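/- **Conventions.** For $i\in\mathbb Z$ put $i'=i-\tfrac12$ and $\mathbb Z'=\{i' : i\in\mathbb Z\}$. Letters are elements of $\mathbb Z\sqcup\mathbb Z'=\tfrac12\mathbb Z$ with the usual order; elements of $\mathbb Z'$ are *primed*. Reversing the prime of a letter interchanges $i\leftrightarrow i'$; *switching the primes* of two letters reverses both primes if exactly one of the letters is primed and does nothing otherwise. A *primed word* is a finite (possibly empty) sequence $a=a_1\cdots a_n$ of letters, of length $\ell(a)=n$; it is a *partial signed permutation* if $\lceil a_1\rceil,\dots,\lceil a_n\rceil$ are distinct. Write $[n]=\{1,\dots,n\}$. A *shifted tableau* of shape $\mu$ ($\mu$ a strict partition) is a map from $\{(i,i+j-1): i\ge 1,\ 1\le j\le\mu_i\}$ to the set of letters; its boxes are the elements of the domain, $(i,j)$ lies in row $i$ and column $j$, and the main diagonal consists of the boxes $(i,i)$. It is *standard* if it has $n$ boxes, its rows and columns are strictly increasing, and each $i\in[n]$ occurs as $i$ or $i'$. **Orthogonal Sagan–Worley insertion.** Given a primed word $a=a_1\cdots a_n$, let $P_0=\emptyset$ and form $P_j$ from $P_{j-1}$ by inserting $u=a_j$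 into the first row, where inserting a letter $u$ into a row or column means the following. If $u\in\mathbb Z$ is inserted into a row, or $u\in\mathbb Z'$ into a column, let $v$ be the first entry of that row or column with $u<v$; otherwise let $v$ be the first entry with $u\le v$ (rows are read by increasing column index, columns by increasing row index). * If no such $v$ exists, add $u$ at the end of the row or column and stop. If $u$ is primed and the new box is on the main diagonal, its entry is changed to $\lceil u\rceil$ and the process is said to end in column insertion; otherwise it ends in row or column insertion according to whether $u$ was being inserted into a row or a column. * If $v$ is not on the main diagonal, replace $v$ by $u$ and insert $v$ into the next row (if $u$ was inserted into a row) or the next column (if $u$ was inserted into a column). * If $v$ is on the main diagonal and $\lceil u\rceil=\lceil v\rceil$, insert $\lceil v\rceil$ into the next column. If $v$ is on the main diagonal and $\lceil u\rceil\ne\lceil v\rceil$, let $\tilde u,\tilde v$ be obtained from $u,v$ by switching their primes, replace $v$ by $\tilde u$, and insert $\tilde v$ into the next column. Set $P^{\mathsf O}_{\mathsf{SW}}(a)=P_n$, and let $Q^{\mathsf O}_{\mathsf{SW}}(a)$ be the shifted tableau of the same shape whose entry in the box added in forming $P_j$ is $j$ if the insertion of $a_j$ ends in row insertion and $j'$ if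 it ends in column insertion. **Orthogonal Knuth operators.** Let $\mathsf{okn}$ act on one- and two-letter words by interchanging, for distinct $X,Y\in\mathbb Z$, $$X\leftrightarrow X',\quad XX\leftrightarrow XX',\quad X'X'\leftrightarrow X'X,\quad XY\leftrightarrow YX,\quad X'Y\leftrightarrow Y'X,\quad XY'\leftrightarrow YX',\quad X'Y'\leftrightarrow Y'X',$$ and on three-letter words by interchanging $ACB\leftrightarrow CAB$ and $YXZ\leftrightarrow YZX$ for all letters with $\lceil A\rceil\le B\le\lceil C\rceil-\tfrac12$ and $X+\tfrac12\le\lceil Y\rceil\le Z$, fixing all other three-letter words. For $i\in\mathbb Z$ and a primed word $a$, set $\mathsf{okn}_i(a)=a$ if $i+2\notin[\ell(a)]$. Otherwise $\mathsf{okn}_{-1}$ applies $\mathsf{okn}$ to the one-letter subword $a_1$, $\mathsf{okn}_0$ applies it to $a_1a_2$, and $\mathsf{okn}_i$ for $i\ge1$ applies it to $a_ia_{i+1}a_{i+2}$, leaving the other letters unchanged. Let $\overset{\mathsf{shK}}{\sim}$ be the transitive closure of the relation $a\sim\mathsf{okn}_i(a)$ ($i\in\mathbb Z$) on primed words. **Dual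 equivalence operators.** Let $T$ be a standard shifted tableau with $n$ boxes, and for $m\in[n]$ let $\square_m$ be the box containing $m$ or $m'$. The word $\mathsf{shword}(T)$ is $C_qR_q\cdots C_2R_2C_1R_1$ with all primes removed, where $C_j$ (respectively $R_j$) is the increasing sequence of primed entries in column $j$ (respectively of unprimed entries in row $j$) and all boxes of $T$ lie in $[q]\times[q]$. For $i\in[n-1]$ form $\mathfrak s_i(T)$ from $T$ as follows. * (a) If $\square_i,\square_{i+1}$ are not in the same row or column, swap $i$ with $i+1$ and $i'$ with $(i+1)'$. * (b) If they are in the same row or column and neither is on the main diagonal, reverse the primes on both entries. * (c) If they are in the same row or column and one is on the main diagonal, reverse the prime on the entry in the other box; then, if $i-1\in[n]$ and $\square_{i-1},\square_{i+1}$ are both on the main diagonal (respectively, if $i+2\in[n]$ and $\square_i,\square_{i+2}$ are both on the main diagonal), switch the primes on the entries in these two diagonal boxes. For $i\in\mathbb Z$ define $\mathfrak d_i(T)=T$ if $i+2\notin[n]$. Otherwise $\mathfrak d_{-1}$ (respectively $\mathfrak d_0$) reverses the prime on the first (respectively second) entry of the first row, and for $i\in[n-2]$ $$\mathfrak d_i(T)=\begin{cases}\mathfrak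 s_i(T)&\text{if } i+2\text{ is between } i\text{ and } i+1\text{ in }\mathsf{shword}(T),\\ \mathfrak s_{i+1}(T)&\text{if } i\text{ is between } i+1\text{ and } i+2\text{ in }\mathsf{shword}(T),\\ T&\text{if } i+1\text{ is between } i\text{ and } i+2\text{ in }\mathsf{shword}(T).\end{cases}$$ **Corollary 5.12.** Suppose $a$ and $b$ are partial signed permutations. Then $a\overset{\mathsf{shK}}{\sim}b$ if and only if $P^{\mathsf O}_{\mathsf{SW}}(a)=P^{\mathsf O}_{\mathsf{SW}}(b)$. Moreover, $Q^{\mathsf O}_{\mathsf{SW}}(\mathsf{okn}_i(a))=\mathfrak d_i(Q^{\mathsf O}_{\mathsf{SW}}(a))$ for all $i\in\mathbb Z$. -/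

import Mathlib

namespace PrimedSW

/-- A letter of the primed alphabet `⋯ < 0' < 0 < 1' < 1 < 2' < 2 < ⋯`: `⟨i, false⟩` is the integer
`i`, and `⟨i, true⟩` is the primed integer `i' = i - 1/2`.  Thus `x.val` is the ceiling of `x`. -/
@[ext]
structure Letter where
  val : ℤ
  primed : Bool

namespace Letter

/-- Twice the half-integer represented by a letter (so `i ↦ 2i` and `i' ↦ 2i - 1`). -/
def twice (x : Letter) : ℤ := 2 * x.val - (if x.primed = true then 1 else 0)

theorem twice_injective : Function.Injective twice := by
  rintro ⟨i, p⟩ ⟨j, q⟩ h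
  cases p <;> cases q <;> simp [twice] at h ⊢ <;> omega

/-- Letters are ordered as half-integers. -/
instance : LinearOrder Letter := LinearOrder.lift' twice twice_injective

/-- Removing the prime: the ceiling of a letter, viewed again as a letter. -/
def unprime (x : Letter) : Letter := ⟨x.val, false⟩

/-- Reversing the prime. -/
def reverse (x : Letter) : Letter := ⟨x.val, !x.primed⟩

/-- Switching the primes of `x` and `y`: both primes are reversed if exactly one of the letters is
primed, and otherwise nothing changes. -/
def switch (x y : Letter) : Letter × Letter :=
  if x.primed ≠ y.primed then (x.reverse, y.reverse) else (x, y)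

end Letter

/-- Primed words. -/
abbrev Word := List Letter

/-- A primed word is a partial signed permutation if its letters are distinct after removing all
primes. -/
def IsPartialSignedPerm (a : Word) : Prop := (a.map Letter.val).Nodup

/-! ### Tableaux -/

/-- A finite filling of boxes `(row, column)` by letters, as a finite partial map.  A shifted tableau
of shape `μ` is such a filling whose domain is `{(i, i + j - 1) : 1 ≤ i, 1 ≤ j ≤ μ i}`; rows and
columns are numbered from `1`. -/
abbrev Tableau := Finmap (fun _ : ℕ × ℕ => Letter)

namespace Tableau

/-- The entry of `T` in a box (only meaningful for boxes of `T`). -/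
def entry (T : Tableau) (b : ℕ × ℕ) : Letter := (T.lookup b).getD ⟨0, false⟩

/-- The number of boxes. -/
def size (T : Tableau) : ℕ := T.keys.card

/-- The smallest `q` such that all boxes of `T` have both coordinates at most `q`. -/
def bound (T : Tableau) : ℕ := T.keys.sup (fun b => max b.1 b.2)

/-- Put the letter `u` into the box `b`, adding the box or replacing its old entry. -/
def set (T : Tableau) (b : ℕ × ℕ) (u : Letter) : Tableau := Finmap.insert b u T

theorem bound_set_of_mem {T : Tableau} {b : ℕ × ℕ} (hb : b ∈ T.keys) (u : Letter) :
    (T.set b u).bound = T.bound := by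
  have h : (T.set b u).keys = T.keys := by
    ext c
    simp only [set, Finmap.mem_keys, Finmap.mem_insert] at hb ⊢
    constructor
    · rintro (rfl | h) <;> assumption
    · exact Or.inr
  rw [bound, h, bound]

end Tableau

/-- Whether an insertion is into a row or into a column. -/
inductive Dir where
  | row
  | col
deriving DecidableEq

namespace Dir

/-- The number of the row (resp. column) containing a box. -/
def line : Dir → ℕ × ℕ → ℕ
  | row, b => b.1
  | col, b => b.2

/-- The place of a box within its row (resp. column). -/
def place : Dir → ℕ × ℕ → ℕ
  | row, b => b.2
  | col, b => b.1

/-- The box in the `k`th row (resp. column) at the given place. -/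
def box : Dir → ℕ → ℕ → ℕ × ℕ
  | row, k, m => (k, m)
  | col, k, m => (m, k)

/-- The first place of the `k`th row (resp. column) of a shifted diagram: the `k`th row starts in
column `k`, and every column starts in row `1`. -/
def start : Dir → ℕ → ℕ
  | row, k => k
  | col, _ => 1

theorem box_line_place (d : Dir) (b : ℕ × ℕ) : d.box (d.line b) (d.place b) = b := by
  cases d <;> rfl

theorem line_le (d : Dir) (b : ℕ × ℕ) : d.line b ≤ max b.1 b.2 := by
  cases d <;> simp [line]

end Dir

/-! ### Orthogonal Sagan-Worley insertion -/

/-- The condition on an entry `v` to be bumped by `u`: it is `u < v` if `u` is unprimed and inserted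
into a row or if `u` is primed and inserted into a column, and `u ≤ v` otherwise. -/
def Bumps (d : Dir) (u v : Letter) : Prop :=
  if (d = Dir.row ∧ u.primed = false) ∨ (d = Dir.col ∧ u.primed = true) then u < v else u ≤ v

instance (d : Dir) (u v : Letter) : Decidable (Bumps d u v) := by
  unfold Bumps; infer_instance

/-- The boxes in the `k`th row (or column) of `T` whose entries satisfy the bumping condition. -/
def candidates (T : Tableau) (d : Dir) (k : ℕ) (u : Letter) : Finset (ℕ × ℕ) :=
  T.keys.filter (fun b => d.line b = k ∧ Bumps d u (T.entry b))

/-- The first of the boxes in `candidates T d k u`. -/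
def bumpedBox (T : Tableau) (d : Dir) (k : ℕ) (u : Letter) (h : (candidates T d k u).Nonempty) :
    ℕ × ℕ :=
  d.box k (((candidates T d k u).image d.place).min' (h.image _))

theorem bumpedBox_mem (T : Tableau) (d : Dir) (k : ℕ) (u : Letter)
    (h : (candidates T d k u).Nonempty) : bumpedBox T d k u h ∈ candidates T d k u := by
  obtain ⟨b, hb, e⟩ := Finset.mem_image.1 (Finset.min'_mem _ (h.image d.place))
  have hk : d.line b = k := (Finset.mem_filter.1 hb).2.1
  have : bumpedBox T d k u h = b := by
    rw [bumpedBox, ← e, ← hk, Dir.box_line_place]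
  rwa [this]

theorem bumpedBox_mem_keys (T : Tableau) (d : Dir) (k : ℕ) (u : Letter)
    (h : (candidates T d k u).Nonempty) : bumpedBox T d k u h ∈ T.keys :=
  (Finset.mem_filter.1 (bumpedBox_mem T d k u h)).1

theorem lt_bound_of_candidates (T : Tableau) (d : Dir) (k : ℕ) (u : Letter)
    (h : (candidates T d k u).Nonempty) : k < T.bound + 1 := by
  obtain ⟨b, hb⟩ := h
  obtain ⟨h1, h2, -⟩ := Finset.mem_filter.1 hb
  have h3 : max b.1 b.2 ≤ T.bound :=
    Finset.le_sup (f := fun b : ℕ × ℕ => max b.1 b.2) h1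
  have := d.line_le b
  omega

/-- The box added at the end of the `k`th row (or column) of a shifted tableau. -/
def endBox (T : Tableau) (d : Dir) (k : ℕ) : ℕ × ℕ :=
  d.box k (d.start k + (T.keys.filter (fun b => d.line b = k)).card)

/-- Insert `u` into the `k`th row or column of `T`, and continue until a box is added.  The result is
the final tableau, the added box, and whether the process ends in row or column insertion. -/
def insertLine (T : Tableau) (d : Dir) (k : ℕ) (u : Letter) : Tableau × (ℕ × ℕ) × Dir :=
  if h : (candidates T d k u).Nonempty then
    if (bumpedBox T d k u h).1 ≠ (bumpedBox T d k u h).2 then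
      -- off the diagonal: the entry moves to the next row or column
      insertLine (T.set (bumpedBox T d k u h) u) d (k + 1) (T.entry (bumpedBox T d k u h))
    else if u.val = (T.entry (bumpedBox T d k u h)).val then
      insertLine T Dir.col (k + 1) (T.entry (bumpedBox T d k u h)).unprime
    else
      insertLine
        (T.set (bumpedBox T d k u h) (u.switch (T.entry (bumpedBox T d k u h))).1)
        Dir.col (k + 1) (u.switch (T.entry (bumpedBox T d k u h))).2
  else if u.primed = true ∧ (endBox T d k).1 = (endBox T d k).2 then
    (T.set (endBox T d k) u.unprime, endBox T d k, Dir.col)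
  else
    (T.set (endBox T d k) u, endBox T d k, d)
termination_by T.bound + 1 - k
decreasing_by
  · have := lt_bound_of_candidates T d k u h
    rw [Tableau.bound_set_of_mem (bumpedBox_mem_keys T d k u h)]
    omega
  · have := lt_bound_of_candidates T d k u h
    omega
  · have := lt_bound_of_candidates T d k u h
    rw [Tableau.bound_set_of_mem (bumpedBox_mem_keys T d k u h)]
    omega

/-- One step of the insertion algorithm: from `(P, Q)` and a letter `x` with label `i`, insert `x` into
the first row of `P`, and put `i` or `i'` in the new box of `Q` according to whether the process ends
in row or column insertion. -/
def swStep (PQ : Tableau × Tableau) (c : Letter × ℕ) : Tableau × Tableau :=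
  let r := insertLine PQ.1 Dir.row 1 c.1
  (r.1, PQ.2.set r.2.1 ⟨(c.2 : ℤ), decide (r.2.2 = Dir.col)⟩)

/-- The pair of tableaux of a primed word `a₁a₂⋯aₙ`, whose letters are labeled `1, 2, …, n`. -/
def sw (a : Word) : Tableau × Tableau := (a.zipIdx 1).foldl swStep (∅, ∅)

/-- The insertion tableau of orthogonal Sagan-Worley insertion. -/
def PSW (a : Word) : Tableau := (sw a).1

/-- The recording tableau of orthogonal Sagan-Worley insertion. -/
def QSW (a : Word) : Tableau := (sw a).2

/-! ### Orthogonal Knuth operators -/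

/-- The operator on primed words with one, two, or three letters. -/
def okn : Word → Word
  | [x] => [x.reverse]
  | [x, y] =>
      if x.val = y.val then [x, y.reverse]
      else [⟨y.val, x.primed⟩, ⟨x.val, y.primed⟩]
  | [x, y, z] =>
      if (x.unprime ≤ z ∧ z < y.unprime) ∨ (y.unprime ≤ z ∧ z < x.unprime) then
        -- `ACB ↔ CAB` where `⌈A⌉ ≤ B ≤ ⌈C⌉ - 1/2`
        [y, x, z]
      else if (y < x.unprime ∧ x.unprime ≤ z) ∨ (z < x.unprime ∧ x.unprime ≤ y) then
        -- `YXZ ↔ YZX` where `X + 1/2 ≤ ⌈Y⌉ ≤ Z`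
        [x, z, y]
      else [x, y, z]
  | a => a

/-- The orthogonal Knuth operators, indexed by all integers. -/
def oknAt (i : ℤ) (a : Word) : Word :=
  if 1 ≤ i + 2 ∧ i + 2 ≤ a.length then
    if i = -1 then okn (a.take 1) ++ a.drop 1
    else if i = 0 then okn (a.take 2) ++ a.drop 2
    else a.take (i.toNat - 1) ++ okn ((a.drop (i.toNat - 1)).take 3) ++ a.drop (i.toNat + 2)
  else a

/-- Orthogonal Knuth equivalence: the transitive closure of the relation `a ∼ oknAt i a`. -/
def ShK : Word → Word → Prop := Relation.TransGen (fun a b => ∃ i : ℤ, b = oknAt i a)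

/-! ### Dual equivalence operators on standard shifted tableaux -/

namespace Tableau

/-- The box of `T` containing `m` or `m'`.  If there is a unique such box, as in a standard tableau,
then the supremum is over a one-element set and equal to its element. -/
def boxOf (T : Tableau) (m : ℤ) : ℕ × ℕ :=
  (T.keys.filter (fun b => (T.entry b).val = m)).sup id

/-- A box is on the main diagonal. -/
abbrev OnDiag (b : ℕ × ℕ) : Prop := b.1 = b.2

/-- Reverse the prime on the entry in the box `b`. -/
def reverseAt (T : Tableau) (b : ℕ × ℕ) : Tableau := T.set b (T.entry b).reverse

/-- Switch the primes on the entries in the boxes `b` and `c`. -/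
def switchAt (T : Tableau) (b c : ℕ × ℕ) : Tableau :=
  if (T.entry b).primed ≠ (T.entry c).primed then (T.reverseAt b).reverseAt c else T

/-- The primed entries in column `j`, with primes removed, in increasing order. -/
def primedCol (T : Tableau) (j : ℕ) : List ℤ :=
  ((T.keys.filter (fun b => b.2 = j ∧ (T.entry b).primed = true)).val.map
    (fun b => (T.entry b).val)).sort (· ≤ ·)

/-- The unprimed entries in row `j`, in increasing order. -/
def unprimedRow (T : Tableau) (j : ℕ) : List ℤ :=
  ((T.keys.filter (fun b => b.1 = j ∧ (T.entry b).primed = false)).val.map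
    (fun b => (T.entry b).val)).sort (· ≤ ·)

/-- The shifted reading word `C_q R_q ⋯ C_2 R_2 C_1 R_1`, with primes removed, where `C_j` lists the
primed entries of column `j` and `R_j` lists the unprimed entries of row `j`. -/
def shword (T : Tableau) : List ℤ :=
  (List.range' 1 T.bound).reverse.flatMap (fun j => T.primedCol j ++ T.unprimedRow j)

/-- The operator `𝔰_i`. -/
def sOp (i : ℤ) (T : Tableau) : Tableau :=
  let b := T.boxOf i
  let c := T.boxOf (i + 1)
  if b.1 ≠ c.1 ∧ b.2 ≠ c.2 then
    (T.set b ⟨i + 1, (T.entry b).primed⟩).set c ⟨i, (T.entry c).primed⟩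
  else if ¬ OnDiag b ∧ ¬ OnDiag c then
    (T.reverseAt b).reverseAt c
  else
    let T' := if OnDiag b then T.reverseAt c else T.reverseAt b
    if 1 ≤ i - 1 ∧ OnDiag (T.boxOf (i - 1)) ∧ OnDiag c then
      T'.switchAt (T.boxOf (i - 1)) c
    else if i + 2 ≤ T.size ∧ OnDiag b ∧ OnDiag (T.boxOf (i + 2)) then
      T'.switchAt b (T.boxOf (i + 2))
    else T'

/-- `y` appears between `x` and `z` in the word `w` (in either order). -/
def Between (w : List ℤ) (x y z : ℤ) : Prop :=
  (w.idxOf x < w.idxOf y ∧ w.idxOf y < w.idxOf z) ∨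
    (w.idxOf z < w.idxOf y ∧ w.idxOf y < w.idxOf x)

instance (w : List ℤ) (x y z : ℤ) : Decidable (Between w x y z) := by
  unfold Between; infer_instance

/-- The dual equivalence operator `𝔡_i`, for any integer `i`. -/
def dOp (i : ℤ) (T : Tableau) : Tableau :=
  if 1 ≤ i + 2 ∧ i + 2 ≤ T.size then
    if i = -1 then T.reverseAt (1, 1)
    else if i = 0 then T.reverseAt (1, 2)
    else if Between T.shword i (i + 2) (i + 1) then sOp i T
    else if Between T.shword (i + 1) i (i + 2) then sOp (i + 1) T
    else T
  else T

end Tableau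

end PrimedSW

/-!
Sagan-Worley insertion is studied by removing the largest letter. Consider a partial signed
permutation with largest letter `m`, and record for each insertion the added box and the final
direction; this list of steps is called the trace of the word, and it is the recording tableau in
another form. Since `m` is larger than all other letters, it only moves out of the way when another
letter arrives in its box. The trace of the word is therefore obtained from the trace of the word
without `m` by a simple transducer, `Push`, whose state is the box of `m` and its prime. Before `m`
is inserted, it is kept at the end of a long virtual row `0`, and its insertion becomes a virtual
step that pushes it out of this row (`Inserted.insert_max`). All statements are proved by induction
on the number of letters along this description.

* Two words that differ by a Knuth move on three letters have the same insertion tableau, and their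
  traces differ by a dual move (`KnuthMove.exists_dualMove`). If `m` takes part in the Knuth move,
  then the traces with a virtual step differ by a swap of two steps; otherwise they differ by a dual
  move by induction. It remains to see that dual moves commute with `Push` (`Push.dualMove`), which
  is a finite analysis of how a box can interact with three others.
* The push preserves the comparison of lanes of consecutive steps (`Push.lane_le_iff`), so that the
  ascents of the word can be read off from the trace (`exists_inserted`). Lanes are the rows and
  columns in the order in which `shword` reads them. With this, the operator `dOp` on the recording
  tableau is identified with the dual move on the trace (`DualMove.dOp_recTab`).
* A push can be undone, and so a word is determined by its insertion tableau and its trace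
  (`Inserted.inj`).
* Any two traces of the same shape are connected by dual moves and by reversing the first two primes
  (`connected_of_adds_eq`).

The orthogonal Knuth operators thus preserve the insertion tableau and act by `dOp` on the recording
tableau (`Inserted.exists_oknAt`). Conversely, if two words have the same insertion tableau, then
their traces have the same shape. A path that connects the traces lifts to a path of Knuth operators
from the first word to a word with the insertion tableau and the trace of the second word, which
must be the second word itself.
-/


namespace PrimedSW

/-! ### Shapes, steps, and the effect of a larger letter -/

/-- A shifted shape, encoded by its free places: `R r` is the first free column of row `r`, and `C
k` is the first free row of column `k`. Rows are numbered from `0`, so that a *virtual row* `0` of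
large length can sit above the shifted diagram whose rows start with `1`. -/
structure Shape where
  R : ℕ → ℕ
  C : ℕ → ℕ

/-- The row and column data of a shape describe the same order ideal of boxes on or above the
diagonal: row `r` starts in column `r`, column `k` ends at the latest in row `k`, and the two ways
to say that `(r, k)` is a box agree. -/
structure Shape.Ok (S : Shape) : Prop where
  hR : ∀ r, r ≤ S.R r
  hC : ∀ k, S.C k ≤ k + 1
  hRC : ∀ r k, r ≤ k → (k < S.R r ↔ r < S.C k)

/-- A step records the box added by one insertion, and whether the insertion ended in column
insertion. -/
abbrev Step := (ℕ × ℕ) × Bool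

/-- The shape with the box `e` added. -/
def Shape.add (S : Shape) (e : ℕ × ℕ) : Shape :=
  ⟨fun r => if r = e.1 then e.2 + 1 else S.R r, fun k => if k = e.2 then e.1 + 1 else S.C k⟩

/-- The box `e` is an outer corner of the shape, so that it can be added. -/
def Shape.Addable (S : Shape) (e : ℕ × ℕ) : Prop := e.1 ≤ e.2 ∧ S.R e.1 = e.2 ∧ S.C e.2 = e.1

theorem Shape.Ok.add {S : Shape} (h : S.Ok) {e} (he : S.Addable e) : (S.add e).Ok := by
  obtain ⟨h1, h2, h3⟩ := h
  obtain ⟨r, k⟩ := e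
  simp only [Addable] at he
  constructor <;> simp only [Shape.add] <;> grind

theorem Shape.Addable.rowEq {S : Shape} {e f} (he : S.Addable e) (hf : S.Addable f) (h : e.1 = f.1)
    : e = f := by
  unfold Addable at *; grind

theorem Shape.Addable.colEq {S : Shape} {e f} (he : S.Addable e) (hf : S.Addable f) (h : e.2 = f.2)
    : e = f := by
  unfold Addable at *; grind

theorem Shape.Addable.lt {S : Shape} (hS : S.Ok) {e f} (he : S.Addable e) (hf : S.Addable f) (h :
    e.1 < f.1) : f.2 < e.2 := by
  obtain ⟨h1, h2, h3⟩ := hS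
  unfold Addable at *
  grind

theorem Shape.Addable.add_ne {S : Shape} {e f} (he : S.Addable e) (hf : S.Addable f) (h : e ≠ f) :
    (S.add e).Addable f := by
  have := he.rowEq hf
  have := he.colEq hf
  unfold Addable add at *
  grind

/-- An addable box after adding `e` was addable before, or is adjacent to `e`. -/
theorem Shape.Addable.of_add {S : Shape} (hS : S.Ok) {e f} (he : S.Addable e) (hf :
    (S.add e).Addable f) :
    (S.Addable f ∧ e ≠ f) ∨ f = (e.1, e.2+1) ∨ f = (e.1 + 1, e.2) := by
  obtain ⟨h1, h2, h3⟩ := hS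
  obtain ⟨r, k⟩ := e
  obtain ⟨r', k'⟩ := f
  simp only [Addable, add] at *
  grind

theorem Shape.Addable.next_row {S : Shape} (hS : S.Ok) {e} (he : S.Addable e) (h : e.1 ≠ e.2) :
    (S.add e).Addable (e.1 + 1, S.R (e.1 + 1)) := by
  obtain ⟨h1, h2, h3⟩ := hS
  obtain ⟨r, k⟩ := e
  simp only [Addable, add] at *
  have := h3 (r+1) (S.R (r+1))
  have := h3 (r) (S.R (r+1))
  have := h3 (r+1) k
  have := h3 r k
  grind

theorem Shape.Addable.next_col {S : Shape} (hS : S.Ok) {e} (he : S.Addable e)  :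
    (S.add e).Addable (S.C (e.2 + 1), e.2 + 1) ∧ S.C (e.2+1) ≤ e.1 := by
  obtain ⟨h1, h2, h3⟩ := hS
  obtain ⟨r, k⟩ := e
  simp only [Addable, add] at *
  have := h3 (S.C (k+1)) (k+1)
  have := h3 (S.C (k+1)) k
  have := h3 (S.C (k+1)-1) (k+1)
  have := h3 r (k+1)
  have := h3 r k
  grind

/-- The lane of a step: the columns and rows are read in the order of `shword`, where row `j` (if
the entry is unprimed) has lane `2 * j`, column `j` (if the entry is primed) has lane `2 * j + 1`,
and larger lanes are read first. -/
def lane (t : Step) : ℕ := if t.2 then 2 * t.1.2 + 1 else 2 * t.1.1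

/-- The effect of the presence of a larger letter on a step. The larger letter is in the box `b`
with prime `p`; without it the step would be `t`; in its presence the step becomes `o` and the
larger letter moves to the box `b'` with prime `p'`. Nothing changes unless `t` wants to use the box
`b`. If it does, the larger letter is bumped: into the next column if `b` is on the diagonal (where
it takes over the prime of the inserted letter) or if the step ends in column insertion, and
otherwise into the next row (where it loses its prime if it arrives on the diagonal). -/
def Push (S : Shape) (b : ℕ × ℕ) (p : Bool) (t o : Step) (b' : ℕ × ℕ) (p' : Bool) : Prop :=
  (t.1 ≠ b ∧ o = t ∧ b' = b ∧ p' = p) ∨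
  (t.1 = b ∧ o.1 = b' ∧ (S.add b).Addable b' ∧
    ((b.1 = b.2 ∧ b'.2 = b.2 + 1 ∧ b'.1 ≤ b.1 ∧ o.2 = true ∧ p' = t.2) ∨
     (b.1 < b.2 ∧ t.2 = true ∧ b'.2 = b.2 + 1 ∧ b'.1 ≤ b.1 ∧ o.2 = true ∧ p' = p) ∨
     (b.1 < b.2 ∧ t.2 = false ∧ b'.1 = b.1 + 1 ∧ b'.2 ≤ b.2 ∧
       ((b'.1 = b'.2 ∧ o.2 = p ∧ p' = false) ∨ (b'.1 < b'.2 ∧ o.2 = false ∧ p' = p)))))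

theorem Push.addable {S b p t o b' p'} (hb : S.Addable b) (ht : S.Addable t.1) (h :
    Push S b p t o b' p') :
    (S.add t.1).Addable b' := by
  unfold Push at h
  rcases h with ⟨h1, rfl, rfl, rfl⟩ | ⟨h1, h2, h3, -⟩
  · exact ht.add_ne hb h1
  · rw [h1]; exact h3

theorem Push.diag {S b p t o b' p'} (hp : b.1 = b.2 → p = false)
    (h : Push S b p t o b' p') : b'.1 = b'.2 → p' = false := by
  unfold Push at h
  grind

/-- Two addable boxes are equal, or one is strictly above and to the right of the other. -/
theorem Shape.Addable.tri {S : Shape} (hS : S.Ok) {e f} (he : S.Addable e) (hf : S.Addable f) :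
    (e.1 = f.1 ∧ e.2 = f.2) ∨ (e.1 < f.1 ∧ f.2 < e.2) ∨ (f.1 < e.1 ∧ e.2 < f.2) := by
  have := he.rowEq hf
  have := he.lt hS hf
  have := hf.lt hS he
  grind

/-- The box `e` belongs to the shape. -/
def Shape.Mem (S : Shape) (e : ℕ × ℕ) : Prop := e.1 ≤ e.2 ∧ e.2 < S.R e.1

theorem Shape.Addable.mem_add {S : Shape} {e} (he : S.Addable e) : (S.add e).Mem e := by
  unfold Addable at he; unfold Mem add; grind

theorem Shape.Mem.add {S : Shape} {e f} (he : S.Mem e) (hf : S.Addable f) : (S.add f).Mem e := by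
  unfold Addable at hf; unfold Mem Shape.add at *; grind

theorem Shape.Addable.not_le {S : Shape} (hS : S.Ok) {e f} (he : S.Addable e) (hf : S.Mem f) :
    e.1 ≤ f.1 → f.2 < e.2 := by
  obtain ⟨h1, h2, h3⟩ := hS
  unfold Addable Mem at *
  have := h3 f.1 f.2
  have := h3 e.1 f.2
  grind

/-- Pushing a larger letter through two consecutive steps preserves the comparison of their lanes.
-/
theorem Push.lane_le_iff {S : Shape} (hS : S.Ok) {b p t1 t2 o1 o2 b1 b2 p1 p2}
   (hb : S.Addable b) (hp : b.1 = b.2 → p = false) (h1 : S.Addable t1.1) (h2 :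
       (S.add t1.1).Addable t2.1)
   (T1 : Push S b p t1 o1 b1 p1) (T2 : Push (S.add t1.1) b1 p1 t2 o2 b2 p2) :
   lane t2 ≤ lane t1 ↔ lane o2 ≤ lane o1 := by
  have hb1 := T1.addable hb h1
  have f1 := h1.of_add hS h2
  have f2 := hb.tri hS h1
  have f3 : S.Addable t2.1 → _ := hb.tri hS
  have f4 := hb1.tri (hS.add h1) h2
  have hb2 := T2.addable hb1 h2
  have c1 := hb1.not_le (hS.add h1) h1.mem_add
  have c2 := hb2.not_le ((hS.add h1).add h2) (h1.mem_add.add h2)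
  have c3 := hb2.not_le ((hS.add h1).add h2) h2.mem_add
  have := h1.1
  have := h2.1
  have := hb.1
  have := hb1.1
  unfold Push at T1 T2
  obtain ⟨⟨r1, k1⟩, q1⟩ := t1
  obtain ⟨⟨r2, k2⟩, q2⟩ := t2
  obtain ⟨⟨u1, v1⟩, w1⟩ := o1
  obtain ⟨⟨u2, v2⟩, w2⟩ := o2
  obtain ⟨x, y⟩ := b
  obtain ⟨x1, y1⟩ := b1
  obtain ⟨x2, y2⟩ := b2
  unfold lane
  simp only [Prod.mk.injEq, ne_eq] at *
  clear hb2 hb hb1 h1 h2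
  rcases T1 with T1 | ⟨_, _, _, T1⟩ <;> rcases T2 with T2 | ⟨_, _, _, T2⟩
  · grind
  · grind
  · grind
  · grind

theorem Shape.add_comm {S : Shape} {e f : ℕ × ℕ} (h1 : e.1 ≠ f.1) (h2 : e.2 ≠ f.2) :
    (S.add e).add f = (S.add f).add e := by
  unfold Shape.add; simp only [Shape.mk.injEq]
  constructor <;> funext x <;> grind

/-- Two steps in different rows and different columns. -/
def Far (s t : Step) : Prop := s.1.1 ≠ t.1.1 ∧ s.1.2 ≠ t.1.2

/-- Two steps in the same row or column, neither of them on the diagonal. -/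
def OffDiagAdj (s t : Step) : Prop := s.1.1 ≠ s.1.2 ∧ t.1.1 ≠ t.1.2 ∧ (s.1.1 = t.1.1 ∨ s.1.2 =
    t.1.2)

/-- The dual equivalence move on three consecutive steps. The side `t` is the one on which the lanes
weakly decrease and then strictly increase. In the five cases, the move swaps the first two or the
last two steps, or reverses the primes of the first two or the last two steps, or acts on three
steps around the diagonal by reversing the prime of the middle one and switching the primes of the
other two. -/
def DualMove (t1 t2 t3 s1 s2 s3 : Step) : Prop :=
 (Far t1 t2 ∧ s1=t2 ∧ s2=t1 ∧ s3=t3 ∧ lane t2 < lane t3 ∧ lane t3 ≤ lane t1) ∨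
 (Far t2 t3 ∧ s1=t1 ∧ s2=t3 ∧ s3=t2 ∧ lane t2 ≤ lane t1 ∧ lane t1 < lane t3) ∨
 (OffDiagAdj t1 t2 ∧ t1.2 = true ∧ t2.2 = false ∧ s1=(t1.1,false) ∧ s2=(t2.1,true) ∧ s3=t3 ∧
     lane t2 < lane t3 ∧ lane t3 ≤ lane t1) ∨
 (OffDiagAdj t2 t3 ∧ t2.2 = false ∧ t3.2 = true ∧ s1=t1 ∧ s2=(t2.1,true) ∧ s3=(t3.1,false) ∧
     lane t2 ≤ lane t1 ∧ lane t1 < lane t3) ∨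
 (t1.1.1 = t1.1.2 ∧ t2.1 = (t1.1.1, t1.1.1+1) ∧ t3.1 = (t1.1.1+1, t1.1.1+1) ∧ t2.2 = false ∧
     s1=(t1.1,t3.2) ∧ s2=(t2.1,true) ∧ s3=(t3.1,t1.2))

/-- The relation `Push` in coordinates, in the form used for case analysis. -/
theorem Push.split {S : Shape} {x y r k u v x' y' : ℕ} {p q w p' : Bool}
    (h : Push S (x, y) p ((r, k), q) ((u, v), w) (x', y') p') :
    (¬ (r = x ∧ k = y) ∧ u = r ∧ v = k ∧ w = q ∧ x' = x ∧ y' = y ∧ p' = p) ∨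
    (r = x ∧ k = y ∧ u = x' ∧ v = y' ∧
    ((y = x ∧ y' = x + 1 ∧ x' ≤ x ∧ w = true ∧ p' = q) ∨
     (x < y ∧ y' = y + 1 ∧ x' ≤ x ∧ q = true ∧ w = true ∧ p' = p) ∨
     (x < y ∧ x' = x + 1 ∧ y' = x + 1 ∧ q = false ∧ w = p ∧ p' = false) ∨
     (x < y ∧ x' = x + 1 ∧ x + 1 < y' ∧ y' ≤ y ∧ q = false ∧ w = false ∧ p' = p))) := by
  unfold Push at h
  simp only [Prod.mk.injEq, ne_eq] at h
  rcases h with h | ⟨h0, h1, -, h⟩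
  · left; simpa [and_assoc] using h
  · right; rcases h with h | h | ⟨h2, h3, h4, h5, h | h⟩ <;> grind

theorem Push.det {S : Shape} {b p t o b' p' o2 b2 p2}
    (h : Push S b p t o b' p') (h' : Push S b p t o2 b2 p2) : o = o2 ∧ b' = b2 ∧ p' = p2 := by
  have key : t.1 = b → (S.add b).Addable b' → (S.add b).Addable b2 → (b'.1 = b2.1 ∨ b'.2 = b2.2)
      → b' = b2 := by
    intro _ h1 h2 h3
    rcases h3 with h3 | h3
    exacts [h1.rowEq h2 h3, h1.colEq h2 h3]
  unfold Push at h h'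
  obtain ⟨o, w⟩ := o
  obtain ⟨o2, w2⟩ := o2
  rcases h with h | ⟨h1, h2, h3, h⟩ <;> rcases h' with h' | ⟨h1', h2', h3', h'⟩
  · grind
  · grind
  · grind
  · have := key h1 h3 h3'
    clear key h3 h3'
    grind

/-- The inequalities between the boxes that take part in three consecutive pushes: they all come
from two addable boxes being comparable, and from an addable box not lying weakly above and to the
left of a box of the shape. -/
theorem Push.facts {S : Shape} (hS : S.Ok) {b p t1 t2 t3 o1 o2 o3 b1 b2 b3 p1 p2 p3}
    (hb : S.Addable b) (hp : b.1 = b.2 → p = false)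
    (h1 : S.Addable t1.1) (h2 : (S.add t1.1).Addable t2.1) (h3 :
        ((S.add t1.1).add t2.1).Addable t3.1)
    (T1 : Push S b p t1 o1 b1 p1) (T2 : Push (S.add t1.1) b1 p1 t2 o2 b2 p2)
    (T3 : Push ((S.add t1.1).add t2.1) b2 p2 t3 o3 b3 p3) :
    ((S.add t1.1).Addable b1 ∧ ((S.add t1.1).add t2.1).Addable b2 ∧
        (((S.add t1.1).add t2.1).add t3.1).Addable b3) ∧
    ((b1.1 = b1.2 → p1 = false) ∧ (b2.1 = b2.2 → p2 = false)) ∧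
    ((b.1 = t1.1.1 ∧ b.2 = t1.1.2) ∨ (b.1 < t1.1.1 ∧ t1.1.2 < b.2) ∨ (t1.1.1 < b.1 ∧ b.2 < t1.1.2))
        ∧
    ((b1.1 = t2.1.1 ∧ b1.2 = t2.1.2) ∨ (b1.1 < t2.1.1 ∧ t2.1.2 < b1.2) ∨ (t2.1.1 < b1.1 ∧
        b1.2 < t2.1.2)) ∧
    ((b2.1 = t3.1.1 ∧ b2.2 = t3.1.2) ∨ (b2.1 < t3.1.1 ∧ t3.1.2 < b2.2) ∨ (t3.1.1 < b2.1 ∧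
        b2.2 < t3.1.2)) ∧
    (b1.1 ≤ t1.1.1 → t1.1.2 < b1.2) ∧
    (b2.1 ≤ t1.1.1 → t1.1.2 < b2.2) ∧ (b2.1 ≤ t2.1.1 → t2.1.2 < b2.2) ∧
    (b3.1 ≤ t1.1.1 → t1.1.2 < b3.2) ∧ (b3.1 ≤ t2.1.1 → t2.1.2 < b3.2) ∧
    (b3.1 ≤ t3.1.1 → t3.1.2 < b3.2) ∧
    (t2.1.1 ≤ t1.1.1 → t1.1.2 < t2.1.2) ∧
    (t3.1.1 ≤ t1.1.1 → t1.1.2 < t3.1.2) ∧ (t3.1.1 ≤ t2.1.1 → t2.1.2 < t3.1.2) ∧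
    t1.1.1 ≤ t1.1.2 ∧ t2.1.1 ≤ t2.1.2 ∧ t3.1.1 ≤ t3.1.2 ∧ b.1 ≤ b.2 ∧ b1.1 ≤ b1.2 ∧
    b2.1 ≤ b2.2 ∧ b3.1 ≤ b3.2 := by
  have hS1 := hS.add h1
  have hS2 := hS1.add h2
  have hS3 := hS2.add h3
  have hb1 := T1.addable hb h1
  have hb2 := T2.addable hb1 h2
  have hb3 := T3.addable hb2 h3
  exact ⟨⟨hb1, hb2, hb3⟩, ⟨T1.diag hp, T2.diag (T1.diag hp)⟩, hb.tri hS h1, hb1.tri hS1 h2,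
    hb2.tri hS2 h3, hb1.not_le hS1 h1.mem_add, hb2.not_le hS2 (h1.mem_add.add h2),
    hb2.not_le hS2 h2.mem_add, hb3.not_le hS3 ((h1.mem_add.add h2).add h3),
    hb3.not_le hS3 (h2.mem_add.add h3), hb3.not_le hS3 h3.mem_add, h2.not_le hS1 h1.mem_add,
    h3.not_le hS2 (h1.mem_add.add h2), h3.not_le hS2 h2.mem_add,
    h1.1, h2.1, h3.1, hb.1, hb1.1, hb2.1, hb3.1⟩

/-! ### Dual moves and a single push -/

set_option maxHeartbeats 8000000 in
/-- A swap of the first two of three steps turns into a dual move when a larger letter is pushed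
through them. As in the four lemmas that follow, the proof splits according to which of the pushes
are bumps, and the inequalities of `Push.facts` settle every combination. -/
theorem Push.dualMove_swap12 {S : Shape} (hS : S.Ok) {b p t1 t2 t3}
   (hb : S.Addable b) (hp : b.1 = b.2 → p = false)
   (h1 : S.Addable t1.1) (h2 : (S.add t1.1).Addable t2.1) (h3 :
       ((S.add t1.1).add t2.1).Addable t3.1)
   (h1' : S.Addable t2.1) (h2' : (S.add t2.1).Addable t1.1)
   (hfar : Far t1 t2)
   (hk : lane t2 < lane t3) (hk' : lane t3 ≤ lane t1)
   {o1 o2 o3 b1 b2 b3 p1 p2 p3}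
   (T1 : Push S b p t1 o1 b1 p1) (T2 : Push (S.add t1.1) b1 p1 t2 o2 b2 p2)
   (T3 : Push ((S.add t1.1).add t2.1) b2 p2 t3 o3 b3 p3)
   {o1' o2' o3' b1' b2' b3' p1' p2' p3'}
   (T1' : Push S b p t2 o1' b1' p1') (T2' : Push (S.add t2.1) b1' p1' t1 o2' b2' p2')
   (T3' : Push ((S.add t2.1).add t1.1) b2' p2' t3 o3' b3' p3') :
   b3' = b3 ∧ p3' = p3 ∧
    DualMove o1 o2 o3 o1' o2' o3' := by
  have hcom : (S.add t1.1).add t2.1 = (S.add t2.1).add t1.1 := Shape.add_comm hfar.1 hfar.2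
  rw [← hcom] at T3'
  have h3' := h3
  rw [hcom] at h3'
  have hS2 := (hS.add h1).add h2
  have hS3 := hS2.add h3
  obtain ⟨⟨hb1, hb2, hb3⟩, ⟨d1, d2⟩, F⟩ := Push.facts hS hb hp h1 h2 h3 T1 T2 T3
  obtain ⟨⟨hb1', hb2', hb3'⟩, ⟨d1', d2'⟩, F'⟩ :=
    Push.facts hS hb hp h1' h2' h3' T1' T2' (hcom ▸ T3')
  rw [← hcom] at hb2' hb3'
  have a1 := h1.tri hS h1'
  have a2 := hb2.tri hS2 hb2'
  have a3 := hb3.tri hS3 hb3'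
  obtain ⟨⟨r1, k1⟩, q1⟩ := t1
  obtain ⟨⟨r2, k2⟩, q2⟩ := t2
  obtain ⟨⟨r3, k3⟩, q3⟩ := t3
  obtain ⟨⟨u1, v1⟩, w1⟩ := o1
  obtain ⟨⟨u2, v2⟩, w2⟩ := o2
  obtain ⟨⟨u3, v3⟩, w3⟩ := o3
  obtain ⟨⟨u1', v1'⟩, w1'⟩ := o1'
  obtain ⟨⟨u2', v2'⟩, w2'⟩ := o2'
  obtain ⟨⟨u3', v3'⟩, w3'⟩ := o3'
  obtain ⟨x, y⟩ := b
  obtain ⟨x1, y1⟩ := b1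
  obtain ⟨x2, y2⟩ := b2
  obtain ⟨x3, y3⟩ := b3
  obtain ⟨x1', y1'⟩ := b1'
  obtain ⟨x2', y2'⟩ := b2'
  obtain ⟨x3', y3'⟩ := b3'
  replace T1 := T1.split
  replace T2 := T2.split
  replace T3 := T3.split
  replace T1' := T1'.split
  replace T2' := T2'.split
  replace T3' := T3'.split
  unfold DualMove lane Far OffDiagAdj at *
  simp only [Prod.mk.injEq, ne_eq] at *
  clear hb hb1 h1 h2 hb2 hb3 hb1' hb2' hb3' h3 h1' h2' h3' hcom hS hS2 hS3
  rcases T1 with ⟨_, _, _, _, _, _, _⟩ | ⟨_, _, _, _, T1⟩ <;>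
    rcases T2 with ⟨_, _, _, _, _, _, _⟩ | ⟨_, _, _, _, T2⟩ <;>
    rcases T1' with ⟨_, _, _, _, _, _, _⟩ | ⟨_, _, _, _, T1'⟩ <;>
    rcases T2' with ⟨_, _, _, _, _, _, _⟩ | ⟨_, _, _, _, T2'⟩ <;>
    try (exfalso; grind)
  all_goals subst_vars
  all_goals rcases T3 with ⟨_, _, _, _, _, _, _⟩ | ⟨_, _, _, _, T3⟩ <;>
    rcases T3' with ⟨_, _, _, _, _, _, _⟩ | ⟨_, _, _, _, T3'⟩ <;>
    try (exfalso; grind)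
  all_goals subst_vars
  all_goals try (rcases T1 with ⟨_, _, _, _, _⟩ | ⟨_, _, _, _, _, _⟩ | ⟨_, _, _, _, _, _⟩ |
      ⟨_, _, _, _, _, _, _⟩ <;>
    try (exfalso; grind))
  all_goals try (rcases T1' with ⟨_, _, _, _, _⟩ | ⟨_, _, _, _, _, _⟩ | ⟨_, _, _, _, _, _⟩ |
      ⟨_, _, _, _, _, _, _⟩ <;>
    try (exfalso; grind))
  all_goals try (rcases T2 with ⟨_, _, _, _, _⟩ | ⟨_, _, _, _, _, _⟩ | ⟨_, _, _, _, _, _⟩ |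
      ⟨_, _, _, _, _, _, _⟩ <;>
    try (exfalso; grind))
  all_goals try (rcases T2' with ⟨_, _, _, _, _⟩ | ⟨_, _, _, _, _, _⟩ | ⟨_, _, _, _, _, _⟩ |
      ⟨_, _, _, _, _, _, _⟩ <;>
    try (exfalso; grind))
  all_goals try (rcases T3 with ⟨_, _, _, _, _⟩ | ⟨_, _, _, _, _, _⟩ | ⟨_, _, _, _, _, _⟩ |
      ⟨_, _, _, _, _, _, _⟩ <;>
    try (exfalso; grind))
  all_goals try (rcases T3' with ⟨_, _, _, _, _⟩ | ⟨_, _, _, _, _, _⟩ | ⟨_, _, _, _, _, _⟩ |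
      ⟨_, _, _, _, _, _, _⟩ <;>
    try (exfalso; grind))
  all_goals subst_vars
  all_goals try grind (splits := 20)
  all_goals simp only [Bool.false_eq_true, if_false, if_true, true_and, and_true, false_and,
      and_false, or_false, false_or, lt_irrefl, le_refl, not_true_eq_false] at *
  all_goals try grind (splits := 60)

set_option maxHeartbeats 8000000 in
theorem Push.dualMove_swap23 {S : Shape} (hS : S.Ok) {b p t1 t2 t3}
    (hb : S.Addable b) (hp : b.1 = b.2 → p = false)
    (h1 : S.Addable t1.1) (h2 : (S.add t1.1).Addable t2.1) (h3 :
        ((S.add t1.1).add t2.1).Addable t3.1)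
    (h2' : (S.add t1.1).Addable t3.1) (h3' : ((S.add t1.1).add t3.1).Addable t2.1)
    (hfar : Far t2 t3) (hk : lane t2 ≤ lane t1) (hk' : lane t1 < lane t3)
    {o1 o2 o3 b1 b2 b3 p1 p2 p3}
    (T1 : Push S b p t1 o1 b1 p1) (T2 : Push (S.add t1.1) b1 p1 t2 o2 b2 p2)
    (T3 : Push ((S.add t1.1).add t2.1) b2 p2 t3 o3 b3 p3)
    {o1' o2' o3' b1' b2' b3' p1' p2' p3'}
    (T1' : Push S b p t1 o1' b1' p1') (T2' : Push (S.add t1.1) b1' p1' t3 o2' b2' p2')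
    (T3' : Push ((S.add t1.1).add t3.1) b2' p2' t2 o3' b3' p3') :
    b3' = b3 ∧ p3' = p3 ∧ DualMove o1 o2 o3 o1' o2' o3' := by
  obtain ⟨rfl, rfl, rfl⟩ := T1.det T1'
  have hcom : ((S.add t1.1).add t2.1).add t3.1 = ((S.add t1.1).add t3.1).add t2.1 :=
    Shape.add_comm hfar.1 hfar.2
  have hS1 := hS.add h1
  have hS3 := (hS1.add h2).add h3
  obtain ⟨⟨hb1, hb2, hb3⟩, ⟨d1, d2⟩, F⟩ := Push.facts hS hb hp h1 h2 h3 T1 T2 T3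
  obtain ⟨⟨hb1', hb2', hb3'⟩, ⟨d1', d2'⟩, F'⟩ := Push.facts hS hb hp h1 h2' h3' T1 T2' T3'
  have a1 := h2.tri hS1 h2'
  have a2 := hb1.tri hS1 h2'
  rw [← hcom] at hb3'
  have a3 := hb3.tri hS3 hb3'
  obtain ⟨⟨r1, k1⟩, q1⟩ := t1
  obtain ⟨⟨r2, k2⟩, q2⟩ := t2
  obtain ⟨⟨r3, k3⟩, q3⟩ := t3
  obtain ⟨⟨u1, v1⟩, w1⟩ := o1
  obtain ⟨⟨u2, v2⟩, w2⟩ := o2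
  obtain ⟨⟨u3, v3⟩, w3⟩ := o3
  obtain ⟨⟨u2', v2'⟩, w2'⟩ := o2'
  obtain ⟨⟨u3', v3'⟩, w3'⟩ := o3'
  obtain ⟨x, y⟩ := b
  obtain ⟨x1, y1⟩ := b1
  obtain ⟨x2, y2⟩ := b2
  obtain ⟨x3, y3⟩ := b3
  obtain ⟨x2', y2'⟩ := b2'
  obtain ⟨x3', y3'⟩ := b3'
  replace T1 := T1.split
  replace T2 := T2.split
  replace T3 := T3.split
  replace T2' := T2'.split
  replace T3' := T3'.split
  unfold DualMove lane Far OffDiagAdj at *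
  simp only [Prod.mk.injEq, ne_eq] at *
  clear hb hb1 h1 h2 hb2 hb3 hb1' hb2' hb3' h3 h2' h3' hcom hS hS1 hS3
  rcases T1 with ⟨_, _, _, _, _, _, _⟩ | ⟨_, _, _, _, T1⟩ <;>
    rcases T2 with ⟨_, _, _, _, _, _, _⟩ | ⟨_, _, _, _, T2⟩ <;>
    rcases T2' with ⟨_, _, _, _, _, _, _⟩ | ⟨_, _, _, _, T2'⟩ <;>
    try (exfalso; grind)
  all_goals subst_vars
  all_goals rcases T3 with ⟨_, _, _, _, _, _, _⟩ | ⟨_, _, _, _, T3⟩ <;>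
    rcases T3' with ⟨_, _, _, _, _, _, _⟩ | ⟨_, _, _, _, T3'⟩ <;>
    try (exfalso; grind)
  all_goals subst_vars
  all_goals try (rcases T1 with ⟨_, _, _, _, _⟩ | ⟨_, _, _, _, _, _⟩ | ⟨_, _, _, _, _, _⟩ |
      ⟨_, _, _, _, _, _, _⟩ <;>
    try (exfalso; grind))
  all_goals try (rcases T2 with ⟨_, _, _, _, _⟩ | ⟨_, _, _, _, _, _⟩ | ⟨_, _, _, _, _, _⟩ |
      ⟨_, _, _, _, _, _, _⟩ <;>
    try (exfalso; grind))
  all_goals try (rcases T2' with ⟨_, _, _, _, _⟩ | ⟨_, _, _, _, _, _⟩ | ⟨_, _, _, _, _, _⟩ |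
      ⟨_, _, _, _, _, _, _⟩ <;>
    try (exfalso; grind))
  all_goals try (rcases T3 with ⟨_, _, _, _, _⟩ | ⟨_, _, _, _, _, _⟩ | ⟨_, _, _, _, _, _⟩ |
      ⟨_, _, _, _, _, _, _⟩ <;>
    try (exfalso; grind))
  all_goals try (rcases T3' with ⟨_, _, _, _, _⟩ | ⟨_, _, _, _, _, _⟩ | ⟨_, _, _, _, _, _⟩ |
      ⟨_, _, _, _, _, _, _⟩ <;>
    try (exfalso; grind))
  all_goals subst_vars
  all_goals grind (splits := 20)

set_option maxHeartbeats 8000000 in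
theorem Push.dualMove_flip12 {S : Shape} (hS : S.Ok) {b p t1 t2 t3}
    (hb : S.Addable b) (hp : b.1 = b.2 → p = false)
    (h1 : S.Addable t1.1) (h2 : (S.add t1.1).Addable t2.1) (h3 :
        ((S.add t1.1).add t2.1).Addable t3.1)
    (hadj : OffDiagAdj t1 t2) (hq1 : t1.2 = true) (hq2 : t2.2 = false)
    (hk : lane t2 < lane t3) (hk' : lane t3 ≤ lane t1)
    {o1 o2 o3 b1 b2 b3 p1 p2 p3}
    (T1 : Push S b p t1 o1 b1 p1) (T2 : Push (S.add t1.1) b1 p1 t2 o2 b2 p2)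
    (T3 : Push ((S.add t1.1).add t2.1) b2 p2 t3 o3 b3 p3)
    {o1' o2' o3' b1' b2' b3' p1' p2' p3'}
    (T1' : Push S b p (t1.1, false) o1' b1' p1') (T2' : Push (S.add t1.1) b1' p1' (t2.1, true)
        o2' b2' p2')
    (T3' : Push ((S.add t1.1).add t2.1) b2' p2' t3 o3' b3' p3') :
    b3' = b3 ∧ p3' = p3 ∧ DualMove o1 o2 o3 o1' o2' o3' := by
  have hS1 := hS.add h1
  have hS2 := hS1.add h2
  have hS3 := hS2.add h3
  obtain ⟨⟨hb1, hb2, hb3⟩, ⟨d1, d2⟩, F⟩ := Push.facts hS hb hp h1 h2 h3 T1 T2 T3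
  obtain ⟨⟨hb1', hb2', hb3'⟩, ⟨d1', d2'⟩, F'⟩ := Push.facts (t1 := (t1.1, false)) (t2 := (t2.1,
      true)) (t3 := t3) hS hb hp h1 h2 h3 T1' T2' T3'
  have a1 := hb1.tri hS1 hb1'
  have a2 := hb2.tri hS2 hb2'
  have a3 := hb3.tri hS3 hb3'
  obtain ⟨⟨r1, k1⟩, q1⟩ := t1
  obtain ⟨⟨r2, k2⟩, q2⟩ := t2
  obtain ⟨⟨r3, k3⟩, q3⟩ := t3
  obtain ⟨⟨u1, v1⟩, w1⟩ := o1
  obtain ⟨⟨u2, v2⟩, w2⟩ := o2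
  obtain ⟨⟨u3, v3⟩, w3⟩ := o3
  obtain ⟨⟨u1', v1'⟩, w1'⟩ := o1'
  obtain ⟨⟨u2', v2'⟩, w2'⟩ := o2'
  obtain ⟨⟨u3', v3'⟩, w3'⟩ := o3'
  obtain ⟨x, y⟩ := b
  obtain ⟨x1, y1⟩ := b1
  obtain ⟨x2, y2⟩ := b2
  obtain ⟨x3, y3⟩ := b3
  obtain ⟨x1', y1'⟩ := b1'
  obtain ⟨x2', y2'⟩ := b2'
  obtain ⟨x3', y3'⟩ := b3'
  replace T1 := T1.split
  replace T2 := T2.split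
  replace T3 := T3.split
  replace T1' := T1'.split
  replace T2' := T2'.split
  replace T3' := T3'.split
  unfold DualMove lane Far OffDiagAdj at *
  simp only [Prod.mk.injEq, ne_eq] at *
  clear hb hb1 h1 h2 hb2 hb3 hb1' hb2' hb3' h3 hS hS1 hS2 hS3
  rcases T1 with ⟨_, _, _, _, _, _, _⟩ | ⟨_, _, _, _, T1⟩ <;>
    rcases T1' with ⟨_, _, _, _, _, _, _⟩ | ⟨_, _, _, _, T1'⟩ <;>
    rcases T2 with ⟨_, _, _, _, _, _, _⟩ | ⟨_, _, _, _, T2⟩ <;>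
    rcases T2' with ⟨_, _, _, _, _, _, _⟩ | ⟨_, _, _, _, T2'⟩ <;>
    try (exfalso; grind)
  all_goals subst_vars
  all_goals rcases T3 with ⟨_, _, _, _, _, _, _⟩ | ⟨_, _, _, _, T3⟩ <;>
    rcases T3' with ⟨_, _, _, _, _, _, _⟩ | ⟨_, _, _, _, T3'⟩ <;>
    try (exfalso; grind)
  all_goals subst_vars
  all_goals try (rcases T1 with ⟨_, _, _, _, _⟩ | ⟨_, _, _, _, _, _⟩ | ⟨_, _, _, _, _, _⟩ |
      ⟨_, _, _, _, _, _, _⟩ <;>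
    try (exfalso; grind))
  all_goals try (rcases T1' with ⟨_, _, _, _, _⟩ | ⟨_, _, _, _, _, _⟩ | ⟨_, _, _, _, _, _⟩ |
      ⟨_, _, _, _, _, _, _⟩ <;>
    try (exfalso; grind))
  all_goals try (rcases T2 with ⟨_, _, _, _, _⟩ | ⟨_, _, _, _, _, _⟩ | ⟨_, _, _, _, _, _⟩ |
      ⟨_, _, _, _, _, _, _⟩ <;>
    try (exfalso; grind))
  all_goals try (rcases T2' with ⟨_, _, _, _, _⟩ | ⟨_, _, _, _, _, _⟩ | ⟨_, _, _, _, _, _⟩ |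
      ⟨_, _, _, _, _, _, _⟩ <;>
    try (exfalso; grind))
  all_goals try (rcases T3 with ⟨_, _, _, _, _⟩ | ⟨_, _, _, _, _, _⟩ | ⟨_, _, _, _, _, _⟩ |
      ⟨_, _, _, _, _, _, _⟩ <;>
    try (exfalso; grind))
  all_goals try (rcases T3' with ⟨_, _, _, _, _⟩ | ⟨_, _, _, _, _, _⟩ | ⟨_, _, _, _, _, _⟩ |
      ⟨_, _, _, _, _, _, _⟩ <;>
    try (exfalso; grind))
  all_goals subst_vars
  all_goals grind (splits := 20)

set_option maxHeartbeats 8000000 in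
theorem Push.dualMove_flip23 {S : Shape} (hS : S.Ok) {b p t1 t2 t3}
    (hb : S.Addable b) (hp : b.1 = b.2 → p = false)
    (h1 : S.Addable t1.1) (h2 : (S.add t1.1).Addable t2.1) (h3 :
        ((S.add t1.1).add t2.1).Addable t3.1)
    (hadj : OffDiagAdj t2 t3) (hq1 : t2.2 = false) (hq2 : t3.2 = true)
    (hk : lane t2 ≤ lane t1) (hk' : lane t1 < lane t3)
    {o1 o2 o3 b1 b2 b3 p1 p2 p3}
    (T1 : Push S b p t1 o1 b1 p1) (T2 : Push (S.add t1.1) b1 p1 t2 o2 b2 p2)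
    (T3 : Push ((S.add t1.1).add t2.1) b2 p2 t3 o3 b3 p3)
    {o1' o2' o3' b1' b2' b3' p1' p2' p3'}
    (T1' : Push S b p t1 o1' b1' p1') (T2' : Push (S.add t1.1) b1' p1' (t2.1, true) o2' b2' p2')
    (T3' : Push ((S.add t1.1).add t2.1) b2' p2' (t3.1, false) o3' b3' p3') :
    b3' = b3 ∧ p3' = p3 ∧ DualMove o1 o2 o3 o1' o2' o3' := by
  have hS1 := hS.add h1
  have hS2 := hS1.add h2
  have hS3 := hS2.add h3
  obtain ⟨⟨hb1, hb2, hb3⟩, ⟨d1, d2⟩, F⟩ := Push.facts hS hb hp h1 h2 h3 T1 T2 T3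
  obtain ⟨⟨hb1', hb2', hb3'⟩, ⟨d1', d2'⟩, F'⟩ := Push.facts (t1 := t1) (t2 := (t2.1, true)) (t3 :=
      (t3.1, false)) hS hb hp h1 h2 h3 T1' T2' T3'
  have a1 := hb1.tri hS1 hb1'
  have a2 := hb2.tri hS2 hb2'
  have a3 := hb3.tri hS3 hb3'
  obtain ⟨⟨r1, k1⟩, q1⟩ := t1
  obtain ⟨⟨r2, k2⟩, q2⟩ := t2
  obtain ⟨⟨r3, k3⟩, q3⟩ := t3
  obtain ⟨⟨u1, v1⟩, w1⟩ := o1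
  obtain ⟨⟨u2, v2⟩, w2⟩ := o2
  obtain ⟨⟨u3, v3⟩, w3⟩ := o3
  obtain ⟨⟨u1', v1'⟩, w1'⟩ := o1'
  obtain ⟨⟨u2', v2'⟩, w2'⟩ := o2'
  obtain ⟨⟨u3', v3'⟩, w3'⟩ := o3'
  obtain ⟨x, y⟩ := b
  obtain ⟨x1, y1⟩ := b1
  obtain ⟨x2, y2⟩ := b2
  obtain ⟨x3, y3⟩ := b3
  obtain ⟨x1', y1'⟩ := b1'
  obtain ⟨x2', y2'⟩ := b2'
  obtain ⟨x3', y3'⟩ := b3'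
  replace T1 := T1.split
  replace T2 := T2.split
  replace T3 := T3.split
  replace T1' := T1'.split
  replace T2' := T2'.split
  replace T3' := T3'.split
  unfold DualMove lane Far OffDiagAdj at *
  simp only [Prod.mk.injEq, ne_eq] at *
  clear hb hb1 h1 h2 hb2 hb3 hb1' hb2' hb3' h3 hS hS1 hS2 hS3
  rcases T1 with ⟨_, _, _, _, _, _, _⟩ | ⟨_, _, _, _, T1⟩ <;>
    rcases T1' with ⟨_, _, _, _, _, _, _⟩ | ⟨_, _, _, _, T1'⟩ <;>
    rcases T2 with ⟨_, _, _, _, _, _, _⟩ | ⟨_, _, _, _, T2⟩ <;>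
    rcases T2' with ⟨_, _, _, _, _, _, _⟩ | ⟨_, _, _, _, T2'⟩ <;>
    try (exfalso; grind)
  all_goals subst_vars
  all_goals rcases T3 with ⟨_, _, _, _, _, _, _⟩ | ⟨_, _, _, _, T3⟩ <;>
    rcases T3' with ⟨_, _, _, _, _, _, _⟩ | ⟨_, _, _, _, T3'⟩ <;>
    try (exfalso; grind)
  all_goals subst_vars
  all_goals try (rcases T1 with ⟨_, _, _, _, _⟩ | ⟨_, _, _, _, _, _⟩ | ⟨_, _, _, _, _, _⟩ |
      ⟨_, _, _, _, _, _, _⟩ <;>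
    try (exfalso; grind))
  all_goals try (rcases T1' with ⟨_, _, _, _, _⟩ | ⟨_, _, _, _, _, _⟩ | ⟨_, _, _, _, _, _⟩ |
      ⟨_, _, _, _, _, _, _⟩ <;>
    try (exfalso; grind))
  all_goals try (rcases T2 with ⟨_, _, _, _, _⟩ | ⟨_, _, _, _, _, _⟩ | ⟨_, _, _, _, _, _⟩ |
      ⟨_, _, _, _, _, _, _⟩ <;>
    try (exfalso; grind))
  all_goals try (rcases T2' with ⟨_, _, _, _, _⟩ | ⟨_, _, _, _, _, _⟩ | ⟨_, _, _, _, _, _⟩ |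
      ⟨_, _, _, _, _, _, _⟩ <;>
    try (exfalso; grind))
  all_goals try (rcases T3 with ⟨_, _, _, _, _⟩ | ⟨_, _, _, _, _, _⟩ | ⟨_, _, _, _, _, _⟩ |
      ⟨_, _, _, _, _, _, _⟩ <;>
    try (exfalso; grind))
  all_goals try (rcases T3' with ⟨_, _, _, _, _⟩ | ⟨_, _, _, _, _, _⟩ | ⟨_, _, _, _, _, _⟩ |
      ⟨_, _, _, _, _, _, _⟩ <;>
    try (exfalso; grind))
  all_goals subst_vars
  all_goals grind (splits := 20)

set_option maxHeartbeats 8000000 in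
theorem Push.dualMove_diag {S : Shape} (hS : S.Ok) {b p t1 t2 t3}
    (hb : S.Addable b) (hp : b.1 = b.2 → p = false)
    (h1 : S.Addable t1.1) (h2 : (S.add t1.1).Addable t2.1) (h3 :
        ((S.add t1.1).add t2.1).Addable t3.1)
    (e1 : t1.1.1 = t1.1.2) (e2 : t2.1 = (t1.1.1, t1.1.1 + 1))
    (e3 : t3.1 = (t1.1.1 + 1, t1.1.1 + 1)) (hq2 : t2.2 = false)
    {o1 o2 o3 b1 b2 b3 p1 p2 p3}
    (T1 : Push S b p t1 o1 b1 p1) (T2 : Push (S.add t1.1) b1 p1 t2 o2 b2 p2)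
    (T3 : Push ((S.add t1.1).add t2.1) b2 p2 t3 o3 b3 p3)
    {o1' o2' o3' b1' b2' b3' p1' p2' p3'}
    (T1' : Push S b p (t1.1, t3.2) o1' b1' p1') (T2' : Push (S.add t1.1) b1' p1' (t2.1, true)
        o2' b2' p2')
    (T3' : Push ((S.add t1.1).add t2.1) b2' p2' (t3.1, t1.2) o3' b3' p3') :
    b3' = b3 ∧ p3' = p3 ∧ DualMove o1 o2 o3 o1' o2' o3' := by
  have hS1 := hS.add h1
  have hS2 := hS1.add h2
  have hS3 := hS2.add h3
  obtain ⟨⟨hb1, hb2, hb3⟩, ⟨d1, d2⟩, F⟩ := Push.facts hS hb hp h1 h2 h3 T1 T2 T3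
  obtain ⟨⟨hb1', hb2', hb3'⟩, ⟨d1', d2'⟩, F'⟩ := Push.facts (t1 := (t1.1, t3.2)) (t2 := (t2.1,
      true)) (t3 := (t3.1, t1.2)) hS hb hp h1 h2 h3 T1' T2' T3'
  have a1 := hb1.tri hS1 hb1'
  have a2 := hb2.tri hS2 hb2'
  have a3 := hb3.tri hS3 hb3'
  obtain ⟨⟨r1, k1⟩, q1⟩ := t1
  obtain ⟨⟨r2, k2⟩, q2⟩ := t2
  obtain ⟨⟨r3, k3⟩, q3⟩ := t3
  obtain ⟨⟨u1, v1⟩, w1⟩ := o1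
  obtain ⟨⟨u2, v2⟩, w2⟩ := o2
  obtain ⟨⟨u3, v3⟩, w3⟩ := o3
  obtain ⟨⟨u1', v1'⟩, w1'⟩ := o1'
  obtain ⟨⟨u2', v2'⟩, w2'⟩ := o2'
  obtain ⟨⟨u3', v3'⟩, w3'⟩ := o3'
  obtain ⟨x, y⟩ := b
  obtain ⟨x1, y1⟩ := b1
  obtain ⟨x2, y2⟩ := b2
  obtain ⟨x3, y3⟩ := b3
  obtain ⟨x1', y1'⟩ := b1'
  obtain ⟨x2', y2'⟩ := b2'
  obtain ⟨x3', y3'⟩ := b3'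
  replace T1 := T1.split
  replace T2 := T2.split
  replace T3 := T3.split
  replace T1' := T1'.split
  replace T2' := T2'.split
  replace T3' := T3'.split
  unfold DualMove lane Far OffDiagAdj at *
  simp only [Prod.mk.injEq, ne_eq] at *
  clear hb hb1 h1 h2 hb2 hb3 hb1' hb2' hb3' h3 hS hS1 hS2 hS3
  rcases T1 with ⟨_, _, _, _, _, _, _⟩ | ⟨_, _, _, _, T1⟩ <;>
    rcases T1' with ⟨_, _, _, _, _, _, _⟩ | ⟨_, _, _, _, T1'⟩ <;>
    rcases T2 with ⟨_, _, _, _, _, _, _⟩ | ⟨_, _, _, _, T2⟩ <;>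
    rcases T2' with ⟨_, _, _, _, _, _, _⟩ | ⟨_, _, _, _, T2'⟩ <;>
    try (exfalso; grind)
  all_goals subst_vars
  all_goals rcases T3 with ⟨_, _, _, _, _, _, _⟩ | ⟨_, _, _, _, T3⟩ <;>
    rcases T3' with ⟨_, _, _, _, _, _, _⟩ | ⟨_, _, _, _, T3'⟩ <;>
    try (exfalso; grind)
  all_goals subst_vars
  all_goals try (rcases T1 with ⟨_, _, _, _, _⟩ | ⟨_, _, _, _, _, _⟩ | ⟨_, _, _, _, _, _⟩ |
      ⟨_, _, _, _, _, _, _⟩ <;>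
    try (exfalso; grind))
  all_goals try (rcases T1' with ⟨_, _, _, _, _⟩ | ⟨_, _, _, _, _, _⟩ | ⟨_, _, _, _, _, _⟩ |
      ⟨_, _, _, _, _, _, _⟩ <;>
    try (exfalso; grind))
  all_goals try (rcases T2 with ⟨_, _, _, _, _⟩ | ⟨_, _, _, _, _, _⟩ | ⟨_, _, _, _, _, _⟩ |
      ⟨_, _, _, _, _, _, _⟩ <;>
    try (exfalso; grind))
  all_goals try (rcases T2' with ⟨_, _, _, _, _⟩ | ⟨_, _, _, _, _, _⟩ | ⟨_, _, _, _, _, _⟩ |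
      ⟨_, _, _, _, _, _, _⟩ <;>
    try (exfalso; grind))
  all_goals try (rcases T3 with ⟨_, _, _, _, _⟩ | ⟨_, _, _, _, _, _⟩ | ⟨_, _, _, _, _, _⟩ |
      ⟨_, _, _, _, _, _, _⟩ <;>
    try (exfalso; grind))
  all_goals subst_vars
  all_goals grind (splits := 20)

/-- Dual moves commute with pushing a larger letter: the letter ends in the same place with the same
prime, and the two outputs again differ by a dual move. -/
theorem Push.dualMove {S : Shape} (hS : S.Ok) {b p t1 t2 t3 s1 s2 s3}
    (hb : S.Addable b) (hp : b.1 = b.2 → p = false)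
    (h1 : S.Addable t1.1) (h2 : (S.add t1.1).Addable t2.1)
    (h3 : ((S.add t1.1).add t2.1).Addable t3.1)
    (h1' : S.Addable s1.1) (h2' : (S.add s1.1).Addable s2.1)
    (h3' : ((S.add s1.1).add s2.1).Addable s3.1)
    (hts : DualMove t1 t2 t3 s1 s2 s3)
    {o1 o2 o3 b1 b2 b3 p1 p2 p3}
    (T1 : Push S b p t1 o1 b1 p1) (T2 : Push (S.add t1.1) b1 p1 t2 o2 b2 p2)
    (T3 : Push ((S.add t1.1).add t2.1) b2 p2 t3 o3 b3 p3)
    {o1' o2' o3' b1' b2' b3' p1' p2' p3'}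
    (T1' : Push S b p s1 o1' b1' p1') (T2' : Push (S.add s1.1) b1' p1' s2 o2' b2' p2')
    (T3' : Push ((S.add s1.1).add s2.1) b2' p2' s3 o3' b3' p3') :
    b3' = b3 ∧ p3' = p3 ∧ DualMove o1 o2 o3 o1' o2' o3' := by
  rcases hts with ⟨hf, rfl, rfl, rfl, hk, hk'⟩ | ⟨hf, rfl, rfl, rfl, hk, hk'⟩ |
    ⟨ha, hq, hq', rfl, rfl, rfl, hk, hk'⟩ | ⟨ha, hq, hq', rfl, rfl, rfl, hk, hk'⟩ |
    ⟨e1, e2, e3, hq, rfl, rfl, rfl⟩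
  · exact Push.dualMove_swap12 hS hb hp h1 h2 h3 h1' h2' hf hk hk' T1 T2 T3 T1' T2' T3'
  · exact Push.dualMove_swap23 hS hb hp h1 h2 h3 h2' h3' hf hk hk' T1 T2 T3 T1' T2' T3'
  · exact Push.dualMove_flip12 hS hb hp h1 h2 h3 ha hq hq' hk hk' T1 T2 T3 T1' T2' T3'
  · exact Push.dualMove_flip23 hS hb hp h1 h2 h3 ha hq hq' hk hk' T1 T2 T3 T1' T2' T3'
  · exact Push.dualMove_diag hS hb hp h1 h2 h3 e1 e2 e3 hq T1 T2 T3 T1' T2' T3'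

theorem DualMove.add_eq {S : Shape} {t1 t2 t3 s1 s2 s3 : Step} (h : DualMove t1 t2 t3 s1 s2 s3) :
    ((S.add s1.1).add s2.1).add s3.1 = ((S.add t1.1).add t2.1).add t3.1 := by
  rcases h with ⟨hf, rfl, rfl, rfl, -⟩ | ⟨hf, rfl, rfl, rfl, -⟩ |
    ⟨-, -, -, rfl, rfl, rfl, -⟩ | ⟨-, -, -, rfl, rfl, rfl, -⟩ | ⟨-, -, -, -, rfl, rfl, rfl⟩
  · rw [Shape.add_comm hf.1 hf.2]
  · rw [Shape.add_comm hf.1 hf.2]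
  all_goals rfl

/-! ### Lists of steps -/

/-- The shape after a list of steps. -/
def Shape.adds (S : Shape) (l : List Step) : Shape := l.foldl (fun S t => S.add t.1) S

/-- Every step of the list adds a box that is addable when its turn comes. -/
def Shape.Chain : Shape → List Step → Prop
  | _, [] => True
  | S, t :: l => S.Addable t.1 ∧ (S.add t.1).Chain l

@[simp] theorem Shape.adds_nil (S : Shape) : S.adds [] = S := rfl

@[simp] theorem Shape.adds_cons (S : Shape) (t : Step) (l : List Step) :
    S.adds (t :: l) = (S.add t.1).adds l := rfl

@[simp] theorem Shape.adds_append (S : Shape) (l l' : List Step) :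
    S.adds (l ++ l') = (S.adds l).adds l' := by simp [Shape.adds]

@[simp] theorem Shape.chain_nil (S : Shape) : S.Chain [] := trivial

@[simp] theorem Shape.chain_cons {S : Shape} {t : Step} {l : List Step} :
    S.Chain (t :: l) ↔ S.Addable t.1 ∧ (S.add t.1).Chain l := Iff.rfl

@[simp] theorem Shape.chain_append {S : Shape} {l l' : List Step} :
    S.Chain (l ++ l') ↔ S.Chain l ∧ (S.adds l).Chain l' := by
  induction l generalizing S with
  | nil => simp
  | cons t l ih => simp [ih, and_assoc]

theorem Shape.Ok.adds {S : Shape} (hS : S.Ok) {l : List Step} (hl : S.Chain l) : (S.adds l).Ok := by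
  induction l generalizing S with
  | nil => exact hS
  | cons t l ih => exact ih (hS.add hl.1) hl.2

/-- A larger letter pushed through a list of steps, one after the other. -/
inductive PushList : Shape → ℕ × ℕ → Bool → List Step → List Step → ℕ × ℕ → Bool → Prop
  | nil (S b p) : PushList S b p [] [] b p
  | cons {S b p t o b1 p1 l ol b' p'} : Push S b p t o b1 p1 →
      PushList (S.add t.1) b1 p1 l ol b' p' → PushList S b p (t :: l) (o :: ol) b' p'

namespace PushList

theorem append {S b p l o b1 p1 l' o' b' p'} (h : PushList S b p l o b1 p1)
    (h' : PushList (S.adds l) b1 p1 l' o' b' p') : PushList S b p (l ++ l') (o ++ o') b' p' := by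
  induction h with
  | nil => exact h'
  | cons h1 _ ih => exact .cons h1 (ih h')

theorem split {S b p l l' o b' p'} (h : PushList S b p (l ++ l') o b' p') :
    ∃ o1 o2 b1 p1, o = o1 ++ o2 ∧ PushList S b p l o1 b1 p1 ∧
      PushList (S.adds l) b1 p1 l' o2 b' p' := by
  induction l generalizing S b p o with
  | nil => exact ⟨[], o, b, p, rfl, .nil _ _ _, h⟩
  | cons t l ih =>
    cases h with
    | cons h1 h2 =>
      obtain ⟨o1, o2, b2, p2, rfl, h3, h4⟩ := ih h2
      exact ⟨_ :: o1, o2, b2, p2, rfl, .cons h1 h3, h4⟩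

theorem length_eq {S b p l o b' p'} (h : PushList S b p l o b' p') : o.length = l.length := by
  induction h with
  | nil => rfl
  | cons _ _ ih => simp [ih]

theorem det {S b p l o b' p' o2 b2 p2} (h : PushList S b p l o b' p')
    (h' : PushList S b p l o2 b2 p2) : o = o2 ∧ b' = b2 ∧ p' = p2 := by
  induction h generalizing o2 with
  | nil => cases h'; simp
  | cons h1 _ ih =>
    cases h' with
    | cons h1' h2' =>
      obtain ⟨rfl, rfl, rfl⟩ := h1.det h1'
      obtain ⟨rfl, rfl, rfl⟩ := ih h2'
      simp

theorem addable {S b p l o b' p'} (h : PushList S b p l o b' p') (hl : S.Chain l)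
    (hb : S.Addable b) : (S.adds l).Addable b' := by
  induction h with
  | nil => exact hb
  | cons h1 _ ih => exact ih hl.2 (h1.addable hb hl.1)

theorem diag {S b p l o b' p'} (h : PushList S b p l o b' p') (hp : b.1 = b.2 → p = false) :
    b'.1 = b'.2 → p' = false := by
  induction h with
  | nil => exact hp
  | cons h1 _ ih => exact ih (h1.diag hp)

theorem _root_.PrimedSW.Push.chain_out {S b p t o b' p'} (h : Push S b p t o b' p')
    (hb : S.Addable b) (ht : S.Addable t.1) :
    (S.add b).Addable o.1 ∧ (S.add b).add o.1 = (S.add t.1).add b' := by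
  rcases h with ⟨h1, rfl, rfl, rfl⟩ | ⟨h1, h2, h3, -⟩
  · exact ⟨hb.add_ne ht (Ne.symm h1), Shape.add_comm (fun h => h1 (ht.rowEq hb h.symm))
      (fun h => h1 (ht.colEq hb h.symm))⟩
  · rw [h2, h1]; exact ⟨h3, rfl⟩

theorem chain_out {S b p l o b' p'} (h : PushList S b p l o b' p') (hl : S.Chain l)
    (hb : S.Addable b) : (S.add b).Chain o ∧ (S.add b).adds o = (S.adds l).add b' := by
  induction h with
  | nil => simp
  | cons h1 _ ih =>
    obtain ⟨h3, h4⟩ := h1.chain_out hb hl.1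
    obtain ⟨h5, h6⟩ := ih hl.2 (h1.addable hb hl.1)
    simp only [Shape.chain_cons, Shape.adds_cons, h4]
    exact ⟨⟨h3, h5⟩, h6⟩

end PushList

/-- Consecutive letters of a word increase if and only if the lanes of the corresponding steps
weakly decrease. -/
def Ascents : List ℤ → List Step → Prop
  | x :: y :: w, s :: t :: l => (x < y ↔ lane t ≤ lane s) ∧ Ascents (y :: w) (t :: l)
  | _, _ => True

theorem PushList.ascents {S b p l o b' p'} (h : PushList S b p l o b' p') (hS : S.Ok)
    (hl : S.Chain l) (hb : S.Addable b) (hp : b.1 = b.2 → p = false) {w : List ℤ}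
    (hw : Ascents w l) : Ascents w o := by
  induction h generalizing w with
  | nil => exact hw
  | cons h1 h2 ih =>
    match w with
    | [] => simp [Ascents]
    | [x] => simp [Ascents]
    | x :: y :: w =>
      cases h2 with
      | nil => simp [Ascents]
      | cons h3 h4 =>
        exact ⟨hw.1.trans (h1.lane_le_iff hS hb hp hl.1 hl.2.1 h3),
          ih (hS.add hl.1) hl.2 (h1.addable hb hl.1) (h1.diag hp) hw.2⟩

theorem Ascents.of_append {w w' : List ℤ} {l l' : List Step} (h : Ascents (w ++ w') (l ++ l'))
    (hlen : w.length = l.length) : Ascents w' l' := by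
  induction w generalizing l with
  | nil =>
    have : l = [] := List.length_eq_zero_iff.1 hlen.symm
    subst this; exact h
  | cons x w ih =>
    match l with
    | [] => simp at hlen
    | t :: l =>
      apply ih (l := l) _ (by simpa using hlen)
      simp only [List.cons_append] at h
      generalize w ++ w' = W at *
      generalize l ++ l' = L at *
      match W, L with
      | [], _ => simp [Ascents]
      | [_], _ => simp [Ascents]
      | _ :: _ :: _, [] => simp [Ascents]
      | y :: W, t :: L => exact h.2

/-- A largest letter is compatible with a step whose lane is smaller than all the others. -/
theorem Ascents.insert_max {w w' : List ℤ} {l l' : List Step} {m : ℤ} {t0 : Step}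
    (hlen : w.length = l.length) (hlt : ∀ x ∈ w ++ w', x < m) (hlane : lane t0 = 0)
    (hl : ∀ t ∈ l ++ l', 0 < lane t) (h : Ascents (w ++ w') (l ++ l')) :
    Ascents (w ++ m :: w') (l ++ t0 :: l') := by
  induction w generalizing l with
  | nil =>
    have : l = [] := List.length_eq_zero_iff.1 hlen.symm
    subst this
    match w', l' with
    | [], _ => simp [Ascents]
    | _ :: _, [] => simp [Ascents]
    | y :: W, t :: L =>
      simp only [List.nil_append, Ascents] at *
      refine ⟨?_, h⟩
      have := hlt y (by simp)
      have := hl t (by simp)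
      omega
  | cons x w ih =>
    match l with
    | [] => simp at hlen
    | t :: l =>
      have hlen' : w.length = l.length := by simpa using hlen
      have h1 : Ascents (w ++ w') (l ++ l') := Ascents.of_append (w := [x]) (l := [t]) h rfl
      have h2 := ih hlen' (fun z hz => hlt z (by simp at hz ⊢; tauto))
        (fun z hz => hl z (by simp at hz ⊢; tauto)) h1
      match w, l with
      | [], [] =>
        have := hlt x (by simp)
        exact ⟨by simp [this, hlane], h2⟩
      | y :: w, u :: l => exact ⟨h.1, h2⟩

theorem PushList.dualMove {S : Shape} (hS : S.Ok) {b p t1 t2 t3 s1 s2 s3 l1 l2}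
    (hb : S.Addable b) (hp : b.1 = b.2 → p = false)
    (hl : S.Chain (l1 ++ t1 :: t2 :: t3 :: l2)) (hl' : S.Chain (l1 ++ s1 :: s2 :: s3 :: l2))
    (hts : DualMove t1 t2 t3 s1 s2 s3) {o o' b1 p1 b2 p2}
    (T : PushList S b p (l1 ++ t1 :: t2 :: t3 :: l2) o b1 p1)
    (T' : PushList S b p (l1 ++ s1 :: s2 :: s3 :: l2) o' b2 p2) :
    b2 = b1 ∧ p2 = p1 ∧ ∃ k1 u1 u2 u3 v1 v2 v3 k2, k1.length = l1.length ∧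
      o = k1 ++ u1 :: u2 :: u3 :: k2 ∧ o' = k1 ++ v1 :: v2 :: v3 :: k2 ∧
      DualMove u1 u2 u3 v1 v2 v3 := by
  obtain ⟨k1, r, c, q, rfl, A1, A2⟩ := T.split
  obtain ⟨k1', r', c', q', rfl, A1', A2'⟩ := T'.split
  obtain ⟨rfl, rfl, rfl⟩ := A1.det A1'
  rw [Shape.chain_append] at hl hl'
  have hS1 := hS.adds hl.1
  have hb1 := A1.addable hl.1 hb
  have hp1 := A1.diag hp
  rcases A2 with _ | ⟨T1, _ | ⟨T2, _ | ⟨T3, T4⟩⟩⟩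
  rcases A2' with _ | ⟨T1', _ | ⟨T2', _ | ⟨T3', T4'⟩⟩⟩
  obtain ⟨rfl, rfl, hD⟩ := Push.dualMove hS1 hb1 hp1 hl.2.1 hl.2.2.1 hl.2.2.2.1 hl'.2.1 hl'.2.2.1
    hl'.2.2.2.1 hts T1 T2 T3 T1' T2' T3'
  rw [hts.add_eq] at T4'
  obtain ⟨rfl, rfl, rfl⟩ := T4.det T4'
  exact ⟨rfl, rfl, k1, _, _, _, _, _, _, _, A1.length_eq, rfl, rfl, hD⟩

/-! ### Tableaux of a given shape -/

theorem Letter.lt_iff_twice {x y : Letter} : x < y ↔ x.twice < y.twice := Iff.rfl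

theorem Letter.le_iff_twice {x y : Letter} : x ≤ y ↔ x.twice ≤ y.twice := Iff.rfl

theorem Letter.lt_of_val_lt {x y : Letter} (h : x.val < y.val) : x < y := by
  rw [lt_iff_twice]; unfold twice; split_ifs <;> omega

theorem bumps_of_val_lt {d : Dir} {u v : Letter} (h : u.val < v.val) : Bumps d u v := by
  unfold Bumps
  split_ifs
  exacts [Letter.lt_of_val_lt h, (Letter.lt_of_val_lt h).le]

theorem not_bumps_of_val_lt {d : Dir} {u v : Letter} (h : v.val < u.val) : ¬ Bumps d u v := by
  unfold Bumps
  split_ifs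
  exacts [(Letter.lt_of_val_lt h).asymm, (Letter.lt_of_val_lt h).not_ge]

namespace Tableau

theorem mem_keys_set {T : Tableau} {b c : ℕ × ℕ} {u : Letter} :
    c ∈ (T.set b u).keys ↔ c = b ∨ c ∈ T.keys := by
  simp [set, Finmap.mem_keys, Finmap.mem_insert]

theorem keys_set (T : Tableau) (b : ℕ × ℕ) (u : Letter) :
    (T.set b u).keys = insert b T.keys := by
  ext c; rw [mem_keys_set, Finset.mem_insert]

@[simp] theorem entry_set_self (T : Tableau) (b : ℕ × ℕ) (u : Letter) : (T.set b u).entry b = u :=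
    by
  simp [set, entry]

theorem entry_set_of_ne (T : Tableau) {b c : ℕ × ℕ} (u : Letter) (h : c ≠ b) :
    (T.set b u).entry c = T.entry c := by
  simp [set, entry, Finmap.lookup_insert_of_ne _ h]

theorem set_comm (T : Tableau) {b c : ℕ × ℕ} (u v : Letter) (h : b ≠ c) :
    (T.set b u).set c v = (T.set c v).set b u :=
  Finmap.insert_insert_of_ne _ h

@[simp] theorem set_set (T : Tableau) (b : ℕ × ℕ) (u v : Letter) :
    (T.set b u).set b v = T.set b v := Finmap.insert_insert _

/-- The boxes of a tableau are those of the shape, except for the virtual row `0`. -/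
def HasShape (T : Tableau) (S : Shape) : Prop := ∀ b, b ∈ T.keys ↔ 1 ≤ b.1 ∧ S.Mem b

/-- All entries have absolute value `val` less than `M`. -/
def ValsLT (T : Tableau) (M : ℤ) : Prop := ∀ b ∈ T.keys, (T.entry b).val < M

theorem HasShape.set_mem {T : Tableau} {S : Shape} (h : T.HasShape S) {b : ℕ × ℕ} {u : Letter}
    (hb : b ∈ T.keys) : (T.set b u).HasShape S := by
  intro c
  rw [mem_keys_set, ← h c]
  constructor
  · rintro (rfl | h) <;> assumption
  · exact Or.inr

theorem HasShape.set_addable {T : Tableau} {S : Shape} (h : T.HasShape S) {b : ℕ × ℕ} {u : Letter}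
    (hb : S.Addable b) (hb1 : 1 ≤ b.1) : (T.set b u).HasShape (S.add b) := by
  intro c
  rw [mem_keys_set, h c]
  unfold Shape.Addable at hb
  unfold Shape.Mem Shape.add
  obtain ⟨r, k⟩ := b
  obtain ⟨r', k'⟩ := c
  simp only [Prod.mk.injEq] at *
  grind

theorem HasShape.not_mem {T : Tableau} {S : Shape} (h : T.HasShape S) {b : ℕ × ℕ}
    (hb : S.Addable b) : b ∉ T.keys := by
  rw [h b]
  unfold Shape.Addable at hb
  unfold Shape.Mem
  omega

theorem ValsLT.set {T : Tableau} {M : ℤ} (h : T.ValsLT M) {b : ℕ × ℕ} {u : Letter}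
    (hu : u.val < M) : (T.set b u).ValsLT M := by
  intro c hc
  by_cases hcb : c = b
  · subst hcb; simpa using hu
  · rw [entry_set_of_ne _ _ hcb]
    exact h c (by rw [mem_keys_set] at hc; tauto)

theorem HasShape.endBox_row {T : Tableau} {S : Shape} (h : T.HasShape S) (hS : S.Ok) {k : ℕ}
    (hk : 1 ≤ k) : endBox T .row k = (k, S.R k) := by
  have : T.keys.filter (fun b => Dir.row.line b = k) = (Finset.Ico k (S.R k)).image (fun x => (k,
      x)) := by
    ext ⟨r, c⟩
    rw [Finset.mem_filter, h (r, c)]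
    simp only [Dir.line, Shape.Mem, Finset.mem_image, Finset.mem_Ico, Prod.mk.injEq]
    constructor
    · rintro ⟨h3, rfl⟩
      exact ⟨c, by grind, by simp⟩
    · rintro ⟨a, h3, rfl, rfl⟩
      grind
  rw [endBox, this, Finset.card_image_of_injective _ (fun _ _ h => (Prod.mk.inj h).2)]
  have := hS.hR k
  simp only [Dir.box, Dir.start, Nat.card_Ico, Prod.mk.injEq, true_and]
  omega

theorem HasShape.endBox_col {T : Tableau} {S : Shape} (h : T.HasShape S) (hS : S.Ok) {k : ℕ}
    (hk : 1 ≤ S.C k) : endBox T .col k = (S.C k, k) := by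
  have : T.keys.filter (fun b => Dir.col.line b = k) = (Finset.Ico 1 (S.C k)).image (fun x => (x,
      k)) := by
    ext ⟨r, c⟩
    have h1 := hS.hRC r k
    have h2 := hS.hC k
    rw [Finset.mem_filter, h (r, c)]
    simp only [Dir.line, Shape.Mem, Finset.mem_image, Finset.mem_Ico, Prod.mk.injEq]
    constructor
    · rintro ⟨h3, rfl⟩
      exact ⟨r, by grind, by simp⟩
    · rintro ⟨a, h3, rfl, rfl⟩
      grind
  rw [endBox, this, Finset.card_image_of_injective _ (fun _ _ h => (Prod.mk.inj h).1)]
  simp only [Dir.box, Dir.start, Nat.card_Ico, Prod.mk.injEq, and_true]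
  omega

end Tableau

theorem Dir.place_lt {S : Shape} (hS : S.Ok) {d : Dir} {b c : ℕ × ℕ} (hb : S.Addable b)
    (hc : S.Mem c) (h : d.line c = d.line b) : d.place c < d.place b := by
  have := hS.hRC c.1 c.2
  unfold Shape.Addable at hb
  unfold Shape.Mem at hc
  cases d <;> simp only [Dir.line, Dir.place] at * <;> grind

theorem mem_candidates {T : Tableau} {d : Dir} {k : ℕ} {u : Letter} {b : ℕ × ℕ} :
    b ∈ candidates T d k u ↔ b ∈ T.keys ∧ d.line b = k ∧ Bumps d u (T.entry b) := by
  simp [candidates]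

theorem bumpedBox_le {T : Tableau} {d : Dir} {k : ℕ} {u : Letter}
    (h : (candidates T d k u).Nonempty) {c : ℕ × ℕ} (hc : c ∈ candidates T d k u) :
    d.place (bumpedBox T d k u h) ≤ d.place c := by
  have : d.place (bumpedBox T d k u h) = ((candidates T d k u).image d.place).min' (h.image _) := by
    unfold bumpedBox; cases d <;> rfl
  rw [this]
  exact Finset.min'_le _ _ (Finset.mem_image_of_mem _ hc)

theorem bumpedBox_eq {T : Tableau} {d : Dir} {k : ℕ} {u : Letter}
    (h : (candidates T d k u).Nonempty) {c : ℕ × ℕ} (hc : c ∈ candidates T d k u)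
    (hle : ∀ c' ∈ candidates T d k u, d.place c ≤ d.place c') : bumpedBox T d k u h = c := by
  have hm := bumpedBox_mem T d k u h
  have h1 := bumpedBox_le h hc
  have h2 := hle _ hm
  rw [mem_candidates] at hm hc
  rw [← d.box_line_place (bumpedBox T d k u h), ← d.box_line_place c, hm.2.1, hc.2.1,
    le_antisymm h1 h2]

theorem candidates_eq_empty {T : Tableau} {M : ℤ} (hT : T.ValsLT M) (d : Dir) (k : ℕ) (p : Bool) :
    ¬ (candidates T d k ⟨M, p⟩).Nonempty := by
  rintro ⟨b, hb⟩
  rw [mem_candidates] at hb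
  exact not_bumps_of_val_lt (hT b hb.1) hb.2.2

/-- `Inserts T d k u T' t`: the insertion of `u` into the row or column `k` of `T` produces `T'`,
with `t` recording the added box and the direction at the end. The case of an equal value on the
diagonal is left out, because it does not occur for partial signed permutations. -/
inductive Inserts : Tableau → Dir → ℕ → Letter → Tableau → Step → Prop
  | bump {T d k u T' t} (h : (candidates T d k u).Nonempty)
      (hd : (bumpedBox T d k u h).1 ≠ (bumpedBox T d k u h).2)
      (hI : Inserts (T.set (bumpedBox T d k u h) u) d (k + 1) (T.entry (bumpedBox T d k u h)) T' t)
          :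
      Inserts T d k u T' t
  | diag {T d k u T' t} (h : (candidates T d k u).Nonempty)
      (hd : (bumpedBox T d k u h).1 = (bumpedBox T d k u h).2)
      (hv : u.val ≠ (T.entry (bumpedBox T d k u h)).val)
      (hI : Inserts (T.set (bumpedBox T d k u h) (u.switch (T.entry (bumpedBox T d k u h))).1)
        Dir.col (k + 1) (u.switch (T.entry (bumpedBox T d k u h))).2 T' t) :
      Inserts T d k u T' t
  | endDiag {T k u} (h : ¬ (candidates T .row k u).Nonempty)
      (hd : (endBox T .row k).1 = (endBox T .row k).2) :
      Inserts T .row k u (T.set (endBox T .row k) u.unprime) (endBox T .row k, u.primed)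
  | endOff {T d k u} (h : ¬ (candidates T d k u).Nonempty)
      (hd : (endBox T d k).1 ≠ (endBox T d k).2) :
      Inserts T d k u (T.set (endBox T d k) u) (endBox T d k, decide (d = .col))

/-- The relation `Inserts` describes the function `insertLine`. -/
theorem Inserts.insertLine_eq {T d k u T' t} (h : Inserts T d k u T' t) :
    insertLine T d k u = (T', t.1, if t.2 = true then .col else .row) := by
  induction h with
  | bump h hd hI ih => rw [insertLine, dif_pos h, if_pos hd, ih]
  | diag h hd hv hI ih => rw [insertLine, dif_pos h, if_neg (not_not.2 hd), if_neg hv, ih]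
  | @endDiag T k u h hd =>
    rw [insertLine, dif_neg h]
    obtain ⟨v, _ | _⟩ := u
    · simp [Letter.unprime]
    · simp [hd]
  | @endOff T d k u h hd =>
    rw [insertLine, dif_neg h, if_neg (by tauto)]
    cases d <;> simp

theorem Inserts.one_le {T d k u T' t} (h : Inserts T d k u T' t) (hk : 1 ≤ k) : 1 ≤ t.1.1 := by
  induction h with
  | bump _ _ _ ih => exact ih (by omega)
  | diag _ _ _ _ ih => exact ih (by omega)
  | endDiag _ _ => exact hk
  | @endOff T d k u _ _ =>
    cases d
    · exact hk
    · simp only [endBox, Dir.box, Dir.start]; omega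

theorem Letter.switch_fst_val (u v : Letter) : (u.switch v).1.val = u.val := by
  unfold switch reverse; split_ifs <;> rfl

theorem Letter.switch_snd_val (u v : Letter) : (u.switch v).2.val = v.val := by
  unfold switch reverse; split_ifs <;> rfl

theorem Inserts.keys_eq {T d k u T' t} (h : Inserts T d k u T' t) :
    T'.keys = insert t.1 T.keys := by
  induction h with
  | bump h _ _ ih => rw [ih, Tableau.keys_set,
      Finset.insert_eq_of_mem (bumpedBox_mem_keys _ _ _ _ h)]
  | diag h _ _ _ ih => rw [ih, Tableau.keys_set,
      Finset.insert_eq_of_mem (bumpedBox_mem_keys _ _ _ _ h)]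
  | endDiag _ _ => rw [Tableau.keys_set]
  | endOff _ _ => rw [Tableau.keys_set]

theorem Inserts.valsLT {T d k u T' t} (h : Inserts T d k u T' t) {M : ℤ} (hT : T.ValsLT M)
    (hu : u.val < M) : T'.ValsLT M := by
  induction h with
  | bump h _ _ ih => exact ih (hT.set hu) (hT _ (bumpedBox_mem_keys _ _ _ _ h))
  | diag h _ _ _ ih =>
    exact ih (hT.set (by rwa [Letter.switch_fst_val])) (by
      rw [Letter.switch_snd_val]; exact hT _ (bumpedBox_mem_keys _ _ _ _ h))
  | endDiag _ _ => exact hT.set hu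
  | endOff _ _ => exact hT.set hu

theorem Inserts.hasShape {T d k u T' t} (h : Inserts T d k u T' t) {S : Shape} (hT : T.HasShape S)
    (hk : 1 ≤ k) (ht : S.Addable t.1) : T'.HasShape (S.add t.1) := by
  intro c
  rw [h.keys_eq, ← Tableau.keys_set T t.1 u]
  exact hT.set_addable ht (h.one_le hk) c

/-! ### Insertion in the presence of a largest letter -/

theorem Inserts.max_row {T : Tableau} {S : Shape} (hT : T.HasShape S) (hS : S.Ok) {M : ℤ}
    (hM : T.ValsLT M) {k : ℕ} (hk : 1 ≤ k) (p : Bool) :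
    Inserts T .row k ⟨M, p⟩ (T.set (k, S.R k) ⟨M, if k = S.R k then false else p⟩)
      ((k, S.R k), if k = S.R k then p else false) := by
  have hE := hT.endBox_row hS hk
  have hc := candidates_eq_empty hM .row k p
  split_ifs with h
  · have := Inserts.endDiag hc (by rw [hE]; exact h)
    rw [hE] at this
    exact this
  · have := Inserts.endOff hc (by rw [hE]; exact h)
    rw [hE] at this
    exact this

theorem Inserts.max_col {T : Tableau} {S : Shape} (hT : T.HasShape S) (hS : S.Ok) {M : ℤ}
    (hM : T.ValsLT M) {k : ℕ} (hk : 1 ≤ S.C k) (hk' : S.C k ≠ k) (p : Bool) :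
    Inserts T .col k ⟨M, p⟩ (T.set (S.C k, k) ⟨M, p⟩) ((S.C k, k), true) := by
  have hE := hT.endBox_col hS hk
  have hc := candidates_eq_empty hM .col k p
  have := Inserts.endOff hc (by rw [hE]; exact hk')
  rw [hE] at this
  exact this

/-- A largest letter in an addable box does not interfere with a bump that happens without it. -/
theorem bumpedBox_set {T : Tableau} {S : Shape} (hT : T.HasShape S) (hS : S.Ok) {b : ℕ × ℕ}
    (hb : S.Addable b) {d : Dir} {k : ℕ} {u m : Letter} (h : (candidates T d k u).Nonempty) :
    ∃ h' : (candidates (T.set b m) d k u).Nonempty,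
      bumpedBox (T.set b m) d k u h' = bumpedBox T d k u h := by
  have hbT := hT.not_mem hb
  have hm := bumpedBox_mem T d k u h
  have hm' := mem_candidates.1 hm
  have hmem : bumpedBox T d k u h ∈ candidates (T.set b m) d k u := by
    rw [mem_candidates, Tableau.mem_keys_set, Tableau.entry_set_of_ne]
    · exact ⟨Or.inr hm'.1, hm'.2⟩
    · rintro e; exact hbT (e ▸ hm'.1)
  refine ⟨⟨_, hmem⟩, bumpedBox_eq _ hmem ?_⟩
  intro c hc
  rw [mem_candidates, Tableau.mem_keys_set] at hc
  by_cases hcb : c = b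
  · subst hcb
    exact (Dir.place_lt hS hb ((hT _).1 hm'.1).2 (hm'.2.1.trans hc.2.1.symm)).le
  · rw [Tableau.entry_set_of_ne _ _ hcb] at hc
    exact bumpedBox_le h (mem_candidates.2 ⟨by tauto, hc.2⟩)

/-- The largest letter is bumped exactly if the insertion would end in its box. -/
theorem bumpedBox_set_end {T : Tableau} {b : ℕ × ℕ} {d : Dir} {k : ℕ} {u m : Letter}
    (h : ¬ (candidates T d k u).Nonempty) (hk : d.line b = k)
    (hum : u.val < m.val) :
    ∃ h' : (candidates (T.set b m) d k u).Nonempty, bumpedBox (T.set b m) d k u h' = b := by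
  have hmem : b ∈ candidates (T.set b m) d k u := by
    rw [mem_candidates, Tableau.mem_keys_set, Tableau.entry_set_self]
    exact ⟨Or.inl rfl, hk, bumps_of_val_lt hum⟩
  refine ⟨⟨_, hmem⟩, bumpedBox_eq _ hmem ?_⟩
  intro c hc
  by_cases hcb : c = b
  · subst hcb; exact le_rfl
  · rw [mem_candidates, Tableau.mem_keys_set, Tableau.entry_set_of_ne _ _ hcb] at hc
    exact absurd ⟨c, mem_candidates.2 ⟨by tauto, hc.2⟩⟩ h

theorem candidates_set_of_line_ne {T : Tableau} {b : ℕ × ℕ} {d : Dir} {k : ℕ} {u m : Letter}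
    (h : ¬ (candidates T d k u).Nonempty) (hk : d.line b ≠ k) :
    ¬ (candidates (T.set b m) d k u).Nonempty := by
  rintro ⟨c, hc⟩
  rw [mem_candidates, Tableau.mem_keys_set] at hc
  have hcb : c ≠ b := by rintro rfl; exact hk hc.2.1
  rw [Tableau.entry_set_of_ne _ _ hcb] at hc
  exact h ⟨c, mem_candidates.2 ⟨by tauto, hc.2⟩⟩

theorem endBox_set_of_line_ne {T : Tableau} {b : ℕ × ℕ} {d : Dir} {k : ℕ} {m : Letter}
    (hk : d.line b ≠ k) : endBox (T.set b m) d k = endBox T d k := by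
  unfold endBox
  rw [Tableau.keys_set, Finset.filter_insert, if_neg hk]

theorem line_endBox (T : Tableau) (d : Dir) (k : ℕ) : d.line (endBox T d k) = k := by
  unfold endBox; cases d <;> rfl

theorem Letter.switch_of_unprimed {u m : Letter} (hm : m.primed = false) :
    u.switch m = (u.unprime, ⟨m.val, u.primed⟩) := by
  obtain ⟨v, _ | _⟩ := u <;> obtain ⟨w, q⟩ := m <;> simp only at hm <;> subst hm <;>
    simp [switch, unprime, reverse]

/-- Inserting a letter in the presence of a largest letter `M`: its box and prime, and the step,
change as described by `Push`. -/
theorem Inserts.push {T d k u T' t} (h : Inserts T d k u T' t) {S : Shape} (hT : T.HasShape S)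
    (hS : S.Ok) {M : ℤ} (hM : T.ValsLT M) (hu : u.val < M) (hk : 1 ≤ k) {b : ℕ × ℕ}
    (hb : S.Addable b) (hb1 : 1 ≤ b.1) (ht : S.Addable t.1) (hC : 1 ≤ S.C (b.2 + 1)) {p : Bool}
    (hp : b.1 = b.2 → p = false) :
    ∃ b' p' t', Inserts (T.set b ⟨M, p⟩) d k u (T'.set b' ⟨M, p'⟩) t' ∧ Push S b p t t' b' p' := by
  have hS1 := hS.add hb
  have hbT := hT.not_mem hb
  have hcol := hb.next_col hS
  have hCadd : (S.add b).C (b.2 + 1) = S.C (b.2 + 1) := by simp [Shape.add]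
  have hRadd : (S.add b).R (b.1 + 1) = S.R (b.1 + 1) := by simp [Shape.add]
  induction h with
  | @bump T d k u T' t h hd hI ih =>
    obtain ⟨h', e⟩ := bumpedBox_set hT hS hb (m := ⟨M, p⟩) h
    have hm := bumpedBox_mem_keys _ _ _ _ h
    have hne : bumpedBox T d k u h ≠ b := fun e => hbT (e ▸ hm)
    obtain ⟨b', p', t', h1, h2⟩ := ih (hT.set_mem hm) (hM.set hu) (hM _ hm) (by omega) ht
      ((hT.set_mem hm).not_mem hb)
    refine ⟨b', p', t', .bump h' (by rwa [e]) ?_, h2⟩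
    rw [e, Tableau.entry_set_of_ne _ _ hne, Tableau.set_comm _ _ _ hne.symm]
    exact h1
  | @diag T d k u T' t h hd hv hI ih =>
    obtain ⟨h', e⟩ := bumpedBox_set hT hS hb (m := ⟨M, p⟩) h
    have hm := bumpedBox_mem_keys _ _ _ _ h
    have hne : bumpedBox T d k u h ≠ b := fun e => hbT (e ▸ hm)
    obtain ⟨b', p', t', h1, h2⟩ := ih (hT.set_mem hm)
      (hM.set (by rwa [Letter.switch_fst_val])) (by rw [Letter.switch_snd_val]; exact hM _ hm)
      (by omega) ht ((hT.set_mem hm).not_mem hb)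
    refine ⟨b', p', t', .diag h' (by rwa [e]) ?_ ?_, h2⟩
    · rwa [e, Tableau.entry_set_of_ne _ _ hne]
    · rw [e, Tableau.entry_set_of_ne _ _ hne, Tableau.set_comm _ _ _ hne.symm]
      exact h1
  | @endDiag T k u h hd =>
    by_cases hl : b.1 = k
    · have he : endBox T .row k = b := ht.rowEq hb ((line_endBox T .row k).trans hl.symm)
      obtain ⟨h', e⟩ := bumpedBox_set_end h (b := b) (m := ⟨M, p⟩) hl hu
      rw [he] at hd ⊢
      have hpf := hp hd
      subst hpf
      have hmax := Inserts.max_col (hT.set_addable (u := u.unprime) hb hb1) hS1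
        (hM.set (b := b) (u := u.unprime) hu) (k := b.2 + 1) (by rw [hCadd]; exact hC)
        (by rw [hCadd]; omega) u.primed
      refine ⟨(S.C (b.2 + 1), b.2 + 1), u.primed, ((S.C (b.2 + 1), b.2 + 1), true),
        .diag h' (by rw [e]; exact hd) ?_ ?_, ?_⟩
      · rw [e, Tableau.entry_set_self]; exact hu.ne
      · rw [e, Tableau.entry_set_self, Letter.switch_of_unprimed rfl, Tableau.set_set]
        rw [hCadd] at hmax
        rw [← hl, hd]
        exact hmax
      · refine Or.inr ⟨rfl, rfl, hcol.1, Or.inl ⟨hd, ?_⟩⟩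
        simp [hcol.2]
    · refine ⟨b, p, (endBox T .row k, u.primed), ?_, Or.inl ⟨?_, rfl, rfl, rfl⟩⟩
      · have h1 := candidates_set_of_line_ne (d := .row) (b := b) (m := ⟨M, p⟩) h hl
        have h2 := endBox_set_of_line_ne (T := T) (d := .row) (b := b) (m := ⟨M, p⟩) hl
        have := Inserts.endDiag h1 (by rw [h2]; exact hd)
        rw [h2, Tableau.set_comm _ _ _ (fun e => hl (by rw [e]; exact line_endBox T .row k))]
            at this
        exact this
      · exact fun e => hl (by rw [← e]; exact line_endBox T .row k)
  | @endOff T d k u h hd =>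
    by_cases hl : d.line b = k
    · have he : endBox T d k = b := by
        have := line_endBox T d k
        cases d
        · exact ht.rowEq hb (this.trans hl.symm)
        · exact ht.colEq hb (this.trans hl.symm)
      obtain ⟨h', e⟩ := bumpedBox_set_end h (b := b) (m := ⟨M, p⟩) hl hu
      rw [he] at hd ⊢
      have hlt : b.1 < b.2 := lt_of_le_of_ne hb.1 hd
      have hbump : ∀ {T'' t''}, Inserts (T.set b u) d (k + 1) ⟨M, p⟩ T'' t'' →
          Inserts (T.set b ⟨M, p⟩) d k u T'' t'' := by
        intro T'' t'' hI
        refine .bump h' (by rwa [e]) ?_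
        rwa [e, Tableau.entry_set_self, Tableau.set_set]
      cases d with
      | row =>
        subst hl
        have hrow := hb.next_row hS hd
        have hmax := Inserts.max_row (hT.set_addable (u := u) hb hb1) hS1
          (hM.set (b := b) (u := u) hu) (k := b.1 + 1) (by omega) p
        rw [hRadd] at hmax
        have hle : S.R (b.1 + 1) ≤ b.2 := by
          have h1 := hrow.not_le hS1 hb.mem_add
          have h2 := hS.hRC (b.1 + 1) b.2
          unfold Shape.Addable at hb
          omega
        refine ⟨_, _, _, hbump hmax, Or.inr ⟨rfl, rfl, hrow, Or.inr (Or.inr ?_)⟩⟩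
        refine ⟨hlt, rfl, rfl, hle, ?_⟩
        by_cases hdg : b.1 + 1 = S.R (b.1 + 1)
        · exact Or.inl ⟨hdg, by rw [if_pos hdg], by rw [if_pos hdg]⟩
        · exact Or.inr ⟨lt_of_le_of_ne hrow.1 hdg, by rw [if_neg hdg], by rw [if_neg hdg]⟩
      | col =>
        subst hl
        have hmax := Inserts.max_col (hT.set_addable (u := u) hb hb1) hS1
          (hM.set (b := b) (u := u) hu) (k := b.2 + 1) (by rw [hCadd]; exact hC)
          (by rw [hCadd]; omega) p
        rw [hCadd] at hmax
        refine ⟨_, _, _, hbump hmax, Or.inr ⟨rfl, rfl, hcol.1, Or.inr (Or.inl ?_)⟩⟩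
        exact ⟨hlt, rfl, rfl, hcol.2, rfl, rfl⟩
    · have hne : b ≠ endBox T d k := fun e => hl (by rw [e]; exact line_endBox T d k)
      refine ⟨b, p, (endBox T d k, decide (d = .col)), ?_, Or.inl ⟨hne.symm, rfl, rfl, rfl⟩⟩
      have h1 := candidates_set_of_line_ne (d := d) (b := b) (m := ⟨M, p⟩) h hl
      have h2 := endBox_set_of_line_ne (T := T) (d := d) (b := b) (m := ⟨M, p⟩) hl
      have := Inserts.endOff h1 (by rw [h2]; exact hd)
      rw [h2, Tableau.set_comm _ _ _ hne] at this
      exact this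

/-! ### Traces of words -/

/-- `Inserted T w T' l`: inserting the letters of `w` into `T` produces `T'`, and `l` is the list of
the steps, called the trace of `w`. -/
inductive Inserted : Tableau → Word → Tableau → List Step → Prop
  | nil (T) : Inserted T [] T []
  | cons {T x T1 t w T' l} : Inserts T .row 1 x T1 t → Inserted T1 w T' l →
      Inserted T (x :: w) T' (t :: l)

namespace Inserted

theorem append {T w T1 l w' T' l'} (h : Inserted T w T1 l) (h' : Inserted T1 w' T' l') :
    Inserted T (w ++ w') T' (l ++ l') := by
  induction h with
  | nil => exact h'
  | cons h1 _ ih => exact .cons h1 (ih h')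

theorem split {T w w' T' l} (h : Inserted T (w ++ w') T' l) :
    ∃ T1 l1 l2, l = l1 ++ l2 ∧ Inserted T w T1 l1 ∧ Inserted T1 w' T' l2 := by
  induction w generalizing T l with
  | nil => exact ⟨T, [], l, rfl, .nil _, h⟩
  | cons x w ih =>
    cases h with
    | cons h1 h2 =>
      obtain ⟨T1, l1, l2, rfl, h3, h4⟩ := ih h2
      exact ⟨T1, _ :: l1, l2, rfl, .cons h1 h3, h4⟩

theorem length_eq {T w T' l} (h : Inserted T w T' l) : l.length = w.length := by
  induction h with
  | nil => rfl
  | cons _ _ ih => simp [ih]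

theorem det {T w T' l T2 l2} (h : Inserted T w T' l) (h' : Inserted T w T2 l2) :
    T' = T2 ∧ l = l2 := by
  induction h generalizing l2 with
  | nil => cases h'; simp
  | cons h1 _ ih =>
    cases h' with
    | @cons _ _ T3 t3 _ _ _ h1' h2' =>
      have := h1.insertLine_eq.symm.trans h1'.insertLine_eq
      simp only [Prod.mk.injEq] at this
      obtain ⟨rfl, ht, hd⟩ := this
      obtain ⟨rfl, rfl⟩ := ih h2'
      refine ⟨rfl, ?_⟩
      congr 1
      refine Prod.ext ht ?_
      revert hd
      split_ifs with h3 h4 h4 <;> simp_all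

theorem one_le {T w T' l} (h : Inserted T w T' l) : ∀ t ∈ l, 1 ≤ t.1.1 := by
  induction h with
  | nil => simp
  | cons h1 _ ih =>
    intro s hs
    rcases List.mem_cons.1 hs with rfl | hs
    exacts [h1.one_le le_rfl, ih s hs]

theorem valsLT {T w T' l} (h : Inserted T w T' l) {M : ℤ} (hT : T.ValsLT M)
    (hw : ∀ x ∈ w, x.val < M) : T'.ValsLT M := by
  induction h with
  | nil => exact hT
  | cons h1 _ ih => exact ih (h1.valsLT hT (hw _ (by simp))) (fun x hx => hw x (by simp [hx]))

theorem hasShape {T w T' l} (h : Inserted T w T' l) {S : Shape} (hT : T.HasShape S)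
    (hl : S.Chain l) : T'.HasShape (S.adds l) := by
  induction h generalizing S with
  | nil => exact hT
  | cons h1 _ ih => exact ih (h1.hasShape hT le_rfl hl.1) hl.2

/-- Inserting a word in the presence of a largest letter: the trace changes as described by
`PushList`. The bound on row `0` guarantees that no column up to the one right of row `1` is empty,
so that the largest letter always has a row index at least `1`. -/
theorem push {T w T' l} (h : Inserted T w T' l) {S : Shape} (hT : T.HasShape S)
    (hS : S.Ok) {M : ℤ} (hM : T.ValsLT M) (hw : ∀ x ∈ w, x.val < M) {b : ℕ × ℕ}
    (hb : S.Addable b) (hb1 : 1 ≤ b.1) (hl : S.Chain l) (hC : S.R 1 + l.length + 1 < S.R 0)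
    {p : Bool} (hp : b.1 = b.2 → p = false) :
    ∃ b' p' l', Inserted (T.set b ⟨M, p⟩) w (T'.set b' ⟨M, p'⟩) l' ∧
      PushList S b p l l' b' p' ∧ 1 ≤ b'.1 := by
  induction h generalizing S b p with
  | nil => exact ⟨b, p, [], .nil _, .nil _ _ _, hb1⟩
  | @cons T x T1 t w T' l h1 h2 ih =>
    have hbR : b.2 ≤ S.R 1 := by
      have h3 := hS.hRC 1 (S.R 1)
      have h4 := hS.hRC b.1 (S.R 1)
      have h5 := hS.hR 1
      unfold Shape.Addable at hb
      have h6 := hS.hRC 1 b.2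
      have h7 := hS.hRC b.1 b.2
      by_contra hlt
      rcases Nat.lt_or_ge 1 b.1 with h8 | h8
      · omega
      · have : b.1 = 1 := by omega
        rw [this] at hb
        omega
    have hC1 : 1 ≤ S.C (b.2 + 1) := by
      have := hS.hRC 0 (b.2 + 1) (by omega)
      simp only [List.length_cons] at hC
      omega
    obtain ⟨b1, p1, t1, h3, h4⟩ := h1.push hT hS hM (hw x (by simp)) le_rfl hb hb1 hl.1 hC1 hp
    have ht1 := h1.one_le le_rfl
    have hC' : (S.add t.1).R 1 + l.length + 1 < (S.add t.1).R 0 := by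
      have ha := hl.1
      unfold Shape.Addable at ha
      simp only [Shape.add, List.length_cons] at hC ⊢
      split_ifs with h5 h6 h6
      · omega
      · rw [← h5] at ha; omega
      · omega
      · omega
    have hb1' : 1 ≤ b1.1 := by
      have := h3.one_le le_rfl
      rcases h4 with ⟨_, _, rfl, _⟩ | ⟨_, h5, _⟩
      · exact hb1
      · rwa [← h5]
    obtain ⟨b', p', l', h5, h6, h7⟩ := ih (h1.hasShape hT le_rfl hl.1) (hS.add hl.1)
      (h1.valsLT hM (hw x (by simp))) (fun y hy => hw y (by simp [hy])) (h4.addable hb hl.1) hb1'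
      hl.2 hC' (h4.diag hp)
    exact ⟨b', p', t1 :: l', .cons h3 h5, .cons h4 h6, h7⟩

end Inserted

/-- The shape that consists only of a virtual row `0` of length `N`. -/
def Shape.base (N : ℕ) : Shape := ⟨fun r => if r = 0 then N else r, fun k => if k < N then 1 else 0⟩

theorem Shape.base_ok (N : ℕ) : (Shape.base N).Ok := by
  constructor <;> intros <;> simp only [Shape.base] <;> grind

theorem Shape.base_addable (N : ℕ) : (Shape.base N).Addable (0, N) := by
  simp [Shape.Addable, Shape.base]

theorem Shape.base_add (N : ℕ) : (Shape.base N).add (0, N) = Shape.base (N + 1) := by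
  unfold Shape.base Shape.add
  simp only [Shape.mk.injEq]
  constructor <;> funext x <;> grind

theorem Tableau.hasShape_empty (N : ℕ) : (∅ : Tableau).HasShape (Shape.base N) := by
  intro b
  simp only [Finmap.mem_keys, Finmap.notMem_empty, Shape.Mem, Shape.base, false_iff]
  grind

theorem Tableau.valsLT_empty (M : ℤ) : (∅ : Tableau).ValsLT M := by
  intro b hb
  simp at hb

/-- A box that is addable at the beginning of a chain, and is not used by it, can be added at any
moment. -/
theorem Shape.Chain.insert {S : Shape} {l l' : List Step} {f : ℕ × ℕ} {q : Bool}
    (h : S.Chain (l ++ l')) (hf : S.Addable f) (hne : ∀ t ∈ l ++ l', t.1 ≠ f) :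
    S.Chain (l ++ (f, q) :: l') ∧ (S.adds l).Addable f ∧
      S.adds (l ++ (f, q) :: l') = (S.adds (l ++ l')).add f := by
  induction l generalizing S with
  | nil =>
    simp only [List.nil_append] at *
    refine ⟨?_, hf, ?_⟩
    · refine ⟨hf, ?_⟩
      induction l' generalizing S with
      | nil => trivial
      | cons t l' ih =>
        have hne1 : t.1 ≠ f := hne t (by simp)
        refine ⟨hf.add_ne h.1 hne1.symm, ?_⟩
        rw [Shape.add_comm (fun e => hne1 (h.1.rowEq hf e.symm))
          (fun e => hne1 (h.1.colEq hf e.symm))]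
        exact ih h.2 (h.1.add_ne hf hne1) (fun t ht => hne t (by simp [ht]))
    · simp only [Shape.adds_cons]
      induction l' generalizing S with
      | nil => rfl
      | cons t l' ih =>
        have hne1 : t.1 ≠ f := hne t (by simp)
        simp only [Shape.adds_cons]
        rw [Shape.add_comm (fun e => hne1 (h.1.rowEq hf e.symm))
          (fun e => hne1 (h.1.colEq hf e.symm))]
        exact ih h.2 (h.1.add_ne hf hne1) (fun t ht => hne t (by simp [ht]))
  | cons t l ih =>
    have hne1 : t.1 ≠ f := hne t (by simp)
    obtain ⟨h1, h2, h3⟩ := ih h.2 (h.1.add_ne hf hne1)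
        (fun t ht => hne t (List.mem_cons_of_mem _ ht))
    exact ⟨⟨h.1, h1⟩, h2, h3⟩

theorem PushList.of_forall_ne (S : Shape) (b : ℕ × ℕ) (p : Bool) (l : List Step)
    (h : ∀ t ∈ l, t.1 ≠ b) : PushList S b p l l b p := by
  induction l generalizing S with
  | nil => exact .nil _ _ _
  | cons t l ih =>
    exact .cons (Or.inl ⟨h t (by simp), rfl, rfl, rfl⟩) (ih _ (fun u hu => h u (by simp [hu])))

/-- The step that adds the first free box of the virtual row `0`. It stands for the insertion of the
largest letter: this letter is first put at the end of row `0` and then pushed out of it. -/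
def virtualStep (N : ℕ) : Step := ((0, N), false)

/-- The trace of a word with largest letter `m` is obtained from the trace of the word without `m`
by inserting a virtual step at the place of `m`, and pushing a letter with the prime of `m` through
the resulting list, starting at the end of the virtual row. -/
theorem Inserted.insert_max {u v : Word} {m : Letter} {T' : Tableau} {lu lv : List Step} {N : ℕ}
    (h : Inserted ∅ (u ++ v) T' (lu ++ lv)) (hlen : lu.length = u.length)
    (hm : ∀ x ∈ u ++ v, x.val < m.val)
    (hN : (u ++ v).length + 2 < N) (hc : (Shape.base N).Chain (lu ++ lv)) :
    (Shape.base N).Chain (lu ++ virtualStep N :: lv) ∧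
    ∃ b' p' l, Inserted ∅ (u ++ m :: v) (T'.set b' ⟨m.val, p'⟩) l ∧
      PushList (Shape.base N) (0, N) m.primed (lu ++ virtualStep N :: lv) l b' p' ∧ 1 ≤ b'.1 := by
  have hB := Shape.base_ok N
  have hf := Shape.base_addable N
  have hrow := h.one_le
  have hne : ∀ t ∈ lu ++ lv, t.1 ≠ (0, N) := by
    intro t ht e
    have := hrow t ht
    rw [e] at this
    omega
  obtain ⟨hchain, hadd, -⟩ := hc.insert (q := false) hf hne
  refine ⟨hchain, ?_⟩
  obtain ⟨T1, l1, l2, he, h1, h2⟩ := h.split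
  obtain ⟨rfl, rfl⟩ := List.append_inj he (by rw [h1.length_eq, hlen])
  have hc1 := (Shape.chain_append.1 hc).1
  have hS1 := hB.adds hc1
  have hT1 := h1.hasShape (Tableau.hasShape_empty N) hc1
  have hM1 := h1.valsLT (Tableau.valsLT_empty m.val) (fun x hx => hm x (by simp [hx]))
  have hmax := Inserts.max_row hT1 hS1 hM1 (k := 1) le_rfl m.primed
  set S1 := (Shape.base N).adds lu with hS1def
  have hR0 : S1.R 0 = N := hadd.2.1
  have hR1 : ∀ (l : List Step) (S : Shape), S.Chain l → (S.adds l).R 1 ≤ S.R 1 + l.length := by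
    intro l
    induction l with
    | nil => simp
    | cons t l ih =>
      intro S hS
      have := ih _ hS.2
      have h3 := hS.1
      unfold Shape.Addable at h3
      simp only [Shape.adds_cons, List.length_cons, Shape.add] at *
      split_ifs at this with h4
      · rw [← h4] at h3; omega
      · omega
  have hR1' : S1.R 1 ≤ 1 + lu.length := by
    have := hR1 lu _ hc1
    have h0 : (Shape.base N).R 1 = 1 := by simp [Shape.base]
    rwa [h0] at this
  have hlv : lv.length = v.length := h2.length_eq
  simp only [List.length_append] at hN
  have hrow1 := hadd.next_row hS1 (by simp only; omega)
  simp only [zero_add] at hrow1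
  have hpush : Push S1 (0, N) m.primed (virtualStep N)
      ((1, S1.R 1), if 1 = S1.R 1 then m.primed else false) (1, S1.R 1)
      (if 1 = S1.R 1 then false else m.primed) := by
    refine Or.inr ⟨rfl, rfl, hrow1, Or.inr (Or.inr ⟨by simp only; omega, rfl, rfl, ?_, ?_⟩)⟩
    · simp only; omega
    · have := hS1.hR 1
      by_cases hd : 1 = S1.R 1
      · left; rw [if_pos hd, if_pos hd]; exact ⟨hd, rfl, rfl⟩
      · right; rw [if_neg hd, if_neg hd]
        exact ⟨by simp only; omega, rfl, rfl⟩
  have hb : S1.Addable (1, S1.R 1) := by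
    have h5 := hrow1
    unfold Shape.Addable Shape.add at h5
    simp only at h5
    have : S1.R 1 ≠ N := by omega
    simp only [this, if_false] at h5
    exact ⟨h5.1, rfl, h5.2.2⟩
  have hdg : (1 : ℕ) = S1.R 1 → (if 1 = S1.R 1 then false else m.primed) = false := by
    intro hd; rw [if_pos hd]
  -- the virtual row already contains the box of the virtual step after it is performed
  have hS2 := hS1.add hadd
  have hT2 : T1.HasShape (S1.add (0, N)) := by
    intro c
    rw [hT1 c]
    unfold Shape.Mem Shape.add
    simp only
    grind
  have hchain2 : (S1.add (0, N)).Chain lv := (Shape.chain_append.1 hchain).2.2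
  obtain ⟨b', p', l', h3, h4, h5⟩ := h2.push hT2 hS2 hM1 (fun x hx => hm x (by simp [hx]))
    (b := (1, S1.R 1)) hrow1 le_rfl hchain2 (by simp only [Shape.add]; simp; omega) (p := if 1 =
        S1.R 1 then false else m.primed) hdg
  refine ⟨b', p', _, h1.append (.cons hmax h3), ?_, h5⟩
  exact (PushList.of_forall_ne _ _ _ _ (fun t ht => hne t (by simp [ht]))).append (.cons hpush h4)

/-! ### Knuth moves and dual moves -/

theorem exists_val_max : ∀ {a : Word}, a ≠ [] → ∃ m ∈ a, ∀ x ∈ a, x.val ≤ m.val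
  | [x], _ => ⟨x, by simp⟩
  | x :: y :: w, _ => by
    obtain ⟨m, hm, h⟩ := exists_val_max (a := y :: w) (by simp)
    rcases le_total x.val m.val with hx | hx
    · exact ⟨m, List.mem_cons_of_mem _ hm, fun z hz => by
        rcases List.mem_cons.1 hz with rfl | hz
        exacts [hx, h z hz]⟩
    · exact ⟨x, by simp, fun z hz => by
        rcases List.mem_cons.1 hz with rfl | hz
        exacts [le_rfl, (h z hz).trans hx]⟩

theorem IsPartialSignedPerm.remove {u v : Word} {m : Letter}
    (h : IsPartialSignedPerm (u ++ m :: v)) : IsPartialSignedPerm (u ++ v) := by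
  unfold IsPartialSignedPerm at *
  exact List.Nodup.sublist (((List.sublist_cons_self m v).append_left u).map _) h

theorem IsPartialSignedPerm.val_lt {u v : Word} {m : Letter}
    (h : IsPartialSignedPerm (u ++ m :: v)) (hm : ∀ x ∈ u ++ m :: v, x.val ≤ m.val) :
    ∀ x ∈ u ++ v, x.val < m.val := by
  intro x hx
  refine lt_of_le_of_ne (hm x (by simp at hx ⊢; tauto)) ?_
  intro e
  unfold IsPartialSignedPerm at h
  rw [List.map_append, List.map_cons, List.nodup_middle, List.nodup_cons, ← List.map_append] at h
  exact h.1 (List.mem_map.2 ⟨x, hx, e⟩)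

theorem List.append_eq_of_length {α : Type*} {l : List α} {a b : ℕ} (h : l.length = a + b) :
    ∃ u v, l = u ++ v ∧ u.length = a ∧ v.length = b :=
  ⟨l.take a, l.drop a, (List.take_append_drop a l).symm, by simp; omega, by simp; omega⟩

/-- Every partial signed permutation has a trace; it is a chain above any sufficiently long virtual
row, and its lanes reflect the ascents of the word. Both properties are inherited from the word
without its largest letter. -/
theorem exists_inserted (a : Word) (ha : IsPartialSignedPerm a) :
    ∃ T l, Inserted ∅ a T l ∧ Ascents (a.map Letter.val) l ∧
      ∀ N, a.length + 2 < N → (Shape.base N).Chain l := by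
  induction hn : a.length generalizing a with
  | zero =>
    obtain rfl := List.length_eq_zero_iff.1 hn
    exact ⟨∅, [], .nil _, by simp [Ascents], fun _ _ => trivial⟩
  | succ n ih =>
    obtain ⟨m, hma, hmax⟩ := exists_val_max (a := a) (by rintro rfl; simp at hn)
    obtain ⟨u, v, rfl⟩ := List.append_of_mem hma
    have hlt := ha.val_lt hmax
    have hn' : (u ++ v).length = n := by simp at hn ⊢; omega
    obtain ⟨T, l, hI, hA, hC⟩ := ih (u ++ v) ha.remove hn'
    obtain ⟨lu, lv, rfl, h1, h2⟩ := List.append_eq_of_length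
      (hI.length_eq.trans List.length_append)
    have key : ∀ N, n + 2 < N → ∃ T' l', Inserted ∅ (u ++ m :: v) T' l' ∧
        Ascents ((u ++ m :: v).map Letter.val) l' ∧ (Shape.base (N + 1)).Chain l' := by
      intro N hN
      obtain ⟨hc, b', p', l', hI', hP, -⟩ := hI.insert_max h1 hlt (hn' ▸ hN) (hC N hN)
      refine ⟨_, l', hI', ?_, ?_⟩
      · refine hP.ascents (Shape.base_ok N) hc (Shape.base_addable N) (by simp; omega) ?_
        rw [List.map_append, List.map_cons]
        refine Ascents.insert_max (by simp [h1]) ?_ rfl ?_ (by simpa using hA)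
        · intro x hx
          rw [← List.map_append] at hx
          obtain ⟨y, hy, rfl⟩ := List.mem_map.1 hx
          exact hlt y hy
        · intro t ht
          have := hI.one_le t ht
          unfold lane; split_ifs <;> omega
      · rw [← Shape.base_add]
        exact (hP.chain_out hc (Shape.base_addable N)).1
    obtain ⟨T', l', h3, h4, h5⟩ := key (n + 3) (by omega)
    refine ⟨T', l', h3, h4, fun N hN => ?_⟩
    obtain ⟨T2, l2, h6, -, h7⟩ := key (N - 1) (by omega)
    obtain ⟨-, rfl⟩ := h3.det h6
    rwa [Nat.sub_add_cancel (by omega)] at h7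

/-- The elementary Knuth moves on the absolute values of three letters: the largest letter, in the
middle, is exchanged with its neighbour whose value is the smallest of the three. -/
def KnuthMove (x y z x' y' z' : Letter) : Prop :=
  (x.val < z.val ∧ z.val < y.val ∧ x' = y ∧ y' = x ∧ z' = z) ∨
  (z.val < x.val ∧ x.val < y.val ∧ x' = x ∧ y' = z ∧ z' = y)

theorem far_virtualStep {S : Shape} {N : ℕ} {t : Step} (h1 : 1 ≤ t.1.1)
    (hV : (S.add t.1).Addable (virtualStep N).1) : Far t (virtualStep N) := by
  unfold Shape.Addable Shape.add virtualStep at hV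
  unfold Far virtualStep
  simp only at *
  grind

set_option maxHeartbeats 1000000 in
/-- A Knuth move does not change the insertion tableau, and changes the trace by a dual move. If the
largest letter of the word is not involved, then it is pushed through two traces that differ by a
dual move; if it is, then the lists with the virtual step at the two places differ by a swap. -/
theorem KnuthMove.exists_dualMove {x z : Word} {α β γ α' β' γ' : Letter}
    (h : KnuthMove α β γ α' β' γ') (hp : IsPartialSignedPerm (x ++ α :: β :: γ :: z)) :
    ∃ T l1 t1 t2 t3 l2 s1 s2 s3, l1.length = x.length ∧
      Inserted ∅ (x ++ α :: β :: γ :: z) T (l1 ++ t1 :: t2 :: t3 :: l2) ∧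
      Inserted ∅ (x ++ α' :: β' :: γ' :: z) T (l1 ++ s1 :: s2 :: s3 :: l2) ∧
      DualMove t1 t2 t3 s1 s2 s3 := by
  induction hn : x.length + z.length using Nat.strong_induction_on generalizing x z with
  | _ n ih =>
  -- the largest letter is inserted into the words from which it has been removed
  have finish : ∀ {u v u' v' : Word} {m : Letter} {T : Tableau} {lu lv lu' lv' k1 k2 : List Step}
      {t1 t2 t3 s1 s2 s3 : Step} {N : ℕ}, Inserted ∅ (u ++ v) T (lu ++ lv) →
      Inserted ∅ (u' ++ v') T (lu' ++ lv') → lu.length = u.length → lu'.length = u'.length →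
      (∀ y ∈ u ++ v, y.val < m.val) → (∀ y ∈ u' ++ v', y.val < m.val) →
      (u ++ v).length + 2 < N → (u' ++ v').length + 2 < N → (Shape.base N).Chain (lu ++ lv) →
      (Shape.base N).Chain (lu' ++ lv') →
      lu ++ virtualStep N :: lv = k1 ++ t1 :: t2 :: t3 :: k2 →
      lu' ++ virtualStep N :: lv' = k1 ++ s1 :: s2 :: s3 :: k2 → DualMove t1 t2 t3 s1 s2 s3 →
      u ++ m :: v = x ++ α :: β :: γ :: z → u' ++ m :: v' = x ++ α' :: β' :: γ' :: z →
      k1.length = x.length →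
      ∃ T l1 t1 t2 t3 l2 s1 s2 s3, l1.length = x.length ∧
        Inserted ∅ (x ++ α :: β :: γ :: z) T (l1 ++ t1 :: t2 :: t3 :: l2) ∧
        Inserted ∅ (x ++ α' :: β' :: γ' :: z) T (l1 ++ s1 :: s2 :: s3 :: l2) ∧
        DualMove t1 t2 t3 s1 s2 s3 := by
    intro u v u' v' m T lu lv lu' lv' k1 k2 t1 t2 t3 s1 s2 s3 N hI hI' hl hl' hm hm' hN hN' hc hc'
      e e' hD ew ew' hk
    obtain ⟨hch, b, p, l, hJ, hP, -⟩ := hI.insert_max hl hm hN hc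
    obtain ⟨hch', b', p', l', hJ', hP', -⟩ := hI'.insert_max hl' hm' hN' hc'
    rw [e] at hch hP
    rw [e'] at hch' hP'
    rw [ew] at hJ
    rw [ew'] at hJ'
    obtain ⟨rfl, rfl, j1, u1, u2, u3, v1, v2, v3, j2, hj, rfl, rfl, hD'⟩ :=
      PushList.dualMove (Shape.base_ok N) (Shape.base_addable N) (by simp only; omega) hch hch' hD
        hP hP'
    exact ⟨_, j1, u1, u2, u3, j2, v1, v2, v3, hj.trans hk, hJ, hJ', hD'⟩
  obtain ⟨m, hma, hmax⟩ := exists_val_max (a := x ++ α :: β :: γ :: z) (by simp)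
  have hαm := hmax α (by simp)
  have hβm := hmax β (by simp)
  have hγm := hmax γ (by simp)
  have hne : α.val < β.val ∧ γ.val < β.val := by unfold KnuthMove at h; omega
  have hcases : m ∈ x ∨ m = β ∨ m ∈ z := by
    simp only [List.mem_append, List.mem_cons] at hma
    rcases hma with h1 | rfl | h1 | rfl | h1
    · exact Or.inl h1
    · omega
    · exact Or.inr (Or.inl h1)
    · omega
    · exact Or.inr (Or.inr h1)
  have hmem' : ∀ y : Letter, y = α' ∨ y = β' ∨ y = γ' → y = α ∨ y = β ∨ y = γ := by
    rcases h with ⟨h1, h2, rfl, rfl, rfl⟩ | ⟨h1, h2, rfl, rfl, rfl⟩ <;> tauto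
  rcases hcases with hmx | rfl | hmz
  · obtain ⟨u, v, rfl⟩ := List.append_of_mem hmx
    have e : (u ++ m :: v) ++ α :: β :: γ :: z = u ++ m :: (v ++ α :: β :: γ :: z) := by simp
    rw [e] at hp hmax
    have hlt := hp.val_lt hmax
    have hrem := hp.remove
    rw [← List.append_assoc] at hrem
    have hlen : (u ++ v).length + z.length < n := by simp at hn ⊢; omega
    obtain ⟨T, l1, t1, t2, t3, l2, s1, s2, s3, h1, h2, h3, h4⟩ := ih _ hlen hrem rfl
    obtain ⟨lu, lv, rfl, h5, h6⟩ := List.append_eq_of_length (h1.trans List.length_append)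
    obtain ⟨T2, l0, h7, -, hC⟩ := exists_inserted _ hrem
    obtain ⟨rfl, rfl⟩ := h7.det h2
    obtain ⟨N, hN⟩ : ∃ N, N = ((u ++ v) ++ α :: β :: γ :: z).length + 3 := ⟨_, rfl⟩
    have hc := hC N (by omega)
    have hrem' : IsPartialSignedPerm ((u ++ v) ++ α' :: β' :: γ' :: z) := by
      unfold IsPartialSignedPerm at *
      refine (List.Perm.nodup_iff ?_).1 hrem
      refine List.Perm.map _ (List.Perm.append_left _ ?_)
      rcases h with ⟨-, -, rfl, rfl, rfl⟩ | ⟨-, -, rfl, rfl, rfl⟩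
      · exact List.Perm.swap _ _ _
      · exact List.Perm.cons _ (List.Perm.swap _ _ _)
    obtain ⟨T3, l0', h7', -, hC'⟩ := exists_inserted _ hrem'
    obtain ⟨rfl, rfl⟩ := h7'.det h3
    have hc' := hC' N (by simp [hN])
    refine finish (u := u) (v := v ++ α :: β :: γ :: z) (u' := u) (v' := v ++ α' :: β' :: γ' :: z)
      (m := m) (lu := lu) (lu' := lu) (lv := lv ++ t1 :: t2 :: t3 :: l2)
      (lv' := lv ++ s1 :: s2 :: s3 :: l2) (k1 := lu ++ virtualStep N :: lv) (k2 := l2) (N := N)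
          (T := T3)
      (by simpa using h2) (by simpa using h3) h5 h5 hlt ?_ ?_ ?_ (by simpa using hc)
      (by simpa using hc') (by simp) (by simp) h4 (by simp) (by simp) (by simp [h5, h6])
    · intro y hy
      refine hlt y ?_
      have := hmem' y
      simp only [List.mem_append, List.mem_cons] at hy ⊢
      tauto
    · simp [hN]
    · simp [hN]
  · have e : x ++ α :: m :: γ :: z = (x ++ [α]) ++ m :: (γ :: z) := by simp
    rw [e] at hp hmax
    have hlt := hp.val_lt hmax
    have hrem := hp.remove
    have e : (x ++ [α]) ++ γ :: z = x ++ α :: γ :: z := by simp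
    rw [e] at hrem hlt
    obtain ⟨T, l, hI, hA, hC⟩ := exists_inserted _ hrem
    have hl : l.length = x.length + (z.length + 2) := by simpa using hI.length_eq
    obtain ⟨l1, l2, rfl, h1, h2⟩ := List.append_eq_of_length hl
    match l2, h2 with
    | t1 :: t3 :: l2, h2 =>
    have hc := hC ((x ++ α :: γ :: z).length + 3) (by omega)
    set N := (x ++ α :: γ :: z).length + 3 with hN
    have hI' : Inserted ∅ ((x ++ [α]) ++ γ :: z) T ((l1 ++ [t1]) ++ t3 :: l2) := by simpa using hI
    have ht1 := hI.one_le t1 (by simp)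
    have ht3 := hI.one_le t3 (by simp)
    have hlane1 : 0 < lane t1 := by unfold lane; split_ifs <;> omega
    have hlane3 : 0 < lane t3 := by unfold lane; split_ifs <;> omega
    have hV : lane (virtualStep N) = 0 := rfl
    rw [List.map_append] at hA
    have hA1 : α.val < γ.val ↔ lane t3 ≤ lane t1 :=
      (Ascents.of_append (l' := t1 :: t3 :: l2) hA (by simp [h1])).1
    obtain ⟨hch, -⟩ := hI'.insert_max (by simp [h1]) (m := m) (by simpa using hlt)
      (N := N) (by simp [hN]) (by simpa using hc)
    rw [List.append_assoc, List.singleton_append] at hch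
    have hF1 : Far t1 (virtualStep N) := far_virtualStep ht1 (Shape.chain_append.1 hch).2.2.1
    rcases h with ⟨h3, h4, rfl, rfl, rfl⟩ | ⟨h3, h4, rfl, rfl, rfl⟩
    · refine finish (u := x ++ [β']) (v := γ' :: z) (u' := x) (v' := β' :: γ' :: z) (m := α')
        (lu := l1 ++ [t1]) (lv := t3 :: l2) (lu' := l1) (lv' := t1 :: t3 :: l2) (k1 := l1) (T := T)
        (N := N) hI' hI (by simp [h1]) h1 (by simpa using hlt) hlt (by simp [hN]) (by simp [hN])
        (by simpa using hc) hc (by rw [List.append_assoc]; rfl) rfl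
        (Or.inl ⟨hF1, rfl, rfl, rfl, by omega, hA1.1 h3⟩) (by simp) (by simp) h1
    · have hI2 : Inserted ∅ ((x ++ [α', β']) ++ z) T ((l1 ++ [t1, t3]) ++ l2) := by simpa using hI
      obtain ⟨hch2, -⟩ := hI2.insert_max (by simp [h1]) (m := γ') (by simpa using hlt)
        (N := N) (by simp [hN]) (by simpa using hc)
      rw [List.append_assoc] at hch2
      have hF3 : Far t3 (virtualStep N) :=
        far_virtualStep ht3 (Shape.chain_append.1 hch2).2.2.2.1
      refine finish (u := x ++ [α']) (v := β' :: z) (u' := x ++ [α', β']) (v' := z) (m := γ')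
        (lu := l1 ++ [t1]) (lv := t3 :: l2) (lu' := l1 ++ [t1, t3]) (lv' := l2) (k1 := l1) (T := T)
        (N := N) hI' hI2 (by simp [h1]) (by simp [h1]) (by simpa using hlt) (by simpa using hlt)
        (by simp [hN]) (by simp [hN])
        (by simpa using hc) (by simpa using hc) (by rw [List.append_assoc]; rfl)
        (by rw [List.append_assoc]; rfl)
        (Or.inr (Or.inl ⟨⟨hF3.1.symm, hF3.2.symm⟩, rfl, rfl, rfl, by omega, ?_⟩)) (by simp)
        (by simp) h1
      have : ¬ lane t3 ≤ lane t1 := fun h => by have := hA1.2 h; omega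
      omega
  · obtain ⟨v, w, rfl⟩ := List.append_of_mem hmz
    have e : x ++ α :: β :: γ :: (v ++ m :: w) = (x ++ α :: β :: γ :: v) ++ m :: w := by simp
    rw [e] at hp hmax
    have hlt := hp.val_lt hmax
    have hrem := hp.remove
    have e : (x ++ α :: β :: γ :: v) ++ w = x ++ α :: β :: γ :: (v ++ w) := by simp
    rw [e] at hrem
    have hlen : x.length + (v ++ w).length < n := by simp at hn ⊢; omega
    obtain ⟨T, l1, t1, t2, t3, l2, s1, s2, s3, h1, h2, h3, h4⟩ := ih _ hlen hrem rfl
    have hl2 : l2.length = v.length + w.length := by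
      have := h2.length_eq
      simp [h1] at this
      omega
    obtain ⟨lv, lw, rfl, h5, h6⟩ := List.append_eq_of_length hl2
    obtain ⟨T2, l0, h7, -, hC⟩ := exists_inserted _ hrem
    obtain ⟨rfl, rfl⟩ := h7.det h2
    obtain ⟨N, hN⟩ : ∃ N, N = (x ++ α :: β :: γ :: (v ++ w)).length + 3 := ⟨_, rfl⟩
    have hc := hC N (by omega)
    have hrem' : IsPartialSignedPerm (x ++ α' :: β' :: γ' :: (v ++ w)) := by
      unfold IsPartialSignedPerm at *
      refine (List.Perm.nodup_iff ?_).1 hrem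
      refine List.Perm.map _ (List.Perm.append_left _ ?_)
      rcases h with ⟨-, -, rfl, rfl, rfl⟩ | ⟨-, -, rfl, rfl, rfl⟩
      · exact List.Perm.swap _ _ _
      · exact List.Perm.cons _ (List.Perm.swap _ _ _)
    obtain ⟨T3, l0', h7', -, hC'⟩ := exists_inserted _ hrem'
    obtain ⟨rfl, rfl⟩ := h7'.det h3
    have hc' := hC' N (by simp [hN])
    refine finish (u := x ++ α :: β :: γ :: v) (v := w) (u' := x ++ α' :: β' :: γ' :: v) (v' := w)
      (m := m) (lu := l1 ++ t1 :: t2 :: t3 :: lv) (lu' := l1 ++ s1 :: s2 :: s3 :: lv) (lv := lw)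
      (lv' := lw) (k1 := l1) (k2 := lv ++ virtualStep N :: lw) (N := N) (T := T3)
      (t1 := t1) (t2 := t2) (t3 := t3) (s1 := s1) (s2 := s2) (s3 := s3)
      (by simpa using h2) (by simpa using h3) (by simp [h1, h5]) (by simp [h1, h5]) hlt ?_ ?_ ?_
      (by simpa using hc)
      (by simpa using hc') (by simp) (by simp) h4 (by simp) (by simp) h1
    · intro y hy
      refine hlt y ?_
      have := hmem' y
      simp only [List.mem_append, List.mem_cons] at hy ⊢
      tauto
    · simp [hN]
    · simp [hN]

/-! ### A word is determined by its tableau and its trace -/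

/-- A push can be undone: the output determines where the larger letter was, because a bump is
recognised by the new box being equal to the one of the output, and its kind by the direction and
the diagonal. -/
theorem Push.inj {S1 S2 : Shape} {b1 b2 p1 p2 t1 t2 o b' p'}
    (h1 : Push S1 b1 p1 t1 o b' p') (h2 : Push S2 b2 p2 t2 o b' p')
    (hb1 : S1.Addable b1) (hb2 : S2.Addable b2)
    (hp1 : b1.1 = b1.2 → p1 = false) (hp2 : b2.1 = b2.2 → p2 = false)
    (hS : S1.add b1 = S2.add b2) : b1 = b2 ∧ p1 = p2 ∧ t1 = t2 := by
  have c1 : ∀ r, (S1.add b1).R r = (S2.add b2).R r := by rw [hS]; simp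
  have c2 : ∀ r, (S1.add b1).C r = (S2.add b2).C r := by rw [hS]; simp
  have d1 := c1 b1.1
  have d2 := c1 b2.1
  have d3 := c2 b1.2
  have d4 := c2 b2.2
  have l1 := hb1.1
  have l2 := hb2.1
  clear c1 c2
  obtain ⟨⟨r1, k1⟩, q1⟩ := t1
  obtain ⟨⟨r2, k2⟩, q2⟩ := t2
  obtain ⟨⟨u, v⟩, w⟩ := o
  obtain ⟨x1, y1⟩ := b1
  obtain ⟨x2, y2⟩ := b2
  obtain ⟨x, y⟩ := b'
  have e1 := h1.split
  have e2 := h2.split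
  clear h1 h2 hb1 hb2 hS
  simp only [Shape.add, Prod.mk.injEq] at *
  rcases e1 with e1 | ⟨_, _, _, _, e1 | e1 | e1 | e1⟩ <;>
    rcases e2 with e2 | ⟨_, _, _, _, e2 | e2 | e2 | e2⟩ <;> grind

theorem PushList.inj {S1 S2 : Shape} {b1 b2 p1 p2 l1 l2 o b' p'}
    (h1 : PushList S1 b1 p1 l1 o b' p') (h2 : PushList S2 b2 p2 l2 o b' p')
    (hb1 : S1.Addable b1) (hb2 : S2.Addable b2)
    (hp1 : b1.1 = b1.2 → p1 = false) (hp2 : b2.1 = b2.2 → p2 = false)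
    (hc1 : S1.Chain l1) (hc2 : S2.Chain l2)
    (hS : S1.add b1 = S2.add b2) : b1 = b2 ∧ p1 = p2 ∧ l1 = l2 := by
  induction h1 generalizing S2 b2 p2 l2 with
  | nil => cases h2; simp
  | cons g1 _ ih =>
    cases h2 with
    | cons g2 h2 =>
      obtain ⟨rfl, rfl, rfl⟩ := ih h2 (g1.addable hb1 hc1.1) (g2.addable hb2 hc2.1) (g1.diag hp1)
        (g2.diag hp2) hc1.2 hc2.2
        (by rw [← (g1.chain_out hb1 hc1.1).2, ← (g2.chain_out hb2 hc2.1).2, hS])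
      obtain ⟨rfl, rfl, rfl⟩ := g1.inj g2 hb1 hb2 hp1 hp2 hS
      simp

theorem Tableau.set_inj_of_not_mem {T1 T2 : Tableau} {b : ℕ × ℕ} {u : Letter} (h1 : b ∉ T1.keys)
    (h2 : b ∉ T2.keys) (h : T1.set b u = T2.set b u) : T1 = T2 := by
  refine Finmap.ext_lookup fun c => ?_
  by_cases hc : c = b
  · subst hc
    rw [Finmap.mem_keys] at h1 h2
    rw [Finmap.lookup_eq_none.2 h1, Finmap.lookup_eq_none.2 h2]
  · have := congrArg (Finmap.lookup c) h
    unfold set at this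
    rwa [Finmap.lookup_insert_of_ne _ hc, Finmap.lookup_insert_of_ne _ hc] at this

/-- A partial signed permutation is determined by its insertion tableau and its trace: the largest
letter is visible in the tableau, and the position of the virtual step is recovered by undoing
pushes. -/
theorem Inserted.inj {a b : Word} (ha : IsPartialSignedPerm a) (hb : IsPartialSignedPerm b)
    {T l} (h1 : Inserted ∅ a T l) (h2 : Inserted ∅ b T l) : a = b := by
  induction hn : a.length generalizing a b T l with
  | zero =>
    have := h1.length_eq.symm.trans h2.length_eq
    rw [List.length_eq_zero_iff.1 hn, List.length_eq_zero_iff.1 (this.symm.trans hn)]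
  | succ n ih =>
    have hab : a.length = b.length := h1.length_eq.symm.trans h2.length_eq
    have key : ∀ a : Word, IsPartialSignedPerm a → a.length = n + 1 → Inserted ∅ a T l →
        ∃ u m v T' lu lv c p, a = u ++ m :: v ∧ lu.length = u.length ∧
          IsPartialSignedPerm (u ++ v) ∧ Inserted ∅ (u ++ v) T' (lu ++ lv) ∧
          T'.ValsLT m.val ∧ c ∉ T'.keys ∧ T = T'.set c ⟨m.val, p⟩ ∧
          (∀ t ∈ lu, t ≠ virtualStep (n + 3)) ∧
          (Shape.base (n + 3)).Chain (lu ++ virtualStep (n + 3) :: lv) ∧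
          PushList (Shape.base (n + 3)) (0, n + 3) m.primed (lu ++ virtualStep (n + 3) :: lv) l
            c p := by
      intro a ha hn h1
      obtain ⟨m, hma, hmax⟩ := exists_val_max (a := a) (by rintro rfl; simp at hn)
      obtain ⟨u, v, rfl⟩ := List.append_of_mem hma
      have hlt := ha.val_lt hmax
      have hn' : (u ++ v).length = n := by simp at hn ⊢; omega
      obtain ⟨T', l', hI, -, hC⟩ := exists_inserted _ ha.remove
      obtain ⟨lu, lv, rfl, h3, h4⟩ := List.append_eq_of_length
        (hI.length_eq.trans List.length_append)
      have hc := hC (n + 3) (by omega)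
      obtain ⟨hch, c, p, l'', hI', hP, hc1⟩ := hI.insert_max h3 hlt (by omega) hc
      obtain ⟨rfl, rfl⟩ := hI'.det h1
      refine ⟨u, m, v, T', lu, lv, c, p, rfl, h3, ha.remove, hI,
        hI.valsLT (Tableau.valsLT_empty _) hlt, ?_, rfl, ?_, hch, hP⟩
      · intro hcT
        have h6 := (hP.addable hch (Shape.base_addable _)).2.1
        have h7 := (hc.insert (q := false) (Shape.base_addable _) (fun t ht e => by
          have := hI.one_le t ht
          rw [e] at this
          simp at this)).2.2
        change ((Shape.base (n + 3)).adds (lu ++ virtualStep (n + 3) :: lv)) = _ at h7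
        have h8 := (hI.hasShape (Tableau.hasShape_empty _) hc c).1 hcT
        rw [h7] at h6
        unfold Shape.add at h6
        unfold Shape.Mem at h8
        simp only at h6
        rw [if_neg (by omega)] at h6
        omega
      · intro t ht e
        have := hI.one_le t (by simp [ht])
        rw [e] at this
        simp [virtualStep] at this
    obtain ⟨u, m, v, T1, lu, lv, c, p, rfl, e1, e2, e3, e4, e5, rfl, e7, e8, e9⟩ := key a ha hn h1
    obtain ⟨u', m', v', T2, lu', lv', c', p', rfl, f1, f2, f3, f4, f5, f6, f7, f8, f9⟩ :=
      key b hb (by omega) h2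
    have hcc : c = c' := by
      by_contra hne
      have g1 : c ∈ T2.keys := by
        have : c ∈ (T1.set c ⟨m.val, p⟩).keys := Tableau.mem_keys_set.2 (Or.inl rfl)
        rw [f6, Tableau.mem_keys_set] at this
        tauto
      have g2 : c' ∈ T1.keys := by
        have : c' ∈ (T2.set c' ⟨m'.val, p'⟩).keys := Tableau.mem_keys_set.2 (Or.inl rfl)
        rw [← f6, Tableau.mem_keys_set] at this
        exact this.resolve_left (Ne.symm hne)
      have g3 := f4 c g1
      have g4 := e4 c' g2
      rw [← Tableau.entry_set_of_ne T2 ⟨m'.val, p'⟩ hne, ← f6, Tableau.entry_set_self] at g3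
      rw [← Tableau.entry_set_of_ne T1 ⟨m.val, p⟩ (Ne.symm hne), f6, Tableau.entry_set_self] at g4
      simp only at g3 g4
      omega
    subst hcc
    have hent : (⟨m.val, p⟩ : Letter) = ⟨m'.val, p'⟩ := by
      rw [← Tableau.entry_set_self T1 c ⟨m.val, p⟩, f6, Tableau.entry_set_self]
    rw [hent] at f6
    obtain ⟨hv, rfl⟩ := Letter.mk.inj hent
    have hT := Tableau.set_inj_of_not_mem e5 f5 f6
    subst hT
    obtain ⟨-, hpm, hll⟩ := e9.inj f9 (Shape.base_addable _) (Shape.base_addable _) (by simp)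
      (by simp) e8 f8 rfl
    have hmm : m = m' := Letter.ext hv hpm
    subst hmm
    have hlu : lu = lu' ∧ lv = lv' := by
      clear * - hll e7 f7
      induction lu generalizing lu' with
      | nil =>
        cases lu' with
        | nil => simpa using hll
        | cons t lu' =>
          simp only [List.nil_append, List.cons_append, List.cons.injEq] at hll
          exact absurd hll.1.symm (f7 t (by simp))
      | cons t lu ih =>
        cases lu' with
        | nil =>
          simp only [List.nil_append, List.cons_append, List.cons.injEq] at hll
          exact absurd hll.1 (e7 t (by simp))
        | cons t' lu' =>
          simp only [List.cons_append, List.cons.injEq] at hll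
          obtain ⟨rfl, rfl⟩ := ih (fun s hs => e7 s (by simp [hs]))
              _ (fun s hs => f7 s (by simp [hs]))
            hll.2
          simp [hll.1]
    obtain ⟨rfl, rfl⟩ := hlu
    have := ih e2 f2 e3 f3 (by simp at hn ⊢; omega)
    obtain ⟨rfl, rfl⟩ := List.append_inj this (e1.symm.trans f1)
    rfl

/-! ### Reading words and recording tableaux -/

namespace Tableau

theorem lookup_set (T : Tableau) (b c : ℕ × ℕ) (u : Letter) :
    (T.set b u).lookup c = if c = b then some u else T.lookup c := by
  unfold set
  split_ifs with h
  · subst h; exact Finmap.lookup_insert _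
  · exact Finmap.lookup_insert_of_ne _ h

theorem entry_set (T : Tableau) (b c : ℕ × ℕ) (u : Letter) :
    (T.set b u).entry c = if c = b then u else T.entry c := by
  split_ifs with h
  · subst h; exact entry_set_self _ _ _
  · exact entry_set_of_ne _ _ h

/-- No two boxes have entries with the same `val`. -/
def LabelsInj (T : Tableau) : Prop :=
  ∀ b ∈ T.keys, ∀ c ∈ T.keys, (T.entry b).val = (T.entry c).val → b = c

theorem LabelsInj.boxOf_entry {T : Tableau} (h : T.LabelsInj) {b : ℕ × ℕ} (hb : b ∈ T.keys) :
    T.boxOf (T.entry b).val = b := by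
  have : T.keys.filter (fun c => (T.entry c).val = (T.entry b).val) = {b} := by
    ext c
    simp only [Finset.mem_filter, Finset.mem_singleton]
    constructor
    · rintro ⟨h1, h2⟩; exact h c h1 b hb h2
    · rintro rfl; exact ⟨hb, rfl⟩
  rw [boxOf, this, Finset.sup_singleton, id]

/-- The lane of the step that is recorded by the entry in a box. -/
def laneAt (T : Tableau) (b : ℕ × ℕ) : ℕ := lane (b, (T.entry b).primed)

theorem _root_.List.Pairwise.idxOf_lt {α : Type*} [DecidableEq α] {r : α → α → Prop} {l : List α}
    (h : l.Pairwise r) {x y : α} (hx : x ∈ l) (hy : y ∈ l) (hne : x ≠ y) (hr : ¬ r y x) :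
    l.idxOf x < l.idxOf y := by
  by_contra hlt
  have h1 : l.idxOf y < l.idxOf x := by
    refine lt_of_le_of_ne (not_lt.1 hlt) fun e => hne ?_
    exact ((List.idxOf_inj hy).1 e).symm
  have h2 := List.pairwise_iff_getElem.1 h _ _ (List.idxOf_lt_length_of_mem hy)
    (List.idxOf_lt_length_of_mem hx) h1
  simp only [List.getElem_idxOf] at h2
  exact hr h2

theorem mem_primedCol {T : Tableau} {j : ℕ} {m : ℤ} : m ∈ T.primedCol j ↔
    ∃ b ∈ T.keys, b.2 = j ∧ (T.entry b).primed = true ∧ (T.entry b).val = m := by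
  simp [primedCol, and_assoc]

theorem mem_unprimedRow {T : Tableau} {j : ℕ} {m : ℤ} : m ∈ T.unprimedRow j ↔
    ∃ b ∈ T.keys, b.1 = j ∧ (T.entry b).primed = false ∧ (T.entry b).val = m := by
  simp [unprimedRow, and_assoc]

theorem LabelsInj.pairwise_sort {T : Tableau} (h : T.LabelsInj) (p : ℕ × ℕ → Prop)
    [DecidablePred p] :
    (((T.keys.filter p).val.map (fun b => (T.entry b).val)).sort (· ≤ ·)).Pairwise (· < ·) := by
  have h1 := Multiset.pairwise_sort ((T.keys.filter p).val.map (fun b => (T.entry b).val)) (· ≤ ·)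
  have h2 : (((T.keys.filter p).val.map (fun b => (T.entry b).val)).sort (· ≤ ·)).Nodup := by
    rw [← Multiset.coe_nodup, Multiset.sort_eq]
    refine Multiset.Nodup.map_on ?_ (T.keys.filter p).nodup
    intro b hb c hc e
    exact h b (Finset.mem_filter.1 hb).1 c (Finset.mem_filter.1 hc).1 e
  exact (h1.and h2).imp (fun ⟨a, b⟩ => lt_of_le_of_ne a b)

/-- The reading word lists the labels by decreasing lanes, and by increasing labels within a lane.
-/
theorem LabelsInj.pairwise_shword {T : Tableau} (h : T.LabelsInj) :
    T.shword.Pairwise (fun x y => T.laneAt (T.boxOf y) < T.laneAt (T.boxOf x) ∨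
      (T.laneAt (T.boxOf y) = T.laneAt (T.boxOf x) ∧ x < y)) := by
  have hc : ∀ {j m}, m ∈ T.primedCol j → T.laneAt (T.boxOf m) = 2 * j + 1 := by
    intro j m hm
    obtain ⟨b, hb, rfl, h1, rfl⟩ := mem_primedCol.1 hm
    rw [h.boxOf_entry hb, laneAt, lane, h1]; rfl
  have hr : ∀ {j m}, m ∈ T.unprimedRow j → T.laneAt (T.boxOf m) = 2 * j := by
    intro j m hm
    obtain ⟨b, hb, rfl, h1, rfl⟩ := mem_unprimedRow.1 hm
    rw [h.boxOf_entry hb, laneAt, lane, h1]; rfl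
  unfold shword
  rw [List.pairwise_flatMap]
  constructor
  · intro j _
    rw [List.pairwise_append]
    refine ⟨?_, ?_, ?_⟩
    · refine (h.pairwise_sort _).imp_of_mem ?_
      intro x y hx hy hxy
      exact Or.inr ⟨(hc (j := j) hy).trans (hc (j := j) hx).symm, hxy⟩
    · refine (h.pairwise_sort _).imp_of_mem ?_
      intro x y hx hy hxy
      exact Or.inr ⟨(hr (j := j) hy).trans (hr (j := j) hx).symm, hxy⟩
    · intro x hx y hy
      left; rw [hc hx, hr hy]; omega
  · rw [List.pairwise_reverse]
    refine List.Pairwise.imp ?_ List.pairwise_lt_range'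
    intro i j hij x hx y hy
    left
    rw [List.mem_append] at hx hy
    rcases hx with hx | hx <;> rcases hy with hy | hy
    · rw [hc hx, hc hy]; omega
    · rw [hc hx, hr hy]; omega
    · rw [hr hx, hc hy]; omega
    · rw [hr hx, hr hy]; omega

theorem mem_shword {T : Tableau} {b : ℕ × ℕ} (hb : b ∈ T.keys) (h1 : 1 ≤ b.1) (h2 : 1 ≤ b.2) :
    (T.entry b).val ∈ T.shword := by
  have h3 : max b.1 b.2 ≤ T.bound :=
    Finset.le_sup (f := fun b : ℕ × ℕ => max b.1 b.2) hb
  unfold shword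
  simp only [List.mem_flatMap, List.mem_reverse, List.mem_range'_1, List.mem_append,
    mem_primedCol, mem_unprimedRow]
  cases hp : (T.entry b).primed
  · exact ⟨b.1, by omega, Or.inr ⟨b, hb, rfl, hp, rfl⟩⟩
  · exact ⟨b.2, by omega, Or.inl ⟨b, hb, rfl, hp, rfl⟩⟩

theorem LabelsInj.idxOf_lt {T : Tableau} (h : T.LabelsInj) (h1 : ∀ b ∈ T.keys, 1 ≤ b.1 ∧ b.1 ≤ b.2)
    {b c : ℕ × ℕ} (hb : b ∈ T.keys) (hc : c ∈ T.keys) (hlt : (T.entry b).val < (T.entry c).val) :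
    (T.laneAt c ≤ T.laneAt b → T.shword.idxOf (T.entry b).val < T.shword.idxOf (T.entry c).val) ∧
    (T.laneAt b < T.laneAt c → T.shword.idxOf (T.entry c).val < T.shword.idxOf (T.entry b).val) :=
        by
  have hbm := mem_shword hb (h1 b hb).1 (by have := h1 b hb; omega)
  have hcm := mem_shword hc (h1 c hc).1 (by have := h1 c hc; omega)
  constructor
  · intro hl
    refine h.pairwise_shword.idxOf_lt hbm hcm hlt.ne ?_
    rw [h.boxOf_entry hb, h.boxOf_entry hc]
    omega
  · intro hl
    refine h.pairwise_shword.idxOf_lt hcm hbm hlt.ne' ?_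
    rw [h.boxOf_entry hb, h.boxOf_entry hc]
    omega

end Tableau

/-- Continue the recording tableau `Q` by the steps of a list, labelled from `k` on. -/
def recFrom (Q : Tableau) (k : ℕ) : List Step → Tableau
  | [] => Q
  | t :: l => recFrom (Q.set t.1 ⟨k, t.2⟩) (k + 1) l

/-- The recording tableau of a list of steps. -/
def recTab (l : List Step) : Tableau := recFrom ∅ 1 l

theorem Inserted.foldl_swStep {T w T' l} (h : Inserted T w T' l) (Q : Tableau) (k : ℕ) :
    (w.zipIdx k).foldl swStep (T, Q) = (T', recFrom Q k l) := by
  induction h generalizing Q k with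
  | nil => rfl
  | @cons T x T1 t w T' l h1 _ ih =>
    rw [List.zipIdx_cons, List.foldl_cons]
    have : swStep (T, Q) (x, k) = (T1, Q.set t.1 ⟨k, t.2⟩) := by
      unfold swStep
      simp only [h1.insertLine_eq]
      cases t.2 <;> simp
    rw [this, ih]
    rfl

theorem Inserted.sw_eq {w T l} (h : Inserted ∅ w T l) : PSW w = T ∧ QSW w = recTab l := by
  have := h.foldl_swStep ∅ 1
  exact ⟨congrArg Prod.fst this, congrArg Prod.snd this⟩

theorem recFrom_append (Q : Tableau) (k : ℕ) (l l' : List Step) :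
    recFrom Q k (l ++ l') = recFrom (recFrom Q k l) (k + l.length) l' := by
  induction l generalizing Q k with
  | nil => rfl
  | cons t l ih =>
    rw [List.cons_append, recFrom, ih, recFrom, List.length_cons]
    congr 1; omega

theorem recFrom_set (Q : Tableau) (k : ℕ) (l : List Step) {b : ℕ × ℕ} (u : Letter)
    (hb : ∀ t ∈ l, t.1 ≠ b) : recFrom (Q.set b u) k l = (recFrom Q k l).set b u := by
  induction l generalizing Q k with
  | nil => rfl
  | cons t l ih =>
    rw [recFrom, Tableau.set_comm _ _ _ (hb t (by simp)).symm,
        ih _ _ (fun s hs => hb s (by simp [hs]))]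
    rfl

theorem recFrom_keys (Q : Tableau) (k : ℕ) (l : List Step) :
    (recFrom Q k l).keys = Q.keys ∪ (l.map Prod.fst).toFinset := by
  induction l generalizing Q k with
  | nil => simp [recFrom]
  | cons t l ih =>
    rw [recFrom, ih, Tableau.keys_set]
    ext c; simp

theorem recTab_keys (l : List Step) : (recTab l).keys = (l.map Prod.fst).toFinset := by
  rw [recTab, recFrom_keys]; simp

theorem mem_recTab_keys {l : List Step} {b : ℕ × ℕ} : b ∈ (recTab l).keys ↔ ∃ t ∈ l, t.1 = b := by
  rw [recTab_keys]; simp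

theorem recTab_size {l : List Step} (h : (l.map Prod.fst).Nodup) : (recTab l).size = l.length := by
  rw [Tableau.size, recTab_keys, List.toFinset_card_of_nodup h, List.length_map]

theorem recTab_middle {l l' : List Step} {t : Step} (h : ((l ++ t :: l').map Prod.fst).Nodup) :
    recTab (l ++ t :: l') = (recFrom (recTab l) (l.length + 2) l').set t.1 ⟨l.length + 1, t.2⟩ := by
  rw [recTab, recFrom_append, recFrom, recFrom_set, recTab]
  · push_cast
    rw [show 1 + l.length + 1 = l.length + 2 by omega, show (1 : ℤ) + l.length =
        l.length + 1 by omega]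
  · intro s hs e
    rw [List.map_append, List.map_cons, List.nodup_middle, List.nodup_cons] at h
    exact h.1 (List.mem_append_right _ (List.mem_map.2 ⟨s, hs, e⟩))

theorem recTab_entry {l l' : List Step} {t : Step} (h : ((l ++ t :: l').map Prod.fst).Nodup) :
    (recTab (l ++ t :: l')).entry t.1 = ⟨l.length + 1, t.2⟩ := by
  rw [recTab_middle h, Tableau.entry_set_self]

theorem recTab_labelsInj {l : List Step} (h : (l.map Prod.fst).Nodup) : (recTab l).LabelsInj := by
  intro b hb c hc e
  obtain ⟨t, ht, rfl⟩ := mem_recTab_keys.1 hb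
  obtain ⟨s, hs, rfl⟩ := mem_recTab_keys.1 hc
  obtain ⟨u, v, rfl⟩ := List.append_of_mem ht
  obtain ⟨u', v', h'⟩ := List.append_of_mem hs
  have h1 := recTab_entry h
  rw [h'] at h
  have h2 := recTab_entry h
  rw [← h'] at h2
  rw [h1, h2] at e
  simp only at e
  obtain ⟨-, h3⟩ := List.append_inj h' (by omega)
  rw [(List.cons.inj h3).1]

theorem Shape.Chain.mem {S : Shape} {l : List Step} (h : S.Chain l) {e : ℕ × ℕ} (he : S.Mem e) :
    (S.adds l).Mem e ∧ ∀ t ∈ l, t.1 ≠ e := by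
  induction l generalizing S with
  | nil => simpa using he
  | cons t l ih =>
    obtain ⟨h1, h2⟩ := ih h.2 (he.add h.1)
    refine ⟨h1, fun s hs => ?_⟩
    rcases List.mem_cons.1 hs with rfl | hs
    · rintro rfl
      have h3 := h.1
      unfold Shape.Addable at h3
      unfold Shape.Mem at he
      omega
    · exact h2 s hs

theorem Shape.Chain.nodup {S : Shape} {l : List Step} (h : S.Chain l) : (l.map Prod.fst).Nodup := by
  induction l generalizing S with
  | nil => simp
  | cons t l ih =>
    rw [List.map_cons, List.nodup_cons]
    refine ⟨?_, ih h.2⟩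
    rw [List.mem_map]
    rintro ⟨s, hs, e⟩
    exact (h.2.mem h.1.mem_add).2 s hs e

theorem Shape.Chain.le {S : Shape} {l : List Step} (h : S.Chain l) : ∀ t ∈ l, t.1.1 ≤ t.1.2 := by
  induction l generalizing S with
  | nil => simp
  | cons t l ih =>
    intro s hs
    rcases List.mem_cons.1 hs with rfl | hs
    exacts [h.1.1, ih h.2 s hs]

/-! ### Dual equivalence operators on recording tableaux -/

open Tableau

/-- A list of steps that can be performed above the virtual row of length `N` without using it. -/
structure IsTrace (N : ℕ) (l : List Step) : Prop where
  chain : (Shape.base N).Chain l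
  one_le : ∀ t ∈ l, 1 ≤ t.1.1

theorem IsTrace.nodup {N l} (h : IsTrace N l) : (l.map Prod.fst).Nodup := h.chain.nodup

theorem recTab_three {l1 l2 : List Step} {t1 t2 t3 : Step}
    (h : ((l1 ++ t1 :: t2 :: t3 :: l2).map Prod.fst).Nodup) :
    recTab (l1 ++ t1 :: t2 :: t3 :: l2) =
      (((recFrom (recTab l1) (l1.length + 4) l2).set t1.1 ⟨l1.length + 1, t1.2⟩).set
        t2.1 ⟨l1.length + 2, t2.2⟩).set t3.1 ⟨l1.length + 3, t3.2⟩ := by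
  rw [recTab, recFrom_append, recFrom, recFrom, recFrom]
  rw [List.map_append, List.nodup_append] at h
  obtain ⟨-, h, -⟩ := h
  simp only [List.map_cons, List.nodup_cons, List.mem_cons, List.mem_map, not_or, not_exists,
    not_and] at h
  rw [recFrom_set, recFrom_set, recFrom_set, recTab]
  · push_cast
    rw [show 1 + l1.length + 1 + 1 + 1 = l1.length + 4 by omega,
      show (1 : ℤ) + l1.length = l1.length + 1 by omega,
      show (l1.length : ℤ) + 1 + 1 = l1.length + 2 by omega,
      show (l1.length : ℤ) + 2 + 1 = l1.length + 3 by omega]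
  · exact fun s hs => h.1.2.2 s hs
  · exact fun s hs => h.2.1.2 s hs
  · exact fun s hs => h.2.2.1 s hs

/-- The order of two labels in the reading word is decided by comparing the lanes of their steps. -/
theorem IsTrace.idxOf {N : ℕ} {u v w : List Step} {s t : Step}
    (h : IsTrace N (u ++ s :: v ++ t :: w)) :
    (lane t ≤ lane s → (recTab (u ++ s :: v ++ t :: w)).shword.idxOf (u.length + 1 : ℤ) <
      (recTab (u ++ s :: v ++ t :: w)).shword.idxOf (u.length + v.length + 2 : ℤ)) ∧
    (lane s < lane t → (recTab (u ++ s :: v ++ t :: w)).shword.idxOf (u.length + v.length + 2 : ℤ) <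
      (recTab (u ++ s :: v ++ t :: w)).shword.idxOf (u.length + 1 : ℤ)) := by
  have hn := h.nodup
  have ht := recTab_entry hn
  have hs : (recTab (u ++ s :: v ++ t :: w)).entry s.1 = ⟨u.length + 1, s.2⟩ := by
    have := recTab_entry (l := u) (t := s) (l' := v ++ t :: w) (by simpa using hn)
    simpa using this
  have hlt : ((recTab (u ++ s :: v ++ t :: w)).entry s.1).val <
      ((recTab (u ++ s :: v ++ t :: w)).entry t.1).val := by
    rw [hs, ht]; simp
  have := (recTab_labelsInj hn).idxOf_lt ?_ (b := s.1) (c := t.1) ?_ ?_ hlt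
  · simp only [laneAt, hs, ht] at this
    have e : (((u ++ s :: v).length : ℤ) + 1) = u.length + v.length + 2 := by simp; omega
    rw [e] at this
    exact this
  · intro b hb
    obtain ⟨t, ht, rfl⟩ := mem_recTab_keys.1 hb
    exact ⟨h.one_le t ht, h.chain.le t ht⟩
  · exact mem_recTab_keys.2 ⟨s, by simp, rfl⟩
  · exact mem_recTab_keys.2 ⟨t, by simp, rfl⟩

/-- The case distinction in the dual equivalence operator in terms of lanes. -/
theorem IsTrace.dOp_eq {N : ℕ} {l1 l2 : List Step} {t1 t2 t3 : Step}
    (h : IsTrace N (l1 ++ t1 :: t2 :: t3 :: l2)) {T : Tableau}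
    (hT : T = recTab (l1 ++ t1 :: t2 :: t3 :: l2)) :
    dOp (l1.length + 1) T =
      if (lane t3 ≤ lane t1 ∧ lane t2 < lane t3) ∨ (lane t3 ≤ lane t2 ∧ lane t1 < lane t3) then
        sOp (l1.length + 1) T
      else if (lane t1 < lane t2 ∧ lane t3 ≤ lane t1) ∨ (lane t1 < lane t3 ∧ lane t2 ≤ lane t1) then
        sOp (l1.length + 2) T
      else T := by
  have h12 := IsTrace.idxOf (u := l1) (s := t1) (v := []) (t := t2) (w := t3 :: l2) (N := N)
    (by simpa using h)
  have h13 := IsTrace.idxOf (u := l1) (s := t1) (v := [t2]) (t := t3) (w := l2) (N := N)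
    (by simpa using h)
  have h23 := IsTrace.idxOf (u := l1 ++ [t1]) (s := t2) (v := []) (t := t3) (w := l2) (N := N)
    (by simpa using h)
  have hsize : T.size = l1.length + l2.length + 3 := by
    rw [hT, recTab_size h.nodup]; simp; omega
  simp only [List.append_assoc, List.cons_append, List.nil_append, ← hT, List.length_append,
    List.length_cons, List.length_nil] at h12 h13 h23
  unfold dOp Between
  push_cast at h12 h13 h23 ⊢
  rw [show (l1.length : ℤ) + 0 + 2 = l1.length + 2 by omega] at h12
  rw [show (l1.length : ℤ) + 1 + 2 = l1.length + 3 by omega] at h13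
  rw [show (l1.length : ℤ) + 1 + 0 + 2 = l1.length + 3 by omega,
    show (l1.length : ℤ) + 1 + 1 = l1.length + 2 by omega] at h23
  rw [show (l1.length : ℤ) + 1 + 1 = l1.length + 2 by omega,
    show (l1.length : ℤ) + 1 + 2 = l1.length + 3 by omega, if_pos (by omega), if_neg (by omega),
    if_neg (by omega)]
  refine if_congr ?_ rfl (if_congr ?_ rfl rfl)
  · omega
  · omega

theorem IsTrace.boxOf {N : ℕ} {u v : List Step} {t : Step} (h : IsTrace N (u ++ t :: v)) :
    (recTab (u ++ t :: v)).boxOf (u.length + 1) = t.1 := by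
  have := (recTab_labelsInj h.nodup).boxOf_entry (b := t.1) (mem_recTab_keys.2 ⟨t, by simp, rfl⟩)
  rwa [recTab_entry h.nodup] at this

/-- The boxes and entries of three consecutive labels. -/
theorem IsTrace.three {N : ℕ} {l1 l2 : List Step} {t1 t2 t3 : Step}
    (h : IsTrace N (l1 ++ t1 :: t2 :: t3 :: l2)) :
    let T := recTab (l1 ++ t1 :: t2 :: t3 :: l2)
    (T.boxOf (l1.length + 1) = t1.1 ∧ T.boxOf (l1.length + 2) = t2.1 ∧
      T.boxOf (l1.length + 3) = t3.1) ∧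
    (T.entry t1.1 = ⟨l1.length + 1, t1.2⟩ ∧ T.entry t2.1 = ⟨l1.length + 2, t2.2⟩ ∧
      T.entry t3.1 = ⟨l1.length + 3, t3.2⟩) ∧
    (t1.1 ≠ t2.1 ∧ t1.1 ≠ t3.1 ∧ t2.1 ≠ t3.1) ∧ ((l1.length : ℤ) + 3 ≤ T.size) := by
  intro T
  have hn := h.nodup
  have e2 : l1 ++ t1 :: t2 :: t3 :: l2 = (l1 ++ [t1]) ++ t2 :: t3 :: l2 := by simp
  have e3 : l1 ++ t1 :: t2 :: t3 :: l2 = (l1 ++ [t1, t2]) ++ t3 :: l2 := by simp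
  have b1 := h.boxOf
  have c1 := recTab_entry hn
  have hsize : T.size = l1.length + l2.length + 3 := by
    rw [recTab_size hn]; simp; omega
  have b2 : T.boxOf (l1.length + 2) = t2.1 ∧ T.entry t2.1 = ⟨l1.length + 2, t2.2⟩ := by
    change (recTab _).boxOf _ = _ ∧ (recTab _).entry _ = _
    rw [e2] at h hn ⊢
    have := h.boxOf
    rw [recTab_entry hn, ← this]
    simp [add_assoc]
  have b3 : T.boxOf (l1.length + 3) = t3.1 ∧ T.entry t3.1 = ⟨l1.length + 3, t3.2⟩ := by
    change (recTab _).boxOf _ = _ ∧ (recTab _).entry _ = _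
    rw [e3] at h hn ⊢
    have := h.boxOf
    rw [recTab_entry hn, ← this]
    simp [add_assoc]
  refine ⟨⟨b1, b2.1, b3.1⟩, ⟨c1, b2.2, b3.2⟩, ⟨?_, ?_, ?_⟩, by omega⟩
  · intro e
    have h1 := b2.2
    rw [← e, c1] at h1
    have := congrArg Letter.val h1
    simp only at this; omega
  · intro e
    have h1 := b3.2
    rw [← e, c1] at h1
    have := congrArg Letter.val h1
    simp only at this; omega
  · intro e
    have h1 := b3.2
    rw [← e, b2.2] at h1
    have := congrArg Letter.val h1
    simp only at this; omega

theorem IsTrace.addable {N : ℕ} {l1 l2 : List Step} {t1 t2 t3 : Step}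
    (h : IsTrace N (l1 ++ t1 :: t2 :: t3 :: l2)) :
    ∃ S : Shape, S.Ok ∧ S.Addable t1.1 ∧ (S.add t1.1).Addable t2.1 ∧
      ((S.add t1.1).add t2.1).Addable t3.1 := by
  have := Shape.chain_append.1 h.chain
  exact ⟨_, (Shape.base_ok N).adds this.1, this.2.1, this.2.2.1, this.2.2.2.1⟩

theorem sOp_swap {T : Tableau} {i : ℤ} {b c : ℕ × ℕ} (hb : T.boxOf i = b)
    (hc : T.boxOf (i + 1) = c) (h : b.1 ≠ c.1 ∧ b.2 ≠ c.2) :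
    sOp i T = (T.set b ⟨i + 1, (T.entry b).primed⟩).set c ⟨i, (T.entry c).primed⟩ := by
  unfold sOp
  simp only [hb, hc]
  rw [if_pos h]

theorem sOp_flip {T : Tableau} {i : ℤ} {b c : ℕ × ℕ} (hb : T.boxOf i = b)
    (hc : T.boxOf (i + 1) = c) (h : b.1 = c.1 ∨ b.2 = c.2) (hbd : b.1 ≠ b.2) (hcd : c.1 ≠ c.2) :
    sOp i T = (T.reverseAt b).reverseAt c := by
  unfold sOp
  simp only [hb, hc]
  rw [if_neg (by tauto), if_pos ⟨hbd, hcd⟩]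

theorem sOp_diag_above {T : Tableau} {i : ℤ} {b c d : ℕ × ℕ} (hb : T.boxOf i = b)
    (hc : T.boxOf (i + 1) = c) (hd : T.boxOf (i - 1) = d) (hi : 1 ≤ i - 1) (h : b.2 = c.2)
    (hbd : b.1 ≠ b.2) (hcd : c.1 = c.2) (hdd : d.1 = d.2) :
    sOp i T = (T.reverseAt b).switchAt d c := by
  unfold sOp
  simp only [hb, hc, hd]
  rw [if_neg (by tauto), if_neg (by tauto), if_neg hbd, if_pos ⟨hi, hdd, hcd⟩]

theorem sOp_diag_below {T : Tableau} {i : ℤ} {b c d : ℕ × ℕ} (hb : T.boxOf i = b)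
    (hc : T.boxOf (i + 1) = c) (hd : T.boxOf (i + 2) = d) (hi : i + 2 ≤ T.size) (h : b.1 = c.1)
    (hbd : b.1 = b.2) (hcd : c.1 ≠ c.2) (hdd : d.1 = d.2) :
    sOp i T = (T.reverseAt c).switchAt b d := by
  unfold sOp
  simp only [hb, hc, hd]
  rw [if_neg (by tauto), if_neg (by tauto), if_pos hbd, if_neg (by tauto), if_pos ⟨hi, hbd, hdd⟩]

/-- If the lane of an earlier step separates an unprimed step from an adjacent primed one, then it
still does after both primes have been reversed. -/
theorem flip_lanes {S : Shape} (hS : S.Ok) {t : Step} {b c : ℕ × ℕ} (ht : S.Addable t.1)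
    (hb : (S.add t.1).Addable b) (hc : ((S.add t.1).add b).Addable c) (hcd : c.1 ≠ c.2)
    (hadj : b.1 = c.1 ∨ b.2 = c.2) (h1 : lane (b, false) ≤ lane t)
    (h2 : lane t < lane (c, true)) : lane (c, false) ≤ lane t ∧ lane t < lane (b, true) := by
  have m1 := hb.not_le (hS.add ht) ht.mem_add
  have m3 := hc.not_le ((hS.add ht).add hb) hb.mem_add
  obtain ⟨⟨x, y⟩, q⟩ := t
  obtain ⟨r, k⟩ := b
  obtain ⟨r', k'⟩ := c
  have i1 := ((hS.add ht).add hb).hRC x k'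
  have i2 := hS.hRC (r + 1) (k - 1)
  have i3 := hS.hRC (r + 1) (r + 1)
  have i4 := hS.hRC x r
  have i5 := hS.hRC x (r + 1)
  have i6 := hS.hRC (r + 1) k
  unfold Shape.Addable Shape.add at *
  unfold lane at *
  cases q <;> simp only [if_true, if_false, Bool.false_eq_true] at * <;>
    rcases hadj with rfl | rfl <;> grind

/-- The dual equivalence operator exchanges the recording tableaux of two lists that differ by a
dual move. -/
theorem DualMove.dOp_recTab {N : ℕ} {l1 l2 : List Step} {t1 t2 t3 s1 s2 s3 : Step}
    (h : DualMove t1 t2 t3 s1 s2 s3)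
    (ht : IsTrace N (l1 ++ t1 :: t2 :: t3 :: l2)) (hs : IsTrace N (l1 ++ s1 :: s2 :: s3 :: l2)) :
    dOp (l1.length + 1) (recTab (l1 ++ t1 :: t2 :: t3 :: l2)) =
      recTab (l1 ++ s1 :: s2 :: s3 :: l2) ∧
    dOp (l1.length + 1) (recTab (l1 ++ s1 :: s2 :: s3 :: l2)) =
      recTab (l1 ++ t1 :: t2 :: t3 :: l2) := by
  obtain ⟨⟨bt1, bt2, bt3⟩, ⟨et1, et2, et3⟩, ⟨nt1, nt2, nt3⟩, szt⟩ := ht.three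
  obtain ⟨⟨bs1, bs2, bs3⟩, ⟨es1, es2, es3⟩, ⟨ns1, ns2, ns3⟩, szs⟩ := hs.three
  have hn := recTab_three ht.nodup
  have hns := recTab_three hs.nodup
  have ht' := ht.dOp_eq rfl
  have hs' := hs.dOp_eq rfl
  obtain ⟨S, hS, a1, a2, a3⟩ := ht.addable
  have m1 := a2.not_le (hS.add a1) a1.mem_add
  have m2 := a3.not_le ((hS.add a1).add a2) (a1.mem_add.add a2)
  have m3 := a3.not_le ((hS.add a1).add a2) a2.mem_add
  have g1 := a1.1
  have g2 := a2.1
  have g3 := a3.1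
  rw [ht', hs']
  clear ht' hs'
  generalize recFrom (recTab l1) (l1.length + 4) l2 = W at *
  generalize recTab (l1 ++ t1 :: t2 :: t3 :: l2) = T at *
  generalize recTab (l1 ++ s1 :: s2 :: s3 :: l2) = T' at *
  have hk0 : (0 : ℤ) ≤ l1.length := by omega
  generalize (l1.length : ℤ) = k at *
  rw [show k + 2 = k + 1 + 1 by omega] at *
  rw [show k + 3 = k + 1 + 1 + 1 by omega] at *
  clear ht hs
  rcases h with ⟨hf, rfl, rfl, rfl, hk, hk'⟩ | ⟨hf, rfl, rfl, rfl, hk, hk'⟩ |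
    ⟨ha, hq, hq', rfl, rfl, rfl, hk, hk'⟩ | ⟨ha, hq, hq', rfl, rfl, rfl, hk, hk'⟩ |
    ⟨e1, e2, e3, hq, rfl, rfl, rfl⟩
  · rw [if_pos (by omega), if_pos (by omega), sOp_swap bt1 bt2 hf,
      sOp_swap bs1 bs2 ⟨hf.1.symm, hf.2.symm⟩, et1, et2, es1, es2, hn, hns]
    constructor <;> refine Finmap.ext_lookup fun c => ?_ <;> simp only [lookup_set] <;> grind
  · rw [if_neg (by omega), if_pos (by omega), if_neg (by omega), if_pos (by omega),
      sOp_swap bt2 bt3 hf, sOp_swap bs2 bs3 ⟨hf.1.symm, hf.2.symm⟩, et2, et3, es2, es3, hn, hns]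
    constructor <;> refine Finmap.ext_lookup fun c => ?_ <;> simp only [lookup_set] <;> grind
  · obtain ⟨d1, d2, hadj⟩ := ha
    have hl : lane (t1.1, false) < lane s3 ∧ lane s3 ≤ lane (t2.1, true) := by
      unfold lane at hk hk' ⊢
      simp only [hq, hq', if_true, if_false, Bool.false_eq_true] at hk hk' ⊢
      omega
    rw [if_pos (by omega), if_pos (by omega), sOp_flip bt1 bt2 hadj d1 d2,
      sOp_flip bs1 bs2 hadj d1 d2]
    simp only [reverseAt, entry_set, if_neg nt1.symm, et1, et2, es1, es2, Letter.reverse, hq, hq']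
    rw [hn, hns]
    constructor <;> refine Finmap.ext_lookup fun c => ?_ <;> simp only [lookup_set] <;> grind
  · obtain ⟨d1, d2, hadj⟩ := ha
    have hl : lane (t3.1, false) ≤ lane s1 ∧ lane s1 < lane (t2.1, true) :=
      flip_lanes hS a1 a2 a3 d2 hadj (by simpa [← hq] using hk) (by simpa [← hq'] using hk')
    rw [if_neg (by omega), if_pos (by omega), if_neg (by omega), if_pos (by omega),
      sOp_flip bt2 bt3 hadj d1 d2, sOp_flip bs2 bs3 hadj d1 d2]
    simp only [reverseAt, entry_set, if_neg nt3.symm, et2, et3, es2, es3, Letter.reverse, hq, hq']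
    rw [hn, hns]
    constructor <;> refine Finmap.ext_lookup fun c => ?_ <;> simp only [lookup_set] <;> grind
  · have hl : lane t2 ≤ lane t1 ∧ lane t1 < lane t3 ∧ lane (t3.1, t1.2) ≤ lane (t2.1, true) ∧
        lane (t1.1, t3.2) < lane (t3.1, t1.2) := by
      unfold lane
      simp only [hq, e2, e3]
      split_ifs <;> simp_all <;> omega
    rw [if_neg (by omega), if_pos (by omega), if_pos (by omega),
      sOp_diag_above bt2 bt3 (d := t1.1) (by rw [← bt1]; congr 1; omega) (by omega)
        (by rw [e2, e3]) (by rw [e2]; simp) (by rw [e3]) e1,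
      sOp_diag_below bs1 bs2 (d := t3.1) (by rw [← bs3]; congr 1; omega) (by omega)
        (by rw [e2]) e1 (by rw [e2]; simp) (by rw [e3])]
    simp only at es1 es2 es3
    simp only [switchAt, reverseAt, entry_set, if_neg nt1, if_neg nt3.symm,
      if_neg nt2.symm,
      et1, et2, et3, es1, es2, es3, Letter.reverse, hq]
    rw [hn, hns]
    constructor <;> refine Finmap.ext_lookup fun c => ?_
    · generalize t1.2 = q1
      generalize t3.2 = q3
      cases q1 <;> cases q3 <;> simp [lookup_set] <;> grind
    · generalize t1.2 = q1
      generalize t3.2 = q3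
      cases q1 <;> cases q3 <;> simp [lookup_set] <;> grind

/-! ### Dual equivalence of traces -/

open Tableau

/-- The relation on lists of steps that corresponds to the dual equivalence operator with index `i`:
a dual move in either direction, or reversing the prime of the first or second step. -/
inductive DualStep : ℤ → List Step → List Step → Prop
  | move {t1 t2 t3 s1 s2 s3 : Step} (l1 l2 : List Step) (h : DualMove t1 t2 t3 s1 s2 s3) :
      DualStep (l1.length + 1) (l1 ++ t1 :: t2 :: t3 :: l2) (l1 ++ s1 :: s2 :: s3 :: l2)
  | move_symm {t1 t2 t3 s1 s2 s3 : Step} (l1 l2 : List Step) (h : DualMove t1 t2 t3 s1 s2 s3) :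
      DualStep (l1.length + 1) (l1 ++ s1 :: s2 :: s3 :: l2) (l1 ++ t1 :: t2 :: t3 :: l2)
  | first (b : ℕ × ℕ) (q : Bool) (l : List Step) : DualStep (-1) ((b, q) :: l) ((b, !q) :: l)
  | second (t : Step) (b : ℕ × ℕ) (q : Bool) (l : List Step) :
      DualStep 0 (t :: (b, q) :: l) (t :: (b, !q) :: l)

theorem DualStep.symm {i l l'} (h : DualStep i l l') : DualStep i l' l := by
  cases h with
  | move l1 l2 h => exact .move_symm l1 l2 h
  | move_symm l1 l2 h => exact .move l1 l2 h
  | first b q l => simpa using DualStep.first b (!q) l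
  | second t b q l => simpa using DualStep.second t b (!q) l

theorem DualStep.append {i l l'} (h : DualStep i l l') (k : List Step) :
    DualStep i (l ++ k) (l' ++ k) := by
  cases h with
  | move l1 l2 h => simpa using DualStep.move l1 (l2 ++ k) h
  | move_symm l1 l2 h => simpa using DualStep.move_symm l1 (l2 ++ k) h
  | first b q l => exact .first b q (l ++ k)
  | second t b q l => exact .second t b q (l ++ k)

theorem IsTrace.snoc {N l} {t : Step} (h : IsTrace N l) (ht : ((Shape.base N).adds l).Addable t.1)
    (h1 : 1 ≤ t.1.1) : IsTrace N (l ++ [t]) := by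
  refine ⟨Shape.chain_append.2 ⟨h.chain, ht, trivial⟩, fun s hs => ?_⟩
  rw [List.mem_append, List.mem_singleton] at hs
  rcases hs with hs | rfl
  exacts [h.one_le s hs, h1]

theorem IsTrace.of_append {N l k} (h : IsTrace N (l ++ k)) : IsTrace N l :=
  ⟨(Shape.chain_append.1 h.chain).1, fun s hs => h.one_le s (by simp [hs])⟩

theorem IsTrace.last {N l} {t : Step} (h : IsTrace N (l ++ [t])) :
    ((Shape.base N).adds l).Addable t.1 ∧ 1 ≤ t.1.1 :=
  ⟨(Shape.chain_append.1 h.chain).2.1, h.one_le t (by simp)⟩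

theorem IsTrace.ok {N l} (h : IsTrace N l) : ((Shape.base N).adds l).Ok :=
  (Shape.base_ok N).adds h.chain

theorem IsTrace.first_box {N t l} (h : IsTrace N (t :: l)) : t.1 = (1, 1) := by
  have h1 := h.chain.1
  have h2 := h.one_le t (by simp)
  obtain ⟨⟨r, k⟩, q⟩ := t
  unfold Shape.Addable Shape.base at h1
  simp only at h1 h2
  grind

theorem IsTrace.second_box {N t s l} (h : IsTrace N (t :: s :: l)) : s.1 = (1, 2) := by
  have h0 := h.first_box
  have h1 := h.chain.2.1
  have h2 := h.one_le s (by simp)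
  rw [h0] at h1
  obtain ⟨⟨r, k⟩, q⟩ := s
  unfold Shape.Addable Shape.add Shape.base at h1
  simp only at h1 h2
  grind

theorem DualStep.dOp_recTab {N i l l'} (h : DualStep i l l') (hl : IsTrace N l)
    (hl' : IsTrace N l') : dOp i (recTab l) = recTab l' := by
  cases h with
  | move l1 l2 h => exact (h.dOp_recTab hl hl').1
  | move_symm l1 l2 h => exact (h.dOp_recTab hl' hl).2
  | first b q l =>
    have hb : b = (1, 1) := hl.first_box
    have e1 := recTab_entry (l := []) hl.nodup
    have m1 := recTab_middle (l := []) hl.nodup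
    have m2 := recTab_middle (l := []) hl'.nodup
    have hsz := recTab_size hl.nodup
    simp only [List.nil_append] at e1 m1 m2
    unfold dOp
    rw [if_pos (by rw [hsz]; simp), if_pos rfl, ← hb, reverseAt, e1, m1, m2, set_set]
    rfl
  | second t b q l =>
    have hb : b = (1, 2) := hl.second_box
    have e1 := recTab_entry (l := [t]) hl.nodup
    have m1 := recTab_middle (l := [t]) hl.nodup
    have m2 := recTab_middle (l := [t]) hl'.nodup
    have hsz := recTab_size hl.nodup
    simp only [List.cons_append, List.nil_append] at e1 m1 m2
    unfold dOp
    rw [if_pos (by rw [hsz]; simp; omega), if_neg (by omega), if_pos rfl, ← hb, reverseAt, e1, m1,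
      m2, set_set]
    rfl

/-- A box of the shape that can be removed. -/
def Shape.Corner (F : Shape) (c : ℕ × ℕ) : Prop := c.1 ≤ c.2 ∧ F.R c.1 = c.2 + 1 ∧ F.C c.2 = c.1 + 1

theorem Shape.Addable.corner {S : Shape} {c} (h : S.Addable c) : (S.add c).Corner c := by
  unfold Addable at h; unfold Corner add; simp only [if_true]; exact ⟨h.1, trivial, trivial⟩

theorem Shape.eq_of_add_eq {S S' : Shape} {c} (h : S.Addable c) (h' : S'.Addable c)
    (e : S.add c = S'.add c) : S = S' := by
  have c1 : ∀ r, (S.add c).R r = (S'.add c).R r := by rw [e]; simp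
  have c2 : ∀ r, (S.add c).C r = (S'.add c).C r := by rw [e]; simp
  obtain ⟨R, C⟩ := S
  obtain ⟨R', C'⟩ := S'
  unfold Addable at h h'
  simp only [add] at *
  congr 1
  · funext r; have := c1 r; grind
  · funext r; have := c2 r; grind

/-- Every box of a shape lies weakly above and to the left of a corner. -/
theorem Shape.Ok.exists_corner {F : Shape} (hF : F.Ok) {b} (hb : F.Mem b) :
    ∃ c, F.Corner c ∧ b.1 ≤ c.1 ∧ b.2 ≤ c.2 := by
  obtain ⟨h1, h2, h3⟩ := hF
  obtain ⟨r, k⟩ := b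
  unfold Mem at hb
  simp only at hb
  refine ⟨(F.C (F.R r - 1) - 1, F.R r - 1), ?_⟩
  have i1 := h3 r (F.R r - 1)
  have i2 := h2 (F.R r - 1)
  have i3 := h3 (F.C (F.R r - 1) - 1) (F.R r - 1)
  have i4 := h3 (F.C (F.R r - 1) - 1) (F.R r)
  have i5 := h3 r (F.R r)
  unfold Corner
  simp only
  omega

/-- A box that is a corner of the final shape can be omitted from a trace. -/
theorem IsTrace.remove_corner {N l} (h : IsTrace N l) {c : ℕ × ℕ}
    (hc : ((Shape.base N).adds l).Corner c) (h1 : 1 ≤ c.1) :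
    ∃ k, IsTrace N k ∧ k.length + 1 = l.length ∧ ((Shape.base N).adds k).Addable c ∧
      ((Shape.base N).adds k).add c = (Shape.base N).adds l := by
  induction l using List.reverseRecOn with
  | nil =>
    unfold Shape.Corner at hc
    simp only [Shape.adds_nil, Shape.base] at hc
    grind
  | append_singleton l t ih =>
    obtain ⟨ht, ht1⟩ := h.last
    have hG := h.of_append.ok
    rw [Shape.adds_append] at hc ⊢
    simp only [Shape.adds_cons, Shape.adds_nil] at hc ⊢
    by_cases htc : t.1 = c
    · subst htc
      exact ⟨l, h.of_append, by simp, ht, rfl⟩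
    · have hf : c.1 ≠ t.1.1 ∧ c.2 ≠ t.1.2 ∧ ((Shape.base N).adds l).Corner c := by
        unfold Shape.Corner Shape.add at hc
        unfold Shape.Corner
        obtain ⟨⟨r, k⟩, q⟩ := t
        obtain ⟨r', k'⟩ := c
        simp only [Prod.mk.injEq] at *
        grind
      obtain ⟨k, hk, hlen, hkc, hadd⟩ := ih h.of_append hf.2.2
      have hkt : ((Shape.base N).adds k).Addable t.1 := by
        rw [← hadd] at ht
        unfold Shape.Addable Shape.add at ht
        unfold Shape.Addable
        simp only at ht
        grind
      refine ⟨k ++ [t], hk.snoc hkt ht1, by simp [hlen], ?_, ?_⟩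
      · simp only [Shape.adds_append, Shape.adds_cons, Shape.adds_nil]
        exact hkt.add_ne hkc htc
      · simp only [Shape.adds_append, Shape.adds_cons, Shape.adds_nil]
        rw [Shape.add_comm hf.1.symm hf.2.1.symm, hadd]

/-- Two traces of the shape `F` are joined by a sequence of traces of this shape related by
`DualStep`. -/
def Connected (N : ℕ) (F : Shape) : List Step → List Step → Prop :=
  Relation.ReflTransGen (fun a b => IsTrace N a ∧ IsTrace N b ∧ (Shape.base N).adds a = F ∧
    (Shape.base N).adds b = F ∧ ∃ i, DualStep i a b)

theorem Connected.snoc {N F l l'} (h : Connected N F l l') {t : Step} (ht : F.Addable t.1)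
    (h1 : 1 ≤ t.1.1) : Connected N (F.add t.1) (l ++ [t]) (l' ++ [t]) := by
  induction h with
  | refl => exact .refl
  | tail _ h ih =>
    obtain ⟨ha, hb, hF, hF', i, hi⟩ := h
    refine ih.tail ⟨ha.snoc (hF ▸ ht) h1, hb.snoc (hF' ▸ ht) h1, ?_, ?_, i, hi.append [t]⟩
    · simp [hF]
    · simp [hF']

theorem Connected.symm {N F l l'} (h : Connected N F l l') : Connected N F l' l := by
  induction h with
  | refl => exact .refl
  | tail _ h ih =>
    obtain ⟨ha, hb, hF, hF', i, hi⟩ := h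
    exact .head ⟨hb, ha, hF', hF, i, hi.symm⟩ ih

/-- Some trace of the shape `F` with last step `t` is connected to some trace with last step `t'`;
both have length `n + 1`. -/
def Linked (N n : ℕ) (F : Shape) (t t' : Step) : Prop :=
  ∃ m m', IsTrace N (m ++ [t]) ∧ IsTrace N (m' ++ [t']) ∧ m.length = n ∧ m'.length = n ∧
    (Shape.base N).adds (m ++ [t]) = F ∧ (Shape.base N).adds (m' ++ [t']) = F ∧
    Connected N F (m ++ [t]) (m' ++ [t'])

theorem Linked.symm {N n F t t'} (h : Linked N n F t t') : Linked N n F t' t := by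
  obtain ⟨m, m', h1, h2, h3, h4, h5, h6, h7⟩ := h
  exact ⟨m', m, h2, h1, h4, h3, h6, h5, h7.symm⟩

theorem Linked.of_dualStep {N n i F m m'} {t t' : Step} (h1 : IsTrace N (m ++ [t]))
    (h2 : IsTrace N (m' ++ [t'])) (h3 : m.length = n) (h4 : m'.length = n)
    (h5 : (Shape.base N).adds (m ++ [t]) = F) (h6 : (Shape.base N).adds (m' ++ [t']) = F)
    (h : DualStep i (m ++ [t]) (m' ++ [t'])) : Linked N n F t t' :=
  ⟨m, m', h1, h2, h3, h4, h5, h6, .single ⟨h1, h2, h5, h6, i, h⟩⟩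

theorem linked_of_dualMove {N : ℕ} {k : List Step} {t1 t2 t3 s1 s2 s3 : Step} (hk : IsTrace N k)
    (ht : ((Shape.base N).adds k).Chain [t1, t2, t3])
    (hs : ((Shape.base N).adds k).Chain [s1, s2, s3])
    (h1 : 1 ≤ t1.1.1 ∧ 1 ≤ t2.1.1 ∧ 1 ≤ t3.1.1) (h1' : 1 ≤ s1.1.1 ∧ 1 ≤ s2.1.1 ∧ 1 ≤ s3.1.1)
    (h : DualMove t1 t2 t3 s1 s2 s3) :
    Linked N (k.length + 2) ((Shape.base N).adds (k ++ [t1, t2, t3])) t3 s3 := by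
  have e : ∀ a b c : Step, (k ++ [a, b]) ++ [c] = k ++ [a, b, c] := by simp
  have i1 : IsTrace N (k ++ [t1, t2, t3]) :=
    ⟨Shape.chain_append.2 ⟨hk.chain, ht⟩, fun s hs => by
      simp only [List.mem_append, List.mem_cons, List.not_mem_nil, or_false] at hs
      rcases hs with hs | rfl | rfl | rfl
      exacts [hk.one_le s hs, h1.1, h1.2.1, h1.2.2]⟩
  have i2 : IsTrace N (k ++ [s1, s2, s3]) :=
    ⟨Shape.chain_append.2 ⟨hk.chain, hs⟩, fun s hs => by
      simp only [List.mem_append, List.mem_cons, List.not_mem_nil, or_false] at hs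
      rcases hs with hs | rfl | rfl | rfl
      exacts [hk.one_le s hs, h1'.1, h1'.2.1, h1'.2.2]⟩
  refine Linked.of_dualStep (i := k.length + 1) (m := k ++ [t1, t2]) (m' := k ++ [s1, s2])
    (by rwa [e]) (by rwa [e]) (by simp) (by simp) (by rw [e]) ?_ ?_
  · rw [e, Shape.adds_append, Shape.adds_append]
    exact h.add_eq
  · rw [e, e]
    exact .move k [] h

/-! ### Connectedness of the traces of a shape -/

open Tableau

/-- Steps at two different corners are linked: remove both corners and then a corner `e` between
them; a dual move swaps the two steps if the lane of the step at `e` lies between theirs, which is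
achieved by the choice of its prime. -/
theorem linked_of_row_lt {N : ℕ} {l : List Step} (h : IsTrace N l) {n : ℕ} (hn : l.length = n + 1)
    {c1 c2 : ℕ × ℕ} (hc1 : ((Shape.base N).adds l).Corner c1)
    (hc2 : ((Shape.base N).adds l).Corner c2) (h1 : 1 ≤ c1.1) (h12 : c1.1 < c2.1) (p1 p2 : Bool) :
    Linked N n ((Shape.base N).adds l) (c1, p1) (c2, p2) := by
  obtain ⟨k2, hk2, hl2, ha2, he2⟩ := h.remove_corner hc2 (by omega)
  have hcol : c1.2 ≠ c2.2 := by
    unfold Shape.Corner at hc1 hc2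
    intro e
    rw [e] at hc1
    omega
  have hc1' : ((Shape.base N).adds k2).Corner c1 := by
    rw [← he2] at hc1
    unfold Shape.Corner Shape.add at hc1
    unfold Shape.Corner
    simp only at hc1
    grind
  obtain ⟨k, hk, hl, ha1, he1⟩ := hk2.remove_corner hc1' h1
  have hc2G : ((Shape.base N).adds k).Addable c2 := by
    rw [← he1] at ha2
    unfold Shape.Addable Shape.add at ha2
    unfold Shape.Addable
    simp only at ha2
    grind
  have hlt := ha1.lt hk.ok hc2G h12
  have hmem : ((Shape.base N).adds k).Mem (c1.1, c2.2) := by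
    have := hc2G.1
    have := ha1.2.1
    unfold Shape.Mem; simp only; omega
  obtain ⟨e, he, hr, hc⟩ := hk.ok.exists_corner hmem
  simp only at hr hc
  have heG : ((Shape.base N).adds k).Mem e := by
    unfold Shape.Corner at he
    unfold Shape.Mem; omega
  have b1 := ha1.not_le hk.ok heG
  have b2 := hc2G.not_le hk.ok heG
  have g2 := hc2G.1
  have g0 := he.1
  obtain ⟨k0, hk0, hl0, ha0, he0⟩ := hk.remove_corner he (by omega)
  have hne : c1 ≠ c2 := fun e => hcol (by rw [e])
  have hfar : Far (c1, p1) (c2, p2) := ⟨h12.ne, hcol⟩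
  have hch1 : ∀ q p1 p2, ((Shape.base N).adds k0).Chain [(e, q), (c1, p1), (c2, p2)] := by
    intro q p1 p2
    refine ⟨ha0, ?_, ?_, trivial⟩
    · simp only [he0]; exact ha1
    · simp only [he0, he1]; exact ha2
  have hch2 : ∀ q p1 p2, ((Shape.base N).adds k0).Chain [(e, q), (c2, p2), (c1, p1)] := by
    intro q p1 p2
    refine ⟨ha0, ?_, ?_, trivial⟩
    · simp only [he0]; exact hc2G
    · simp only [he0]; exact hc2G.add_ne ha1 hne.symm
  have hlen : k0.length + 2 = n := by omega
  have hrows : 1 ≤ e.1 ∧ 1 ≤ c1.1 ∧ 1 ≤ c2.1 := by omega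
  cases p1
  · have := linked_of_dualMove hk0 (hch1 false false p2) (hch2 false false p2) hrows
      ⟨hrows.1, hrows.2.2, hrows.2.1⟩ (Or.inr (Or.inl ⟨hfar, rfl, rfl, rfl, ?_, ?_⟩))
    · rw [hlen] at this
      simpa [he0, he1, he2] using this.symm
    · unfold lane; simp; omega
    · unfold lane; simp; split_ifs <;> omega
  · have := linked_of_dualMove hk0 (hch2 true true p2) (hch1 true true p2)
      ⟨hrows.1, hrows.2.2, hrows.2.1⟩ hrows
      (Or.inr (Or.inl ⟨⟨hfar.1.symm, hfar.2.symm⟩, rfl, rfl, rfl, ?_, ?_⟩))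
    · rw [hlen] at this
      have e1 : (((Shape.base N).adds (k0 ++ [(e, true), (c2, p2), (c1, true)]))) =
          (Shape.base N).adds l := by
        simp only [Shape.adds_append, Shape.adds_cons, Shape.adds_nil, he0]
        rw [Shape.add_comm h12.ne' hcol.symm, he1, he2]
      rwa [e1] at this
    · unfold lane; simp; split_ifs <;> omega
    · unfold lane; simp; omega

/-- The two steps at the only corner are linked: its neighbours in the diagram can be taken as the
boxes of the two preceding steps, and a dual move reverses the last prime. In shapes with at most
two boxes, this is done by reversing the first or second prime. -/
theorem linked_flip {N : ℕ} {l : List Step} (h : IsTrace N l) {n : ℕ} (hn : l.length = n + 1)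
    {c : ℕ × ℕ} (hc : ((Shape.base N).adds l).Corner c) (h1 : 1 ≤ c.1)
    (huniq : ∀ c', ((Shape.base N).adds l).Corner c' → 1 ≤ c'.1 → c' = c) :
    Linked N n ((Shape.base N).adds l) (c, false) (c, true) := by
  have hF := h.ok
  have hle : ∀ b, ((Shape.base N).adds l).Mem b → 1 ≤ b.1 → b.1 ≤ c.1 ∧ b.2 ≤ c.2 := by
    intro b hb hb1
    obtain ⟨c', h2, h3, h4⟩ := hF.exists_corner hb
    obtain rfl := huniq c' h2 (by omega)
    exact ⟨h3, h4⟩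
  obtain ⟨k, hk, hl, ha, he⟩ := h.remove_corner hc h1
  have hG := hk.ok
  -- boxes weakly above and to the left of the corner are in the shape, and no others
  have hmem : ∀ x y, 1 ≤ x → x ≤ y → (y < ((Shape.base N).adds k).R x ↔
      x ≤ c.1 ∧ y ≤ c.2 ∧ ¬ (x = c.1 ∧ y = c.2)) := by
    intro x y hx hxy
    have m := hle (x, y)
    have i1 := hF.hRC x c.2
    have i2 := hc.2.2
    have i3 := hc.1
    rw [← he] at m i1 i2
    unfold Shape.Mem at m
    have ha2 := ha.2.1
    obtain ⟨ℓ, K⟩ := c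
    unfold Shape.add at m i1 i2
    simp only at *
    grind
  have hmemC : ∀ x y, 1 ≤ x → x ≤ y → (x < ((Shape.base N).adds k).C y ↔
      x ≤ c.1 ∧ y ≤ c.2 ∧ ¬ (x = c.1 ∧ y = c.2)) := by
    intro x y hx hxy
    rw [← hG.hRC x y hxy]; exact hmem x y hx hxy
  have hcc := hc.1
  have hC := hG.hC
  have hflip : ∀ (t1 t2 s1 s2 : Step), ((Shape.base N).adds k).Corner t2.1 →
      (∀ k', IsTrace N k' → ((Shape.base N).adds k').Addable t2.1 →
        ((Shape.base N).adds k').add t2.1 = (Shape.base N).adds k →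
        ((Shape.base N).adds k').Corner t1.1) →
      1 ≤ t1.1.1 → 1 ≤ t2.1.1 → s1.1 = t1.1 → s2.1 = t2.1 →
      DualMove t1 t2 (c, true) s1 s2 (c, false) →
      Linked N n ((Shape.base N).adds l) (c, false) (c, true) := by
    intro t1 t2 s1 s2 hk2 hk1 h2 h3 h4 h5 hD
    obtain ⟨k1, hk1', hl1, ha1, he1⟩ := hk.remove_corner hk2 h3
    obtain ⟨k0, hk0, hl0, ha0, he0⟩ := hk1'.remove_corner (hk1 k1 hk1' ha1 he1) h2
    have hch : ∀ p1 p2 p3, ((Shape.base N).adds k0).Chain [(t1.1, p1), (t2.1, p2), (c, p3)] := by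
      intro p1 p2 p3
      refine ⟨ha0, ?_, ?_, trivial⟩
      · simp only [he0]; exact ha1
      · simp only [he0, he1]; exact ha
    obtain ⟨b1, p1⟩ := s1
    obtain ⟨b2, p2⟩ := s2
    simp only at h4 h5
    subst h4 h5
    have := linked_of_dualMove hk0 (hch t1.2 t2.2 true) (hch p1 p2 false) ⟨h2, h3, h1⟩ ⟨h2, h3, h1⟩
        hD
    rw [show k0.length + 2 = n by omega] at this
    simpa [he0, he1, he] using this.symm
  obtain ⟨ℓ, K⟩ := c
  simp only at hcc h1
  have hK1 := ha.2.1
  have hK2 := ha.2.2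
  simp only at hK1 hK2
  by_cases hℓ : 2 ≤ ℓ
  · have m1 := hmem (ℓ - 1) K
    have m2 := hmem (ℓ - 1) (K + 1)
    have hcorner : ((Shape.base N).adds k).Corner (ℓ - 1, K) := by
      unfold Shape.Corner; simp only at *; omega
    by_cases hK : ℓ < K
    · refine hflip ((ℓ, K - 1), false) ((ℓ - 1, K), false) ((ℓ, K - 1), false) ((ℓ - 1, K), true)
        hcorner ?_ h1 (by simp only; omega) rfl rfl (Or.inr (Or.inr (Or.inr (Or.inl ?_))))
      · intro k' hk' ha' he'
        have m3 := hmemC ℓ (K - 1)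
        have m4 := hmemC (ℓ + 1) (K - 1)
        have m5 := hC (K - 1)
        rw [← he'] at m3 m4 m5 hK1
        unfold Shape.Corner
        unfold Shape.add at m3 m4 m5 hK1
        simp only at *
        rw [if_neg (by omega)] at m3 m4 m5 hK1
        omega
      · refine ⟨⟨?_, ?_, Or.inr rfl⟩, rfl, rfl, rfl, rfl, rfl, ?_, ?_⟩
        · simp only; omega
        · simp only; omega
        · simp only [lane, Bool.false_eq_true, if_false]; omega
        · simp only [lane, Bool.false_eq_true, if_false, if_true]; omega
    · obtain rfl : ℓ = K := by omega
      refine hflip ((ℓ - 1, ℓ - 1), false) ((ℓ - 1, ℓ), false) ((ℓ - 1, ℓ - 1), true)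
        ((ℓ - 1, ℓ), true) hcorner ?_ (by simp only; omega) (by simp only; omega) rfl rfl
        (Or.inr (Or.inr (Or.inr (Or.inr ?_))))
      · intro k' hk' ha' he'
        have m3 := hmemC (ℓ - 1) (ℓ - 1)
        have m5 := hC (ℓ - 1)
        have m6 := ha'.2.1
        rw [← he'] at m3 m5
        unfold Shape.Corner
        unfold Shape.add at m3 m5
        simp only at *
        rw [if_neg (by omega)] at m3 m5
        omega
      · refine ⟨rfl, ?_, ?_, rfl, rfl, rfl, rfl⟩
        · exact Prod.ext rfl (show ℓ = ℓ - 1 + 1 by omega)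
        · exact Prod.ext (show ℓ = ℓ - 1 + 1 by omega) (show ℓ = ℓ - 1 + 1 by omega)
  · obtain rfl : ℓ = 1 := by omega
    by_cases hK : 3 ≤ K
    · refine hflip ((1, K - 2), false) ((1, K - 1), false) ((1, K - 2), false) ((1, K - 1), true)
        ?_ ?_ le_rfl le_rfl rfl rfl (Or.inr (Or.inr (Or.inr (Or.inl ?_))))
      · have m3 := hmemC 1 (K - 1)
        have m4 := hmemC 2 (K - 1)
        unfold Shape.Corner; simp only at *; omega
      · intro k' hk' ha' he'
        have m3 := hmemC 1 (K - 2)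
        have m4 := hmemC 2 (K - 2)
        have m5 := hC (K - 2)
        have m6 := ha'.2.1
        rw [← he'] at m3 m4 m5
        unfold Shape.Corner
        unfold Shape.add at m3 m4 m5
        simp only at *
        rw [if_neg (by omega)] at m3 m4 m5
        omega
      · refine ⟨⟨?_, ?_, Or.inl rfl⟩, rfl, rfl, rfl, rfl, rfl, ?_, ?_⟩
        · simp only; omega
        · simp only; omega
        · simp only [lane, Bool.false_eq_true, if_false]; omega
        · simp only [lane, Bool.false_eq_true, if_false, if_true]; omega
    · have htr : ∀ q, IsTrace N (k ++ [((1, K), q)]) := fun q => hk.snoc ha le_rfl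
      have hsh : ∀ q, (Shape.base N).adds (k ++ [((1, K), q)]) = (Shape.base N).adds l := by
        intro q; simpa using he
      have hlen : k.length = n := by omega
      have hlink : ∀ i, DualStep i (k ++ [((1, K), false)]) (k ++ [((1, K), true)]) →
          Linked N n ((Shape.base N).adds l) ((1, K), false) ((1, K), true) := fun i hi =>
        Linked.of_dualStep (htr _) (htr _) hlen hlen (hsh _) (hsh _) hi
      match k, htr, hlink with
      | [], _, hlink => exact hlink _ (.first _ _ _)
      | [t], _, hlink => exact hlink _ (.second _ _ _ _)
      | t :: s :: k, htr, _ =>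
        exfalso
        have h3 := (htr true).first_box
        have h4 := (htr true).second_box
        have h5 := (htr true).nodup
        have h6 : (1, K) ≠ t.1 ∧ (1, K) ≠ s.1 := by
          simp only [List.cons_append, List.map_cons, List.map_append, List.nodup_cons,
            List.mem_cons, List.mem_append, List.map_nil, not_or] at h5
          exact ⟨fun e => h5.1.2.2.1 e.symm, fun e => h5.2.1.2.1 e.symm⟩
        rw [h3, h4] at h6
        have h7 : K ≠ 1 := fun e => h6.1 (by rw [e])
        have h8 : K ≠ 2 := fun e => h6.2 (by rw [e])
        omega

/-- Links can be composed if shorter traces of the same shape are connected. -/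
theorem Linked.trans {N n F} {t u v : Step}
    (ih : ∀ m m', IsTrace N m → IsTrace N m' → m.length = n → m'.length = n →
      (Shape.base N).adds m = (Shape.base N).adds m' →
      Connected N ((Shape.base N).adds m) m m')
    (h : Linked N n F t u) (h' : Linked N n F u v) : Linked N n F t v := by
  obtain ⟨m, m', h1, h2, h3, h4, h5, h6, h7⟩ := h
  obtain ⟨k, k', g1, g2, g3, g4, g5, g6, g7⟩ := h'
  refine ⟨m, k', h1, g2, h3, g4, h5, g6, (h7.trans ?_).trans g7⟩
  rw [Shape.adds_append] at h6 g5
  have e := Shape.eq_of_add_eq h2.last.1 g1.last.1 (h6.trans g5.symm)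
  have := (ih m' k h2.of_append g1.of_append h4 g3 e).snoc h2.last.1 h2.last.2
  rwa [show ((Shape.base N).adds m').add u.1 = F from h6] at this

/-- Any two traces of the same shape are connected. By induction it is enough to link their last
steps. -/
theorem connected_of_adds_eq {N : ℕ} {l l' : List Step} (h : IsTrace N l) (h' : IsTrace N l')
    (hlen : l.length = l'.length) (hF : (Shape.base N).adds l = (Shape.base N).adds l') :
    Connected N ((Shape.base N).adds l) l l' := by
  induction hn : l.length generalizing l l' with
  | zero =>
    rw [List.length_eq_zero_iff.1 hn, List.length_eq_zero_iff.1 (hlen.symm.trans hn)]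
    exact .refl
  | succ n ih =>
    have ih' : ∀ m m', IsTrace N m → IsTrace N m' → m.length = n → m'.length = n →
        (Shape.base N).adds m = (Shape.base N).adds m' →
        Connected N ((Shape.base N).adds m) m m' :=
      fun m m' h1 h2 h3 h4 h5 => ih h1 h2 (h3.trans h4.symm) h5 h3
    have hcor : ∀ {c p k}, IsTrace N (k ++ [(c, p)]) →
        ((Shape.base N).adds (k ++ [(c, p)])).Corner c := by
      intro c p k hk
      rw [Shape.adds_append]
      exact hk.last.1.corner
    obtain ⟨k, ⟨c, p⟩, rfl⟩ := (List.eq_nil_or_concat' l).resolve_left (by rintro rfl; simp at hn)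
    obtain ⟨k', ⟨c', p'⟩, rfl⟩ :=
      (List.eq_nil_or_concat' l').resolve_left (by rintro rfl; simp [hn] at hlen)
    have hc := hcor h
    have hc' := hF ▸ hcor h'
    have hc1 := h.last.2
    have hc1' := h'.last.2
    -- the two last steps are linked
    have hne : ∀ {a a' r r'}, ((Shape.base N).adds (k ++ [(c, p)])).Corner a →
        ((Shape.base N).adds (k ++ [(c, p)])).Corner a' → 1 ≤ a.1 → 1 ≤ a'.1 → a ≠ a' →
        Linked N n ((Shape.base N).adds (k ++ [(c, p)])) (a, r) (a', r') := by
      intro a a' r r' h1 h2 h3 h4 hne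
      have hrow : a.1 ≠ a'.1 := by
        intro e
        refine hne (Prod.ext e ?_)
        have := h1.2.1
        have := h2.2.1
        rw [e] at *
        omega
      rcases lt_or_gt_of_ne hrow with hlt | hlt
      · exact linked_of_row_lt h hn h1 h2 h3 hlt _ _
      · exact (linked_of_row_lt h hn h2 h1 h4 hlt _ _).symm
    have hflip : ∀ {c₀}, ((Shape.base N).adds (k ++ [(c, p)])).Corner c₀ → 1 ≤ c₀.1 → ∀ q q',
        q ≠ q' →
        Linked N n ((Shape.base N).adds (k ++ [(c, p)])) (c₀, q) (c₀, q') := by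
      intro c₀ h1 h2 q q' hq
      have key : Linked N n ((Shape.base N).adds (k ++ [(c, p)])) (c₀, false) (c₀, true) := by
        by_cases hu : ∀ c', ((Shape.base N).adds (k ++ [(c, p)])).Corner c' → 1 ≤ c'.1 → c' = c₀
        · exact linked_flip h hn h1 h2 hu
        · push Not at hu
          obtain ⟨c', h3, h4, h5⟩ := hu
          exact Linked.trans ih' (hne (r' := false) h1 h3 h2 h4 h5.symm) (hne h3 h1 h4 h2 h5)
      cases q <;> cases q'
      exacts [absurd rfl hq, key, key.symm, absurd rfl hq]
    have finish : Linked N n ((Shape.base N).adds (k ++ [(c, p)])) (c, p) (c', p') →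
        Connected N ((Shape.base N).adds (k ++ [(c, p)])) (k ++ [(c, p)]) (k' ++ [(c', p')]) := by
      rintro ⟨m, m', h1, h2, h3, h4, h5, h6, h7⟩
      have hk : k.length = n := by simpa using hn
      have hk' : k'.length = n := by simp at hn hlen; omega
      have h5' := h5
      have h6' := h6.trans hF
      rw [Shape.adds_append, Shape.adds_append] at h5' h6'
      have e1 := Shape.eq_of_add_eq h.last.1 h1.last.1 h5'.symm
      have e2 := Shape.eq_of_add_eq h2.last.1 h'.last.1 h6'
      have g1 := (ih' k m h.of_append h1.of_append hk h3 e1).snoc h.last.1 hc1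
      have g2 := (ih' m' k' h2.of_append h'.of_append h4 hk' e2).snoc h2.last.1 hc1'
      rw [show ((Shape.base N).adds k).add c = (Shape.base N).adds (k ++ [(c, p)]) by simp] at g1
      rw [show ((Shape.base N).adds m').add c' = (Shape.base N).adds (k ++ [(c, p)]) from
        (by simp : _ = (Shape.base N).adds (m' ++ [(c', p')])).trans h6] at g2
      exact (g1.trans h7).trans g2
    by_cases hcc : c = c'
    · subst hcc
      by_cases hp : p = p'
      · subst hp
        rw [Shape.adds_append, Shape.adds_append] at hF
        have e := Shape.eq_of_add_eq h.last.1 h'.last.1 hF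
        have := (ih' k k' h.of_append h'.of_append (by simpa using hn) (by simp at hn hlen; omega)
          e).snoc h.last.1 hc1
        simpa using this
      · exact finish (hflip hc hc1 p p' hp)
    · exact finish (hne hc hc' hc1 hc1' hcc)

/-! ### Orthogonal Knuth operators -/

open Tableau

theorem Inserted.isTrace {a : Word} (ha : IsPartialSignedPerm a) {T l} (h : Inserted ∅ a T l)
    {N : ℕ} (hN : a.length + 2 < N) : IsTrace N l := by
  obtain ⟨T', l', h1, -, h3⟩ := exists_inserted a ha
  obtain ⟨-, rfl⟩ := h.det h1
  exact ⟨h3 N hN, h.one_le⟩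

theorem Inserted.ascents {a : Word} (ha : IsPartialSignedPerm a) {T l} (h : Inserted ∅ a T l) :
    Ascents (a.map Letter.val) l := by
  obtain ⟨T', l', h1, h2, -⟩ := exists_inserted a ha
  obtain ⟨-, rfl⟩ := h.det h1
  exact h2

theorem recTab_inj {l l' : List Step} (h : (l.map Prod.fst).Nodup) (h' : (l'.map Prod.fst).Nodup)
    (hlen : l.length = l'.length) (e : recTab l = recTab l') : l = l' := by
  refine List.ext_getElem hlen fun j hj hj' => ?_
  have h1 : l = l.take j ++ l[j] :: l.drop (j + 1) := by simp
  have e1 : (recTab l).entry (l[j]).1 = ⟨(l.take j).length + 1, (l[j]).2⟩ := by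
    have := recTab_entry (h1 ▸ h)
    rwa [← h1] at this
  have hmem : (l[j]).1 ∈ (recTab l').keys := by
    rw [← e]; exact mem_recTab_keys.2 ⟨l[j], by simp, rfl⟩
  obtain ⟨t, ht, htb⟩ := mem_recTab_keys.1 hmem
  obtain ⟨u, v, rfl⟩ := List.append_of_mem ht
  have e2 := recTab_entry h'
  rw [htb, ← e, e1] at e2
  obtain ⟨h3, h4⟩ := Letter.mk.inj e2
  have hu : u.length = j := by simp at h3; omega
  subst hu
  simp only [List.getElem_append_right, le_refl, Nat.sub_self, List.getElem_cons_zero]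
  exact Prod.ext htb.symm h4

theorem Inserts.empty (v : ℤ) (p : Bool) :
    Inserts ∅ .row 1 ⟨v, p⟩ ((∅ : Tableau).set (1, 1) ⟨v, false⟩) ((1, 1), p) := by
  have := Inserts.max_row (hasShape_empty 3) (Shape.base_ok 3) (valsLT_empty v) le_rfl p
  simpa [Shape.base] using this

/-- The words `vw` and `wv` with the same sequence of primes have the same insertion tableau, and
their traces differ in the prime of the second step. -/
theorem inserted_pair {v w : ℤ} (h : v < w) (p q : Bool) :
    ∃ T, Inserted ∅ [⟨v, p⟩, ⟨w, q⟩] T [((1, 1), p), ((1, 2), false)] ∧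
      Inserted ∅ [⟨w, p⟩, ⟨v, q⟩] T [((1, 1), p), ((1, 2), true)] := by
  have hB := Shape.base_ok 5
  have hb : (Shape.base 5).Addable (1, 1) := by simp [Shape.Addable, Shape.base]
  have hE := hasShape_empty 5
  have hM := valsLT_empty w
  refine ⟨((∅ : Tableau).set (1, 1) ⟨v, false⟩).set (1, 2) ⟨w, q⟩,
    .cons (.empty v p) (.cons ?_ (.nil _)), .cons (.empty w p) (.cons ?_ (.nil _))⟩
  · have := Inserts.max_row (hE.set_addable (u := ⟨v, false⟩) hb le_rfl) (hB.add hb)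
      (hM.set (b := (1, 1)) (u := ⟨v, false⟩) h) (k := 1) le_rfl q
    simpa [Shape.base, Shape.add] using this
  · obtain ⟨b', p', t', h1, h2⟩ := (Inserts.empty v q).push hE hB hM h le_rfl hb le_rfl hb
      (by simp [Shape.base]) (p := false) (fun _ => rfl)
    rcases h2 with ⟨h2, -⟩ | ⟨-, h2, h3, h4 | h4 | h4⟩
    · exact absurd rfl h2
    · obtain ⟨-, h5, h6, h7, rfl⟩ := h4
      obtain ⟨c, d⟩ := t'
      have hb' : b' = (1, 2) := by
        have := h3.2.2
        obtain ⟨x, y⟩ := b'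
        simp only [Shape.add, Shape.base] at *
        subst h5
        simp at this
        rw [← this]
      simp only at h2 h7
      subst h2 h7
      rw [hb'] at h1
      exact h1
    · exact absurd h4.1 (lt_irrefl _)
    · exact absurd h4.1 (lt_irrefl _)

theorem IsPartialSignedPerm.of_perm {a b : Word} (h : IsPartialSignedPerm a)
    (hab : (a.map Letter.val).Perm (b.map Letter.val)) : IsPartialSignedPerm b :=
  hab.nodup_iff.1 h

theorem Letter.unprime_le_iff {x y : Letter} (h : x.val ≠ y.val) : x.unprime ≤ y ↔ x.val < y.val :=
    by
  rw [Letter.le_iff_twice]; unfold unprime twice; simp only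
  split_ifs <;> omega

theorem Letter.lt_unprime_iff {x y : Letter} (h : x.val ≠ y.val) : x < y.unprime ↔ x.val < y.val :=
    by
  rw [Letter.lt_iff_twice]; unfold unprime twice; simp only
  split_ifs <;> omega

/-- On three letters with distinct values, `okn` is a Knuth move in one direction or the other,
unless the values are monotone, in which case nothing changes. -/
theorem okn_triple (x y z : Letter) (hxy : x.val ≠ y.val) (hxz : x.val ≠ z.val)
    (hyz : y.val ≠ z.val) :
    (∃ x' y' z', okn [x, y, z] = [x', y', z'] ∧
      (KnuthMove x y z x' y' z' ∨ KnuthMove x' y' z' x y z)) ∨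
    (okn [x, y, z] = [x, y, z] ∧ ((x.val < y.val ∧ y.val < z.val) ∨ (z.val < y.val ∧
        y.val < x.val))) := by
  have e : okn [x, y, z] = if (x.unprime ≤ z ∧ z < y.unprime) ∨ (y.unprime ≤ z ∧ z < x.unprime) then
      [y, x, z] else if (y < x.unprime ∧ x.unprime ≤ z) ∨ (z < x.unprime ∧ x.unprime ≤ y) then
      [x, z, y] else [x, y, z] := rfl
  simp only [Letter.unprime_le_iff hxz, Letter.lt_unprime_iff hyz.symm, Letter.unprime_le_iff hyz,
    Letter.lt_unprime_iff hxz.symm, Letter.lt_unprime_iff hxy.symm,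
    Letter.unprime_le_iff hxy] at e
  rw [e]
  unfold KnuthMove
  split_ifs with h3 h4
  · left
    refine ⟨y, x, z, rfl, ?_⟩
    rcases h3 with h3 | h3
    · exact Or.inl (Or.inl ⟨h3.1, h3.2, rfl, rfl, rfl⟩)
    · exact Or.inr (Or.inl ⟨h3.1, h3.2, rfl, rfl, rfl⟩)
  · left
    refine ⟨x, z, y, rfl, ?_⟩
    rcases h4 with h4 | h4
    · exact Or.inr (Or.inr ⟨h4.1, h4.2, rfl, rfl, rfl⟩)
    · exact Or.inl (Or.inr ⟨h4.1, h4.2, rfl, rfl, rfl⟩)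
  · right
    exact ⟨rfl, by omega⟩

/-- The orthogonal Knuth operators preserve the insertion tableau, and act on the recording tableau
by the dual equivalence operators. -/
theorem Inserted.exists_oknAt {a : Word} (ha : IsPartialSignedPerm a) {T l} (h : Inserted ∅ a T l)
    (i : ℤ) :
    IsPartialSignedPerm (oknAt i a) ∧ ∃ l', Inserted ∅ (oknAt i a) T l' ∧
      recTab l' = dOp i (recTab l) := by
  have hlen := h.length_eq
  have htr := h.isTrace ha (N := a.length + 3) (by omega)
  have hsz := recTab_size htr.nodup
  unfold oknAt
  by_cases hi : 1 ≤ i + 2 ∧ i + 2 ≤ a.length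
  swap
  · rw [if_neg hi]
    refine ⟨ha, l, h, ?_⟩
    unfold dOp
    rw [hsz, hlen, if_neg hi]
  rw [if_pos hi]
  -- two words with the same insertion tableau whose traces are related by a dual move
  have finish : ∀ {b : Word} {l'}, (a.map Letter.val).Perm (b.map Letter.val) →
      Inserted ∅ b T l' → DualStep i l l' → IsPartialSignedPerm b ∧ ∃ l', Inserted ∅ b T l' ∧
      recTab l' = dOp i (recTab l) := by
    intro b l' hp hI hD
    have hb := ha.of_perm hp
    have hba : b.length = a.length := by simpa using hp.length_eq.symm
    exact ⟨hb, l', hI, (hD.dOp_recTab htr (hI.isTrace hb (by omega))).symm⟩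
  split_ifs with h1 h2
  · subst h1
    match a with
    | [] => simp at hi
    | x :: w =>
      obtain ⟨T1, l1, l2, rfl, g1, g2⟩ := h.split (w := [x])
      obtain ⟨rfl, rfl⟩ := g1.det (.cons (.empty x.val x.primed) (.nil _))
      refine finish (b := x.reverse :: w) (by simp [Letter.reverse])
        (Inserted.append (w := [x.reverse]) (.cons (.empty x.val (!x.primed)) (.nil _)) g2)
        (.first _ _ _)
  · subst h2
    match a with
    | [] => simp at hi
    | [x] => simp at hi
    | x :: y :: w =>
      have hxy : x.val ≠ y.val := by
        intro e
        unfold IsPartialSignedPerm at ha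
        simp [e] at ha
      obtain ⟨T1, l1, l2, rfl, g1, g2⟩ := h.split (w := [x, y])
      have e : okn ((x :: y :: w).take 2) ++ (x :: y :: w).drop 2 =
          [⟨y.val, x.primed⟩, ⟨x.val, y.primed⟩] ++ w := by
        simp [okn, hxy]
      rw [e]
      have hperm : ((x :: y :: w).map Letter.val).Perm
          ((([⟨y.val, x.primed⟩, ⟨x.val, y.primed⟩] ++ w : Word)).map Letter.val) :=
              List.Perm.swap _ _ _
      rcases lt_or_gt_of_ne hxy with hlt | hlt
      · obtain ⟨T2, k1, k2⟩ := inserted_pair hlt x.primed y.primed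
        obtain ⟨rfl, rfl⟩ := g1.det k1
        exact finish hperm (k2.append g2) (.second _ _ _ _)
      · obtain ⟨T2, k1, k2⟩ := inserted_pair hlt x.primed y.primed
        obtain ⟨rfl, rfl⟩ := g1.det k2
        exact finish hperm (k1.append g2) (.second _ _ _ _)
  · obtain ⟨n, rfl⟩ : ∃ n : ℕ, i = n + 1 := ⟨(i - 1).toNat, by omega⟩
    obtain ⟨u, v, rfl, hu, hv⟩ := List.append_eq_of_length
      (show a.length = n + (3 + (a.length - (n + 3))) by omega)
    match v, hv with
    | [], hv => simp at hv; omega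
    | [_], hv => simp at hv; omega
    | [_, _], hv => simp at hv; omega
    | x :: y :: z :: w, hv =>
      have en : ((n : ℤ) + 1).toNat - 1 = u.length := by omega
      have en' : ((n : ℤ) + 1).toNat + 2 = u.length + 3 := by omega
      rw [en, en']
      have e : (u ++ x :: y :: z :: w).take u.length ++
          okn (((u ++ x :: y :: z :: w).drop u.length).take 3) ++
          (u ++ x :: y :: z :: w).drop (u.length + 3) = u ++ okn [x, y, z] ++ w := by
        rw [List.take_left, List.drop_left, List.drop_append]
        simp
      rw [e]
      have hnod : x.val ≠ y.val ∧ x.val ≠ z.val ∧ y.val ≠ z.val := by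
        have h3 := ha
        unfold IsPartialSignedPerm at h3
        rw [List.map_append, List.nodup_append] at h3
        have h4 := h3.2.1
        simp only [List.map_cons, List.nodup_cons, List.mem_cons, not_or] at h4
        exact ⟨h4.1.1, h4.1.2.1, h4.2.1.1⟩
      subst hu
      rcases okn_triple x y z hnod.1 hnod.2.1 hnod.2.2 with ⟨x', y', z', e2, hK⟩ | ⟨e2, hmono⟩
      · rw [e2]
        have e3 : u ++ [x', y', z'] ++ w = u ++ x' :: y' :: z' :: w := by simp
        rw [e3]
        have hperm : ((u ++ x :: y :: z :: w).map Letter.val).Perm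
            ((u ++ x' :: y' :: z' :: w).map Letter.val) := by
          refine List.Perm.map _ (List.Perm.append_left _ ?_)
          rcases hK with hK | hK <;>
            rcases hK with ⟨-, -, rfl, rfl, rfl⟩ | ⟨-, -, rfl, rfl, rfl⟩
          · exact List.Perm.swap _ _ _
          · exact List.Perm.cons _ (List.Perm.swap _ _ _)
          · exact List.Perm.swap _ _ _
          · exact List.Perm.cons _ (List.Perm.swap _ _ _)
        rcases hK with hK | hK
        · obtain ⟨T', l1, t1, t2, t3, l2, s1, s2, s3, k1, k2, k3, k4⟩ := hK.exists_dualMove ha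
          obtain ⟨rfl, rfl⟩ := h.det k2
          refine finish hperm k3 ?_
          rw [← k1]
          exact .move _ _ k4
        · obtain ⟨T', l1, t1, t2, t3, l2, s1, s2, s3, k1, k2, k3, k4⟩ :=
            hK.exists_dualMove (ha.of_perm hperm)
          obtain ⟨rfl, rfl⟩ := h.det k3
          refine finish hperm k2 ?_
          rw [← k1]
          exact .move_symm _ _ k4
      · rw [e2]
        have e3 : u ++ [x, y, z] ++ w = u ++ x :: y :: z :: w := by simp
        rw [e3]
        refine ⟨ha, l, h, ?_⟩
        have hasc := h.ascents ha
        have hl : l.length = u.length + (w.length + 3) := by simpa using hlen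
        obtain ⟨l1, l2, rfl, k1, k2⟩ := List.append_eq_of_length hl
        match l2, k2 with
        | t1 :: t2 :: t3 :: l2, _ =>
          rw [List.map_append] at hasc
          have h3 := hasc.of_append (by simp [k1])
          have h4 := h3.1
          have h5 := h3.2.1
          rw [← k1, htr.dOp_eq rfl, if_neg (by omega), if_neg (by omega)]

theorem Inserted.keys_eq {T w T' l} (h : Inserted T w T' l) :
    T'.keys = T.keys ∪ (l.map Prod.fst).toFinset := by
  induction h with
  | nil => simp
  | cons h1 _ ih => rw [ih, h1.keys_eq]; ext c; simp

theorem IsTrace.adds_R_zero {N l} (h : IsTrace N l) : ((Shape.base N).adds l).R 0 = N := by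
  induction l using List.reverseRecOn with
  | nil => simp [Shape.base]
  | append_singleton l t ih =>
    have h1 := h.last.2
    have h2 := ih h.of_append
    rw [Shape.adds_append]
    simp only [Shape.adds_cons, Shape.adds_nil, Shape.add]
    rw [if_neg (by omega), h2]

theorem Tableau.HasShape.unique {T : Tableau} {S S' : Shape} (h : T.HasShape S)
    (h' : T.HasShape S') (hS : S.Ok) (hS' : S'.Ok) (h0 : S.R 0 = S'.R 0) : S = S' := by
  have hR : ∀ r, S.R r = S'.R r := by
    intro r
    rcases Nat.eq_zero_or_pos r with rfl | hr
    · exact h0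
    have h1 := hS.hR r
    have h2 := hS'.hR r
    have h3 : ∀ k, r ≤ k → (k < S.R r ↔ k < S'.R r) := by
      intro k hk
      have := (h (r, k)).symm.trans (h' (r, k))
      unfold Shape.Mem at this
      simp only at this
      constructor <;> intro h4 <;> tauto
    have h4 := h3 (S.R r) h1
    have h5 := h3 (S'.R r) h2
    omega
  have hC : ∀ k, S.C k = S'.C k := by
    intro k
    have h1 := hS.hC k
    have h2 := hS'.hC k
    have h3 : ∀ r, r ≤ k → (r < S.C k ↔ r < S'.C k) := by
      intro r hr
      rw [← hS.hRC r k hr, ← hS'.hRC r k hr, hR]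
    have h4 := h3 (S.C k)
    have h5 := h3 (S'.C k)
    omega
  obtain ⟨R, C⟩ := S
  obtain ⟨R', C'⟩ := S'
  congr 1
  · exact funext hR
  · exact funext hC

theorem ShK.invariant {a b : Word} (h : ShK a b) (ha : IsPartialSignedPerm a) :
    IsPartialSignedPerm b ∧ PSW a = PSW b := by
  have step : ∀ {a : Word} (i : ℤ), IsPartialSignedPerm a →
      IsPartialSignedPerm (oknAt i a) ∧ PSW a = PSW (oknAt i a) := by
    intro a i ha
    obtain ⟨T, l, h, -⟩ := exists_inserted a ha
    obtain ⟨h1, l', h2, -⟩ := h.exists_oknAt ha i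
    exact ⟨h1, h.sw_eq.1.trans h2.sw_eq.1.symm⟩
  induction h with
  | single h => obtain ⟨i, rfl⟩ := h; exact step i ha
  | tail _ h ih =>
    obtain ⟨i, rfl⟩ := h
    obtain ⟨h1, h2⟩ := step i ih.1
    exact ⟨h1, ih.2.trans h2⟩

/-- A path between traces lifts to a path between words. -/
theorem Connected.exists_word {N F l l'} (h : Connected N F l l') {a : Word}
    (ha : IsPartialSignedPerm a) {T} (hI : Inserted ∅ a T l) :
    ∃ b, IsPartialSignedPerm b ∧ Relation.ReflTransGen (fun a b => ∃ i : ℤ, b = oknAt i a) a b ∧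
      Inserted ∅ b T l' := by
  induction h with
  | refl => exact ⟨a, ha, .refl, hI⟩
  | @tail _ c _ h ih =>
    obtain ⟨b, hb, hab, hIb⟩ := ih
    obtain ⟨h1, h2, -, -, i, hi⟩ := h
    obtain ⟨hb', l2, hI2, e⟩ := hIb.exists_oknAt hb i
    refine ⟨_, hb', hab.tail ⟨i, rfl⟩, ?_⟩
    rw [hi.dOp_recTab h1 h2] at e
    have hn2 := (hI2.isTrace hb' (N := _) (Nat.lt_succ_self _)).nodup
    have hlen : l2.length = c.length := by
      rw [← recTab_size hn2, e, recTab_size h2.nodup]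
    rwa [recTab_inj hn2 h2.nodup hlen e] at hI2

theorem shK_of_PSW_eq {a b : Word} (ha : IsPartialSignedPerm a) (hb : IsPartialSignedPerm b)
    (h : PSW a = PSW b) : ShK a b := by
  obtain ⟨T, l, hI, -⟩ := exists_inserted a ha
  obtain ⟨T', l', hI', -⟩ := exists_inserted b hb
  rw [hI.sw_eq.1, hI'.sw_eq.1] at h
  subst h
  have hlen : l.length = l'.length := by
    have h1 := hI.keys_eq
    rw [hI'.keys_eq] at h1
    have n1 := (hI.isTrace ha (Nat.lt_succ_self _)).nodup
    have n2 := (hI'.isTrace hb (Nat.lt_succ_self _)).nodup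
    have := congrArg Finset.card h1
    simp only [Finmap.keys_empty, Finset.empty_union] at this
    rw [List.toFinset_card_of_nodup n1, List.toFinset_card_of_nodup n2] at this
    simpa using this.symm
  have hab : a.length = b.length := hI.length_eq.symm.trans (hlen.trans hI'.length_eq)
  have htr := hI.isTrace ha (N := a.length + 3) (by omega)
  have htr' := hI'.isTrace hb (N := a.length + 3) (by omega)
  have hF := (hI.hasShape (hasShape_empty _) htr.chain).unique
    (hI'.hasShape (hasShape_empty _) htr'.chain) htr.ok htr'.ok
    (htr.adds_R_zero.trans htr'.adds_R_zero.symm)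
  obtain ⟨c, hc, hac, hIc⟩ := (connected_of_adds_eq htr htr' hlen hF).exists_word ha hI
  obtain rfl := hIc.inj hc hb hI'
  -- the operators with an index out of range fix every word
  refine Relation.TransGen.head' (b := a) ⟨-2, ?_⟩ hac
  unfold oknAt
  rw [if_neg (by omega)]

end PrimedSW

theorem corollary5p12 (a b : PrimedSW.Word)
    (ha : PrimedSW.IsPartialSignedPerm a) (hb : PrimedSW.IsPartialSignedPerm b) :
    (PrimedSW.ShK a b ↔ PrimedSW.PSW a = PrimedSW.PSW b) ∧
      ∀ i : ℤ, PrimedSW.QSW (PrimedSW.oknAt i a) =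
        PrimedSW.Tableau.dOp i (PrimedSW.QSW a) := by
  refine ⟨⟨fun h => (h.invariant ha).2, PrimedSW.shK_of_PSW_eq ha hb⟩, fun i => ?_⟩
  obtain ⟨T, l, h, -⟩ := PrimedSW.exists_inserted a ha
  obtain ⟨-, l', h', e⟩ := h.exists_oknAt ha i
  rw [h.sw_eq.2, h'.sw_eq.2, e]
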